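/- Let $d\ge 1$ and let $\mu$ be a probability measure on $\mathbb{R}$ with all moments finite, such that for some constants $C,a\ge 1$ $$\int |x|^k\,d\mu(x)\le C\,a^k k^k\qquad\text{for all } k\in\mathbb{N}\quad(0^0=1).$$ Let $\Omega=\mathbb{R}^{\mathbb{Z}^d}$ and $\mathbb{P}=\bigotimes_{n\in\mathbb{Z}^d}\mu$. For $\omega\in\Omega$ let $H^\omega$ be the self-adjoint operator on $\ell^2(\mathbb{Z}^d)$ given by $$(H^\omega u)(n)=\sum_{|k-n|_1=1}u(k)+\omega_n u(n),$$ with its maximal domain $\{u\in\ell^2(\mathbb{Z}^d):H^\omega u\in\ell^2(\mathbb{Z}^d)\}$. For $L\in\mathbb{N}$ let $\Lambda_L=\{n\in\mathbb{Z}^d:|n_i|\le L\text{ for all } i\}$, and let $H^\omega_L=(\langle\delta_n,H^\omega\delta_m\rangle)_{n,m\in\Lambda_L}$ be the restriction of $H^\omega$ to $\ell^2(\Lambda_L)$, where $\{\delta_n\}$ is the standard basis. Then there is a measurable set $\tilde\Omega\subset\Omega$ with $\mathbb{P}(\tilde\Omega)=1$ such that the following holds for every continuous $f:\mathbb{R}\to\mathbb{R}$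 for which there is a polynomial $P$ with $|f(x)|\le P(x)$ for all $x\in\mathbb{R}$: for every $\omega\in\Omega$ the vector $\delta_0$ lies in the domain of $f(H^\omega)$ (that is, $f$ is square-integrable for the spectral measure of $H^\omega$ at $\delta_0$), the random variable $\omega\mapsto\langle\delta_0,f(H^\omega)\delta_0\rangle$ is $\mathbb{P}$-integrable, and $$\frac{1}{|\Lambda_L|}\operatorname{Tr} f(H^\omega_L)=\frac{1}{|\Lambda_L|}\sum_{n\in\Lambda_L}\langle\delta_n,f(H^\omega_L)\delta_n\rangle\;\xrightarrow[L\to\infty]{}\;\mathbb{E}\big(\langle\delta_0,f(H^\omega)\delta_0\rangle\big)\qquad\text{for all }\omega\in\tilde\Omega.$$ Here $f(H^\omega)$ and $f(H^\omega_L)$ are defined by the functional calculus of self-adjoint operators. -/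

import Mathlib

open MeasureTheory Filter Topology

noncomputable section

/-! ### Spectral measures of (possibly unbounded) self-adjoint operators -/

/-- A projection-valued measure on the Borel sets of `ℝ`, acting on a complex Hilbert space. (The
values on non-measurable sets carry no information.) -/
structure ProjValuedMeasure (E : Type*) [NormedAddCommGroup E] [InnerProductSpace ℂ E]
    [CompleteSpace E] where
  proj : Set ℝ → E →L[ℂ] E
  isStarProjection : ∀ B, MeasurableSet B → IsStarProjection (proj B)
  proj_empty : proj ∅ = 0
  proj_univ : proj Set.univ = 1
  proj_inter : ∀ A B, MeasurableSet A → MeasurableSet B → proj (A ∩ B) = proj A * proj B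
  hasSum_proj : ∀ B : ℕ → Set ℝ, (∀ i, MeasurableSet (B i)) → Pairwise (Function.onFun Disjoint B) →
    ∀ ψ : E, HasSum (fun i => proj (B i) ψ) (proj (⋃ i, B i) ψ)

namespace ProjValuedMeasure

variable {E : Type*} [NormedAddCommGroup E] [InnerProductSpace ℂ E] [CompleteSpace E]

theorem inner_eq_norm_sq (P : ProjValuedMeasure E) (ψ : E) {B : Set ℝ} (hB : MeasurableSet B) :
    inner ℂ ψ (P.proj B ψ) = ((‖P.proj B ψ‖ ^ 2 : ℝ) : ℂ) := by
  have h := P.isStarProjection B hB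
  have h1 : P.proj B (P.proj B ψ) = P.proj B ψ := by
    have := congrArg (fun T : E →L[ℂ] E => T ψ) h.isIdempotentElem
    simpa using this
  have h2 : inner ℂ ψ (P.proj B (P.proj B ψ)) = inner ℂ (P.proj B ψ) (P.proj B ψ) := by
    rw [← ContinuousLinearMap.adjoint_inner_left, h.isSelfAdjoint.adjoint_eq]
  rw [h1] at h2
  rw [h2, inner_self_eq_norm_sq_to_K]
  push_cast
  rfl

/-- The scalar measure `B ↦ ⟨ψ, P(B) ψ⟩` of a projection-valued measure `P` at a vector `ψ`. -/
def diag (P : ProjValuedMeasure E) (ψ : E) : Measure ℝ :=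
  Measure.ofMeasurable (fun B _ => ENNReal.ofReal (inner ℂ ψ (P.proj B ψ)).re)
    (by simp [P.proj_empty])
    (by
      intro B hB hd
      have hs : HasSum (fun i => (inner ℂ ψ (P.proj (B i) ψ)).re)
          (inner ℂ ψ (P.proj (⋃ i, B i) ψ)).re :=
        Complex.hasSum_re ((P.hasSum_proj B hB hd ψ).mapL (innerSL ℂ ψ))
      have hn : ∀ i, 0 ≤ (inner ℂ ψ (P.proj (B i) ψ)).re := by
        intro i
        rw [P.inner_eq_norm_sq ψ (hB i), Complex.ofReal_re]
        positivity
      rw [← hs.tsum_eq, ENNReal.ofReal_tsum_of_nonneg hn hs.summable])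

theorem diag_apply (P : ProjValuedMeasure E) (ψ : E) {B : Set ℝ} (hB : MeasurableSet B) :
    P.diag ψ B = ENNReal.ofReal (inner ℂ ψ (P.proj B ψ)).re :=
  Measure.ofMeasurable_apply B hB

/-- `T = ∫ x dP(x)` in the sense of the spectral theorem: the domain of `T` consists of all `ψ` with
`∫ x² d⟨ψ, P(x) ψ⟩ < ∞`, and `⟨ψ, T ψ⟩ = ∫ x d⟨ψ, P(x) ψ⟩` on the domain. By polarization, this
pins down `T` and `⟨φ, T ψ⟩` for all `φ`, `ψ` in the domain. -/
def IsResolutionOf (P : ProjValuedMeasure E) (T : E →ₗ.[ℂ] E) : Prop :=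
  (∀ ψ : E, ψ ∈ T.domain ↔ Integrable (fun x : ℝ => x ^ 2) (P.diag ψ)) ∧
  ∀ ψ : T.domain, inner ℂ (ψ : E) (T ψ) = ((∫ x, x ∂(P.diag (ψ : E)) : ℝ) : ℂ)

end ProjValuedMeasure

open Classical in
/-- The spectral measure `⟨ψ, E_T(·) ψ⟩` of a self-adjoint operator `T` at the vector `ψ`, where
`E_T` is the projection-valued measure of `T`. (The junk value `0` occurs only for operators that
are not self-adjoint.) -/
def spectralMeasureAt {E : Type*} [NormedAddCommGroup E] [InnerProductSpace ℂ E] [CompleteSpace E]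
    (T : E →ₗ.[ℂ] E) (ψ : E) : Measure ℝ :=
  if h : ∃ P : ProjValuedMeasure E, P.IsResolutionOf T then h.choose.diag ψ else 0

/-- `⟨ψ, f(T) ψ⟩ = ∫ f d⟨ψ, E_T(·) ψ⟩`, for `ψ` in the domain of `f(T)`, that is, for
`f ∈ L²(⟨ψ, E_T(·) ψ⟩)`. -/
def spectralExpectation {E : Type*} [NormedAddCommGroup E] [InnerProductSpace ℂ E] [CompleteSpace E]
    (T : E →ₗ.[ℂ] E) (f : ℝ → ℝ) (ψ : E) : ℝ :=
  ∫ x, f x ∂(spectralMeasureAt T ψ)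

/-! ### The Anderson model -/

/-- The lattice `ℤ^d`. -/
abbrev LatticeZ (d : ℕ) : Type := Fin d → ℤ

/-- The Hilbert space `ℓ²(ℤ^d)`. -/
abbrev LatticeL2 (d : ℕ) : Type := lp (fun _ : LatticeZ d => ℂ) 2

/-- The basis vector `δ_n` of `ℓ²(ℤ^d)`. -/
def latticeDelta {d : ℕ} (n : LatticeZ d) : LatticeL2 d := lp.single 2 n (1 : ℂ)

/-- The formal action `(Δ u + V^ω u)(n) = ∑_{|k - n|₁ = 1} u(k) + ω_n u(n)` on arbitrary functions
on `ℤ^d`; the neighbours of `n` are `n + e_i` and `n - e_i`. -/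
def andersonFormal {d : ℕ} (ω : LatticeZ d → ℝ) : (LatticeZ d → ℂ) →ₗ[ℂ] (LatticeZ d → ℂ) where
  toFun u := fun n =>
    (∑ i : Fin d, (u (n + Pi.single i 1) + u (n - Pi.single i 1))) + (ω n : ℂ) * u n
  map_add' u v := by
    ext n
    simp only [Pi.add_apply, Finset.sum_add_distrib]
    ring
  map_smul' c u := by
    ext n
    simp only [Pi.smul_apply, smul_eq_mul, RingHom.id_apply, Finset.sum_add_distrib,
      ← Finset.mul_sum]
    ring

/-- The operator `H^ω = Δ + V^ω` on `ℓ²(ℤ^d)`, with its maximal domain `{u ∈ ℓ² | H^ω u ∈ ℓ²}`. As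
`Δ` is bounded, this is the domain of the multiplication operator `V^ω`. -/
def andersonOperator {d : ℕ} (ω : LatticeZ d → ℝ) : LatticeL2 d →ₗ.[ℂ] LatticeL2 d where
  domain :=
    { carrier := {u | Memℓp (andersonFormal ω (u : LatticeZ d → ℂ)) 2}
      add_mem' := by
        intro u v hu hv
        simp only [Set.mem_ofPred_eq, lp.coeFn_add, map_add] at *
        exact hu.add hv
      zero_mem' := by
        simp only [Set.mem_ofPred_eq, lp.coeFn_zero, map_zero]
        exact zero_memℓp
      smul_mem' := by
        intro c u hu
        simp only [Set.mem_ofPred_eq, lp.coeFn_smul, map_smul] at *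
        exact hu.const_smul c }
  toFun :=
    { toFun := fun u => ⟨andersonFormal ω ((u : LatticeL2 d) : LatticeZ d → ℂ), u.2⟩
      map_add' := by
        intro u v
        apply Subtype.ext
        simp only [Submodule.coe_add, lp.coeFn_add, map_add]
        rfl
      map_smul' := by
        intro c u
        apply Subtype.ext
        simp only [Submodule.coe_smul, lp.coeFn_smul, map_smul, RingHom.id_apply]
        rfl }

/-- The cube `Λ_L = {n ∈ ℤ^d : |n_i| ≤ L for all i}`. -/
def latticeBox (d L : ℕ) : Finset (LatticeZ d) :=
  Fintype.piFinset fun _ => Finset.Icc (-(L : ℤ)) (L : ℤ)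

/-- The matrix `H^ω_L = χ_L H^ω χ_L` on `ℓ²(Λ_L)`, with entries `⟨δ_n, H^ω δ_m⟩ = (H^ω δ_m)(n)`. -/
def andersonMatrix {d : ℕ} (ω : LatticeZ d → ℝ) (L : ℕ) :
    Matrix (latticeBox d L) (latticeBox d L) ℂ :=
  Matrix.of fun n m => andersonFormal ω (Pi.single (m : LatticeZ d) 1) (n : LatticeZ d)

/-- The law `⨂_{n ∈ ℤ^d} μ` of the i.i.d. potential `(ω_n)` with single site distribution `μ`. -/
def potentialLaw (d : ℕ) (μ : Measure ℝ) [IsProbabilityMeasure μ] : Measure (LatticeZ d → ℝ) :=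
  Measure.infinitePi fun _ : LatticeZ d => μ

/-- All moments of `μ` are finite, and `∫ |x|^k dμ ≤ C a^k k^k` for all `k` and some `C, a ≥ 1`. -/
def MomentCondition (μ : Measure ℝ) : Prop :=
  (∀ k : ℕ, Integrable (fun x : ℝ => |x| ^ k) μ) ∧
  ∃ C a : ℝ, 1 ≤ C ∧ 1 ≤ a ∧ ∀ k : ℕ, ∫ x, |x| ^ k ∂μ ≤ C * a ^ k * (k : ℝ) ^ k

end

/-!
The normalized trace of `f (H^ω_L)` is the integral of `f` against the finite-volume density of
states `cubeDensityOfStates L ω`, and the expectation on the right is the integral of `f` against a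
fixed probability measure `ν`, the average over the disorder of the spectral measures of `H^ω` at
the origin (`exists_densityOfStates`). It is enough to show that, for almost every `ω`, every moment
of `cubeDensityOfStates L ω` converges to the corresponding moment of `ν`: the exceptional set then
does not depend on `f`, and convergence of moments upgrades to convergence of the integrals of all
polynomially bounded continuous functions, because the moments of `ν` have factorial growth and
hence determine `ν` (`tendsto_integral_of_tendsto_moments`).

*Moments to integrals.* If the even moments of the limit are bounded by `C b^{2k} (2k)!`, then the
Taylor series of `s ↦ ∫ x^k e^{isx}` converges in a neighbourhood of every point whose size depends
only on `b`. So convergence of moments gives convergence of all these functions, step by step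
along the real axis. Applied to the measures with density `1 + x^{2r}`, Lévy's continuity theorem
then yields weak convergence of the weighted measures.

*Convergence of moments.* The `k`-th moment at a site `n` is `⟨δ_n, H^k δ_n⟩`, a polynomial in the
values of the potential at distance at most `k` from `n`. In the interior of the cube it agrees with
the infinite-volume moment `originMoment k` of the potential shifted by `n`, and the average of the
latter over the cube converges by the law of large numbers for local functions of an i.i.d. field
(`ae_tendsto_boxAverage`, by a second-moment argument along squares and monotone interpolation). The
boundary contributes nothing in the limit (`abs_integral_pow_sub_boxAverage_le`). The moment
condition on `μ` bounds the expected moments by `C b^k k!` (`exists_integral_orbitBound_le`).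

*Spectral measures in infinite volume.* The potential is unbounded and enters the spectral measure
of an unbounded operator, so two more facts are needed. First, `H^ω` has a projection-valued measure
for every `ω`: for `l > 2d` the resolvent at `il` exists by a Neumann series, it is a bounded normal
operator, and its continuous functional calculus extends to Borel functions
(`exists_isResolutionOf`). Applying the operator multiplies scalar spectral measures by `x²`
(`ProjValuedMeasure.IsResolutionOf.diag_apply_eq`), which identifies the moments of the spectral
measure at the origin (`integral_pow_diag`) and shows that all of them are finite. Second, that
spectral measure depends measurably on `ω`, up to a null set: almost surely its moments have
factorial growth (`ae_hasMomentGrowth`), so it is the limit of the spectral measures of the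
finite-volume matrices, whose moments are polynomials in the potential.
-/

noncomputable section

/-! ### Convergence of integrals from convergence of moments -/

/-- Taylor remainder of the exponential on the imaginary axis. There is no factor `exp ‖z‖`, so the
bound can be integrated against a measure that only has moments. -/
theorem norm_exp_sub_sum_le_of_re_eq_zero {z : ℂ} (hz : z.re = 0) (n : ℕ) :
    ‖Complex.exp z - ∑ j ∈ Finset.range n, z ^ j / (j.factorial : ℂ)‖ ≤
      ‖z‖ ^ n / (n.factorial : ℝ) := by
  have key : ∀ n : ℕ, ∀ x ∈ Set.Icc (0 : ℝ) 1,
      ‖Complex.exp (x * z) - ∑ j ∈ Finset.range n, (x * z) ^ j / (j.factorial : ℂ)‖ ≤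
        (x * ‖z‖) ^ n / (n.factorial : ℝ) := by
    intro n
    induction n with
    | zero =>
      intro x _
      simp [Complex.norm_exp, hz]
    | succ n ih =>
      have hE : ∀ x : ℝ,
          HasDerivAt (fun x : ℝ => Complex.exp (x * z)) (z * Complex.exp (x * z)) x := by
        intro x
        have h1 : HasDerivAt (fun x : ℝ => (x : ℂ) * z) z x := by
          simpa using (Complex.ofRealCLM.hasDerivAt (x := x)).mul_const z
        simpa [mul_comm] using h1.cexp
      have hS : ∀ x : ℝ, HasDerivAt
          (fun x : ℝ => ∑ j ∈ Finset.range (n + 1), ((x : ℂ) * z) ^ j / (j.factorial : ℂ))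
          (z * ∑ j ∈ Finset.range n, ((x : ℂ) * z) ^ j / (j.factorial : ℂ)) x := by
        intro x
        simp_rw [Finset.sum_range_succ']
        simp only [pow_zero, Nat.factorial_zero, Nat.cast_one, div_one]
        refine HasDerivAt.add_const _ ?_
        rw [Finset.mul_sum]
        refine HasDerivAt.fun_sum fun j _ => ?_
        have h1 : HasDerivAt (fun x : ℝ => (x : ℂ) * z) z x := by
          simpa using (Complex.ofRealCLM.hasDerivAt (x := x)).mul_const z
        have h2 := (h1.pow (j + 1)).div_const (((j + 1).factorial : ℕ) : ℂ)
        convert! h2 using 1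
        rw [Nat.factorial_succ]
        push_cast
        have : (j.factorial : ℂ) ≠ 0 := by exact_mod_cast j.factorial_ne_zero
        have : (j + 1 : ℂ) ≠ 0 := by exact_mod_cast j.succ_ne_zero
        field_simp
      have hB : ∀ x : ℝ, HasDerivAt (fun x : ℝ => (x * ‖z‖) ^ (n + 1) / ((n + 1).factorial : ℝ))
          (‖z‖ * ((x * ‖z‖) ^ n / (n.factorial : ℝ))) x := by
        intro x
        have h1 : HasDerivAt (fun x : ℝ => x * ‖z‖) ‖z‖ x := by
          simpa using (hasDerivAt_id x).mul_const ‖z‖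
        have h2 := (h1.pow (n + 1)).div_const (((n + 1).factorial : ℕ) : ℝ)
        convert! h2 using 1
        rw [Nat.factorial_succ]
        push_cast
        have : (n.factorial : ℝ) ≠ 0 := by exact_mod_cast n.factorial_ne_zero
        have : (n + 1 : ℝ) ≠ 0 := by exact_mod_cast n.succ_ne_zero
        field_simp
      have hd := fun x => (hE x).sub (hS x)
      intro x hx
      refine image_norm_le_of_norm_deriv_right_le_deriv_boundary (a := 0) (b := 1)
        (f := fun x : ℝ => Complex.exp (x * z) -
          ∑ j ∈ Finset.range (n + 1), ((x : ℂ) * z) ^ j / (j.factorial : ℂ))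
        (f' := fun x : ℝ => z * Complex.exp (x * z) -
          z * ∑ j ∈ Finset.range n, ((x : ℂ) * z) ^ j / (j.factorial : ℂ))
        (B := fun x : ℝ => (x * ‖z‖) ^ (n + 1) / ((n + 1).factorial : ℝ))
        (fun x _ => (hd x).continuousAt.continuousWithinAt)
        (fun x _ => (hd x).hasDerivWithinAt) ?_ hB ?_ hx
      · simp [Finset.sum_range_succ']
      · intro x hx
        rw [← mul_sub, norm_mul]
        exact mul_le_mul_of_nonneg_left (ih x ⟨hx.1, hx.2.le⟩) (norm_nonneg _)
  simpa using key n 1 (by simp)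

section MomentConvergence

variable {ν : ℕ → Measure ℝ} {ν₀ : Measure ℝ}

theorem integrable_pow_mul_cexp {m : Measure ℝ} (hm : ∀ k : ℕ, Integrable (fun x : ℝ => x ^ k) m)
    (k : ℕ) (s : ℝ) :
    Integrable (fun x : ℝ => (x : ℂ) ^ k * Complex.exp ((s * x : ℝ) * Complex.I)) m := by
  refine (hm k).norm.mono' (by fun_prop) (Eventually.of_forall fun x => ?_)
  rw [norm_mul, Complex.norm_exp_ofReal_mul_I, mul_one, norm_pow, norm_pow, Complex.norm_real]

/-- Taylor expansion of order `n` in `t` under the integral sign. The parity assumption makes the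
remainder a moment, rather than an absolute moment. -/
theorem norm_integral_pow_mul_cexp_sub_le {m : Measure ℝ}
    (hm : ∀ k : ℕ, Integrable (fun x : ℝ => x ^ k) m) (k n : ℕ) (hkn : Even (n + k)) (s t : ℝ) :
    ‖(∫ x, (x : ℂ) ^ k * Complex.exp (((s + t) * x : ℝ) * Complex.I) ∂m) -
      ∑ j ∈ Finset.range n, (t * Complex.I) ^ j / (j.factorial : ℂ) *
        ∫ x, (x : ℂ) ^ (k + j) * Complex.exp ((s * x : ℝ) * Complex.I) ∂m‖ ≤
      |t| ^ n / (n.factorial : ℝ) * ∫ x, x ^ (n + k) ∂m := by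
  have hsum : ∑ j ∈ Finset.range n, (t * Complex.I) ^ j / (j.factorial : ℂ) *
        ∫ x, (x : ℂ) ^ (k + j) * Complex.exp ((s * x : ℝ) * Complex.I) ∂m =
      ∫ x, ∑ j ∈ Finset.range n, (t * Complex.I) ^ j / (j.factorial : ℂ) *
        ((x : ℂ) ^ (k + j) * Complex.exp ((s * x : ℝ) * Complex.I)) ∂m := by
    rw [integral_finsetSum _ fun j _ => (integrable_pow_mul_cexp hm (k + j) s).const_mul _]
    simp_rw [integral_const_mul]
  rw [hsum, ← integral_sub (integrable_pow_mul_cexp hm k _)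
    (integrable_finsetSum _ fun j _ => (integrable_pow_mul_cexp hm (k + j) s).const_mul _),
    ← integral_const_mul]
  refine norm_integral_le_of_norm_le ((hm (n + k)).const_mul _) (Eventually.of_forall fun x => ?_)
  have hx : (x : ℂ) ^ k * Complex.exp (((s + t) * x : ℝ) * Complex.I) -
      ∑ j ∈ Finset.range n, (t * Complex.I) ^ j / (j.factorial : ℂ) *
        ((x : ℂ) ^ (k + j) * Complex.exp ((s * x : ℝ) * Complex.I)) =
      (x : ℂ) ^ k * Complex.exp ((s * x : ℝ) * Complex.I) *
        (Complex.exp ((t * x : ℝ) * Complex.I) -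
          ∑ j ∈ Finset.range n, ((t * x : ℝ) * Complex.I) ^ j / (j.factorial : ℂ)) := by
    rw [mul_sub, mul_assoc _ _ (Complex.exp _), ← Complex.exp_add, Finset.mul_sum]
    congr 1
    · congr 2
      push_cast
      ring
    · refine Finset.sum_congr rfl fun j _ => ?_
      push_cast
      ring
  rw [hx, norm_mul, norm_mul, Complex.norm_exp_ofReal_mul_I, mul_one, norm_pow, Complex.norm_real]
  have h1 := norm_exp_sub_sum_le_of_re_eq_zero (z := (t * x : ℝ) * Complex.I) (by simp) n
  refine (mul_le_mul_of_nonneg_left h1 (by positivity)).trans (le_of_eq ?_)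
  rw [norm_mul, Complex.norm_I, mul_one, Complex.norm_real, Real.norm_eq_abs, Real.norm_eq_abs,
    abs_mul, mul_pow, ← hkn.pow_abs x, pow_add]
  ring

theorem factorial_add_le (n k : ℕ) :
    (n + k).factorial ≤ 2 ^ (n + k) * n.factorial * k.factorial := by
  rw [← Nat.add_choose_mul_factorial_mul_factorial n k, mul_assoc, mul_assoc]
  exact Nat.mul_le_mul_right _ (Nat.choose_le_two_pow _ _)

/-- Convergence of the functions `s ↦ ∫ x ^ k e^{isx}` propagates from `s` to `s + t`, for `t` in an
interval whose length depends only on the growth `b` of the moments of the limit. -/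
theorem tendsto_integral_pow_mul_cexp_add
    (hν : ∀ L k, Integrable (fun x : ℝ => x ^ k) (ν L))
    (hν₀ : ∀ k : ℕ, Integrable (fun x : ℝ => x ^ k) ν₀)
    (hlim : ∀ k : ℕ, Tendsto (fun L => ∫ x, x ^ k ∂(ν L)) atTop (𝓝 (∫ x, x ^ k ∂ν₀)))
    {C b : ℝ} (hb : 0 < b) (hC : 0 ≤ C)
    (hgrowth : ∀ k : ℕ, ∫ x, x ^ (2 * k) ∂ν₀ ≤ C * b ^ (2 * k) * (2 * k).factorial)
    {s t : ℝ} (ht : |t| * b ≤ 1 / 4)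
    (hs : ∀ k : ℕ, Tendsto
      (fun L => ∫ x, (x : ℂ) ^ k * Complex.exp ((s * x : ℝ) * Complex.I) ∂(ν L)) atTop
      (𝓝 (∫ x, (x : ℂ) ^ k * Complex.exp ((s * x : ℝ) * Complex.I) ∂ν₀))) (k : ℕ) :
    Tendsto (fun L => ∫ x, (x : ℂ) ^ k * Complex.exp (((s + t) * x : ℝ) * Complex.I) ∂(ν L)) atTop
      (𝓝 (∫ x, (x : ℂ) ^ k * Complex.exp (((s + t) * x : ℝ) * Complex.I) ∂ν₀)) := by
  -- The Taylor polynomials converge termwise. The remainder of order `k + 2 * p` is an even moment,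
  -- hence converges to its counterpart `r p` for the limit measure.
  set r : ℕ → ℝ := fun p => |t| ^ (k + 2 * p) / ((k + 2 * p).factorial : ℝ) *
    ∫ x, x ^ ((k + 2 * p) + k) ∂ν₀ with hr
  have hev : ∀ p, Even ((k + 2 * p) + k) := fun p => ⟨k + p, by ring⟩
  have hr0 : Tendsto r atTop (𝓝 0) := by
    have hle : ∀ p, r p ≤ (C * (2 * b) ^ k * k.factorial) * (1 / 2) ^ p := by
      intro p
      have h1 := hgrowth (k + p)
      rw [show 2 * (k + p) = (k + 2 * p) + k by ring] at h1
      set n := k + 2 * p with hn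
      have h2 : ((n + k).factorial : ℝ) ≤ 2 ^ (n + k) * n.factorial * k.factorial := by
        exact_mod_cast factorial_add_le n k
      have hnf : (0 : ℝ) < n.factorial := by exact_mod_cast n.factorial_pos
      calc r p ≤ |t| ^ n / (n.factorial : ℝ) *
            (C * b ^ (n + k) * (2 ^ (n + k) * n.factorial * k.factorial)) := by
            refine mul_le_mul_of_nonneg_left (h1.trans ?_) (by positivity)
            exact mul_le_mul_of_nonneg_left h2 (by positivity)
        _ = (C * (2 * b) ^ k * k.factorial) * (2 * (|t| * b)) ^ n := by
            field_simp
            ring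
        _ ≤ (C * (2 * b) ^ k * k.factorial) * (1 / 2) ^ n := by
            refine mul_le_mul_of_nonneg_left ?_ (by positivity)
            exact pow_le_pow_left₀ (by positivity) (by linarith) _
        _ ≤ (C * (2 * b) ^ k * k.factorial) * (1 / 2) ^ p := by
            refine mul_le_mul_of_nonneg_left ?_ (by positivity)
            exact pow_le_pow_of_le_one (by norm_num) (by norm_num) (by omega)
    refine squeeze_zero (fun p => ?_) hle ?_
    · have : 0 ≤ ∫ x, x ^ ((k + 2 * p) + k) ∂ν₀ := integral_nonneg fun x => (hev p).pow_nonneg x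
      positivity
    · simpa using (tendsto_pow_atTop_nhds_zero_of_lt_one (r := (1 / 2 : ℝ)) (by norm_num)
        (by norm_num)).const_mul (C * (2 * b) ^ k * k.factorial)
  rw [Metric.tendsto_atTop']
  intro ε hε
  obtain ⟨p, hp⟩ := (hr0.eventually (gt_mem_nhds (show (0 : ℝ) < ε / 4 by positivity))).exists
  set n := k + 2 * p with hn
  have hT : Tendsto (fun L => ∑ j ∈ Finset.range n, (t * Complex.I) ^ j / (j.factorial : ℂ) *
        ∫ x, (x : ℂ) ^ (k + j) * Complex.exp ((s * x : ℝ) * Complex.I) ∂(ν L)) atTop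
      (𝓝 (∑ j ∈ Finset.range n, (t * Complex.I) ^ j / (j.factorial : ℂ) *
        ∫ x, (x : ℂ) ^ (k + j) * Complex.exp ((s * x : ℝ) * Complex.I) ∂ν₀)) :=
    tendsto_finsetSum _ fun j _ => (hs (k + j)).const_mul _
  have hR : Tendsto (fun L => |t| ^ n / (n.factorial : ℝ) * ∫ x, x ^ (n + k) ∂(ν L)) atTop
      (𝓝 (r p)) := (hlim (n + k)).const_mul _
  obtain ⟨N₁, h₁⟩ := (Metric.tendsto_atTop'.1 hT) (ε / 4) (by positivity)
  obtain ⟨N₂, h₂⟩ := eventually_atTop.1 (hR.eventually (gt_mem_nhds hp))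
  refine ⟨max N₁ N₂, fun L hL => ?_⟩
  have e1 := norm_integral_pow_mul_cexp_sub_le (hν L) k n (hev p) s t
  have e2 := norm_integral_pow_mul_cexp_sub_le hν₀ k n (hev p) s t
  have e3 := h₁ L (lt_of_le_of_lt (le_max_left _ _) hL)
  have e4 := h₂ L (le_of_lt (lt_of_le_of_lt (le_max_right _ _) hL))
  rw [dist_eq_norm] at e3 ⊢
  set A := ∫ x, (x : ℂ) ^ k * Complex.exp (((s + t) * x : ℝ) * Complex.I) ∂(ν L)
  set A₀ := ∫ x, (x : ℂ) ^ k * Complex.exp (((s + t) * x : ℝ) * Complex.I) ∂ν₀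
  set B := ∑ j ∈ Finset.range n, (t * Complex.I) ^ j / (j.factorial : ℂ) *
        ∫ x, (x : ℂ) ^ (k + j) * Complex.exp ((s * x : ℝ) * Complex.I) ∂(ν L)
  set B₀ := ∑ j ∈ Finset.range n, (t * Complex.I) ^ j / (j.factorial : ℂ) *
        ∫ x, (x : ℂ) ^ (k + j) * Complex.exp ((s * x : ℝ) * Complex.I) ∂ν₀
  have hsplit : A - A₀ = (A - B) + (B - B₀) - (A₀ - B₀) := by ring
  rw [hsplit]
  have t1 := norm_sub_le ((A - B) + (B - B₀)) (A₀ - B₀)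
  have t2 := norm_add_le (A - B) (B - B₀)
  have hp' : |t| ^ n / (n.factorial : ℝ) * ∫ x, x ^ (n + k) ∂ν₀ < ε / 4 := hp
  linarith

/-- Convergence of moments implies convergence of the characteristic functions and of all their
derivatives: any `s` is reached from `0` by finitely many steps of admissible length. -/
theorem tendsto_integral_pow_mul_cexp
    (hν : ∀ L k, Integrable (fun x : ℝ => x ^ k) (ν L))
    (hν₀ : ∀ k : ℕ, Integrable (fun x : ℝ => x ^ k) ν₀)
    (hlim : ∀ k : ℕ, Tendsto (fun L => ∫ x, x ^ k ∂(ν L)) atTop (𝓝 (∫ x, x ^ k ∂ν₀)))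
    {C b : ℝ} (hb : 0 < b)
    (hgrowth : ∀ k : ℕ, ∫ x, x ^ (2 * k) ∂ν₀ ≤ C * b ^ (2 * k) * (2 * k).factorial)
    (s : ℝ) (k : ℕ) :
    Tendsto (fun L => ∫ x, (x : ℂ) ^ k * Complex.exp ((s * x : ℝ) * Complex.I) ∂(ν L)) atTop
      (𝓝 (∫ x, (x : ℂ) ^ k * Complex.exp ((s * x : ℝ) * Complex.I) ∂ν₀)) := by
  have hC : 0 ≤ C := by
    have h0 : 0 ≤ ∫ x, x ^ (2 * 0) ∂ν₀ := integral_nonneg fun x => by simp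
    simpa using h0.trans (hgrowth 0)
  obtain ⟨N, hN⟩ := exists_nat_gt (4 * |s| * b)
  have hN0 : (0 : ℝ) < N := lt_of_le_of_lt (by positivity) hN
  have key : ∀ j : ℕ, ∀ k : ℕ, Tendsto
      (fun L => ∫ x, (x : ℂ) ^ k * Complex.exp ((j * (s / N) * x : ℝ) * Complex.I) ∂(ν L)) atTop
      (𝓝 (∫ x, (x : ℂ) ^ k * Complex.exp ((j * (s / N) * x : ℝ) * Complex.I) ∂ν₀)) := by
    intro j
    induction j with
    | zero =>
      intro k
      have h : ∀ m : Measure ℝ, ∫ x, (x : ℂ) ^ k * Complex.exp (((0 : ℕ) * (s / N) * x : ℝ) *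
          Complex.I) ∂m = ((∫ x, x ^ k ∂m : ℝ) : ℂ) := by
        intro m
        rw [← integral_complex_ofReal]
        simp
      simp_rw [h]
      exact (Complex.continuous_ofReal.tendsto _).comp (hlim k)
    | succ j ih =>
      intro k
      have ht : |s / N| * b ≤ 1 / 4 := by
        rw [abs_div, abs_of_pos hN0, div_mul_eq_mul_div, div_le_iff₀ hN0]
        linarith
      have := tendsto_integral_pow_mul_cexp_add hν hν₀ hlim hb hC hgrowth ht ih k
      have e : ((j + 1 : ℕ) : ℝ) * (s / N) = j * (s / N) + s / N := by push_cast; ring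
      rw [e]
      exact this
  have h := key N k
  rwa [mul_div_cancel₀ _ hN0.ne'] at h

/-- The probability measure proportional to `(1 + x ^ (2 * r)) m`. -/
def momentTilt (r : ℕ) (m : Measure ℝ) : Measure ℝ :=
  (ENNReal.ofReal (∫ x, (1 + x ^ (2 * r)) ∂m))⁻¹ •
    m.withDensity fun x => ENNReal.ofReal (1 + x ^ (2 * r))

theorem one_le_integral_weight {m : Measure ℝ} [IsProbabilityMeasure m]
    (hm : ∀ k : ℕ, Integrable (fun x : ℝ => x ^ k) m) (r : ℕ) :
    1 ≤ ∫ x, (1 + x ^ (2 * r)) ∂m := by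
  rw [integral_add (integrable_const _) (hm _)]
  have : 0 ≤ ∫ x, x ^ (2 * r) ∂m := integral_nonneg fun x => (even_two_mul r).pow_nonneg x
  simpa using this

theorem isProbabilityMeasure_momentTilt {m : Measure ℝ} [IsProbabilityMeasure m]
    (hm : ∀ k : ℕ, Integrable (fun x : ℝ => x ^ k) m) (r : ℕ) :
    IsProbabilityMeasure (momentTilt r m) := by
  have h1 := one_le_integral_weight hm r
  constructor
  have h2 : Integrable (fun x : ℝ => 1 + x ^ (2 * r)) m := (integrable_const _).add (hm _)
  rw [momentTilt, Measure.smul_apply, withDensity_apply _ MeasurableSet.univ, Measure.restrict_univ,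
    ← ofReal_integral_eq_lintegral_ofReal h2 (Eventually.of_forall fun x => by
      have := (even_two_mul r).pow_nonneg x
      simp only [Pi.zero_apply]
      linarith), smul_eq_mul]
  exact ENNReal.inv_mul_cancel (by simpa using by linarith) ENNReal.ofReal_ne_top

/-- Integrals against the tilted measure. Functions bounded by a multiple of `1 + x ^ (2 * r)` for
the original measure become bounded functions for the tilted one. -/
theorem integral_momentTilt {E : Type*} [NormedAddCommGroup E] [NormedSpace ℝ E]
    {m : Measure ℝ} [IsProbabilityMeasure m]
    (hm : ∀ k : ℕ, Integrable (fun x : ℝ => x ^ k) m) (r : ℕ) (f : ℝ → E) :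
    ∫ x, f x ∂(momentTilt r m) =
      (∫ x, (1 + x ^ (2 * r)) ∂m)⁻¹ • ∫ x, (1 + x ^ (2 * r)) • f x ∂m := by
  have h1 := one_le_integral_weight hm r
  rw [momentTilt, integral_smul_measure,
    integral_withDensity_eq_integral_toReal_smul (by fun_prop)
      (Eventually.of_forall fun x => ENNReal.ofReal_lt_top)]
  congr 1
  · rw [ENNReal.toReal_inv, ENNReal.toReal_ofReal (by linarith)]
  · refine integral_congr_ae (Eventually.of_forall fun x => ?_)
    have := (even_two_mul r).pow_nonneg x
    simp only
    rw [ENNReal.toReal_ofReal (by linarith)]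

/-- Every polynomial is dominated by an even weight. -/
theorem polynomial_eval_le_weight (P : Polynomial ℝ) :
    ∃ A : ℝ, ∃ r : ℕ, ∀ x : ℝ, |P.eval x| ≤ A * (1 + x ^ (2 * r)) := by
  refine ⟨∑ i ∈ Finset.range (P.natDegree + 1), |P.coeff i|, P.natDegree, fun x => ?_⟩
  rw [Polynomial.eval_eq_sum_range, Finset.sum_mul]
  refine (Finset.abs_sum_le_sum_abs _ _).trans (Finset.sum_le_sum fun i hi => ?_)
  rw [abs_mul]
  refine mul_le_mul_of_nonneg_left ?_ (abs_nonneg _)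
  have hi' : i ≤ P.natDegree := by simpa [Nat.lt_succ_iff] using hi
  rw [abs_pow, ← (even_two_mul P.natDegree).pow_abs x]
  rcases le_total |x| 1 with h | h
  · have := pow_le_one₀ (n := i) (abs_nonneg x) h
    have : 0 ≤ |x| ^ (2 * P.natDegree) := by positivity
    linarith
  · have := pow_le_pow_right₀ h (show i ≤ 2 * P.natDegree by omega)
    linarith

theorem integrable_weight_mul_of_bounded {m : Measure ℝ} [IsProbabilityMeasure m]
    (hm : ∀ k : ℕ, Integrable (fun x : ℝ => x ^ k) m) (r : ℕ) {f : ℝ → ℝ} {A : ℝ}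
    (hf : AEStronglyMeasurable f m) (h : ∀ x, |f x| ≤ A * (1 + x ^ (2 * r))) : Integrable f m :=
  (((integrable_const 1).add (hm (2 * r))).const_mul A).mono' hf
    (Eventually.of_forall fun x => by simpa using h x)

/-- **Convergence of moments implies convergence of integrals** of polynomially bounded continuous
functions, if the limit has moments of factorial growth. -/
theorem tendsto_integral_of_tendsto_moments
    [∀ L, IsProbabilityMeasure (ν L)] [IsProbabilityMeasure ν₀]
    (hν : ∀ L k, Integrable (fun x : ℝ => x ^ k) (ν L))
    (hν₀ : ∀ k : ℕ, Integrable (fun x : ℝ => x ^ k) ν₀)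
    (hlim : ∀ k : ℕ, Tendsto (fun L => ∫ x, x ^ k ∂(ν L)) atTop (𝓝 (∫ x, x ^ k ∂ν₀)))
    {C b : ℝ} (hb : 0 < b)
    (hgrowth : ∀ k : ℕ, ∫ x, x ^ (2 * k) ∂ν₀ ≤ C * b ^ (2 * k) * (2 * k).factorial)
    {f : ℝ → ℝ} (hf : Continuous f) {P : Polynomial ℝ} (hP : ∀ x, |f x| ≤ P.eval x) :
    Tendsto (fun L => ∫ x, f x ∂(ν L)) atTop (𝓝 (∫ x, f x ∂ν₀)) := by
  obtain ⟨A, r, hPr⟩ := polynomial_eval_le_weight P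
  have hw : ∀ x : ℝ, 0 < 1 + x ^ (2 * r) := fun x => by
    have := (even_two_mul r).pow_nonneg x; linarith
  -- the tilted measures converge weakly, by Lévy's continuity theorem
  have hZ : Tendsto (fun L => ∫ x, (1 + x ^ (2 * r)) ∂(ν L)) atTop
      (𝓝 (∫ x, (1 + x ^ (2 * r)) ∂ν₀)) := by
    have e : ∀ m : Measure ℝ, [IsProbabilityMeasure m] →
        (∀ k : ℕ, Integrable (fun x : ℝ => x ^ k) m) →
        ∫ x, (1 + x ^ (2 * r)) ∂m = 1 + ∫ x, x ^ (2 * r) ∂m := by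
      intro m _ hm
      rw [integral_add (integrable_const _) (hm _)]
      simp
    simp_rw [fun L => e (ν L) (hν L), e ν₀ hν₀]
    exact (hlim _).const_add 1
  have hZ0 := one_le_integral_weight hν₀ r
  have : ∀ L, IsProbabilityMeasure (momentTilt r (ν L)) :=
    fun L => isProbabilityMeasure_momentTilt (hν L) r
  have := isProbabilityMeasure_momentTilt hν₀ r
  let ρ : ℕ → ProbabilityMeasure ℝ := fun L => ⟨momentTilt r (ν L), inferInstance⟩
  let ρ₀ : ProbabilityMeasure ℝ := ⟨momentTilt r ν₀, inferInstance⟩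
  have hρ : Tendsto ρ atTop (𝓝 ρ₀) := by
    refine ProbabilityMeasure.tendsto_of_tendsto_charFun fun t => ?_
    have e : ∀ m : Measure ℝ, [IsProbabilityMeasure m] →
        (∀ k : ℕ, Integrable (fun x : ℝ => x ^ k) m) →
        charFun (momentTilt r m) t = (∫ x, (1 + x ^ (2 * r)) ∂m)⁻¹ •
          ((∫ x, (x : ℂ) ^ 0 * Complex.exp ((t * x : ℝ) * Complex.I) ∂m) +
            ∫ x, (x : ℂ) ^ (2 * r) * Complex.exp ((t * x : ℝ) * Complex.I) ∂m) := by
      intro m _ hm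
      rw [charFun_apply_real, integral_momentTilt hm, ← integral_add
        (integrable_pow_mul_cexp hm 0 t) (integrable_pow_mul_cexp hm (2 * r) t)]
      congr 1
      refine integral_congr_ae (Eventually.of_forall fun x => ?_)
      simp only [Complex.real_smul]
      push_cast
      ring
    change Tendsto (fun L => charFun (momentTilt r (ν L)) t) atTop (𝓝 (charFun (momentTilt r ν₀) t))
    simp_rw [fun L => e (ν L) (hν L), e ν₀ hν₀]
    exact (hZ.inv₀ (by linarith)).smul
      ((tendsto_integral_pow_mul_cexp hν hν₀ hlim hb hgrowth t 0).add
        (tendsto_integral_pow_mul_cexp hν hν₀ hlim hb hgrowth t (2 * r)))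
  -- test the weak convergence of the tilted measures against `f x / (1 + x ^ (2 * r))`
  let g : BoundedContinuousFunction ℝ ℝ := BoundedContinuousFunction.ofNormedAddCommGroup
    (fun x => f x / (1 + x ^ (2 * r))) (hf.div (by fun_prop) fun x => (hw x).ne') A (fun x => by
      rw [norm_div, Real.norm_eq_abs, Real.norm_of_nonneg (hw x).le, div_le_iff₀ (hw x)]
      exact ((hP x).trans (le_abs_self _)).trans (hPr x))
  have hg := ProbabilityMeasure.tendsto_iff_forall_integral_tendsto.1 hρ g
  have e : ∀ m : Measure ℝ, [IsProbabilityMeasure m] →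
      (∀ k : ℕ, Integrable (fun x : ℝ => x ^ k) m) →
      ∫ x, f x ∂m = (∫ x, (1 + x ^ (2 * r)) ∂m) * ∫ x, g x ∂(momentTilt r m) := by
    intro m _ hm
    have h1 := one_le_integral_weight hm r
    rw [integral_momentTilt hm, smul_eq_mul, mul_inv_cancel_left₀ (by linarith)]
    refine integral_congr_ae (Eventually.of_forall fun x => ?_)
    change f x = (1 + x ^ (2 * r)) • (f x / (1 + x ^ (2 * r)))
    rw [smul_eq_mul, mul_div_cancel₀ _ (hw x).ne']
  simp_rw [fun L => e (ν L) (hν L), e ν₀ hν₀]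
  exact hZ.mul hg

end MomentConvergence

/-! ### Borel functional calculus of a representation of `C(X)` -/

section BorelCalculus

variable {X : Type*} [MetricSpace X] [CompactSpace X] [MeasurableSpace X] [BorelSpace X]
variable {E : Type*} [NormedAddCommGroup E] [InnerProductSpace ℂ E] [CompleteSpace E]
variable (Φ : C(X, ℂ) →⋆ₐ[ℂ] (E →L[ℂ] E))

/-- A real continuous function, viewed as a complex one. -/
def complexify (f : C(X, ℝ)) : C(X, ℂ) := ⟨fun x => (f x : ℂ), by fun_prop⟩

theorem inner_rep_star_mul (f g : C(X, ℂ)) (ψ φ : E) :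
    inner ℂ ψ (Φ (star f * g) φ) = inner ℂ (Φ f ψ) (Φ g φ) := by
  rw [map_mul, map_star, mul_apply_eq_comp, ContinuousLinearMap.star_eq_adjoint,
    ContinuousLinearMap.adjoint_inner_right]

/-- `Φ` is positive, as a nonnegative function is the square of its square root. -/
theorem inner_rep_nonneg (f : C(X, ℝ)) (hf : ∀ x, 0 ≤ f x) (ψ : E) :
    0 ≤ (inner ℂ ψ (Φ (complexify f) ψ)).re := by
  let g : C(X, ℝ) := ⟨fun x => Real.sqrt (f x), by fun_prop⟩
  have h : complexify f = star (complexify g) * complexify g := by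
    ext x
    simp only [complexify, ContinuousMap.coe_mk, ContinuousMap.mul_apply, ContinuousMap.star_apply,
      RCLike.star_def, Complex.conj_ofReal, g]
    rw [← Complex.ofReal_mul, Real.mul_self_sqrt (hf x)]
  rw [h, inner_rep_star_mul, inner_self_eq_norm_sq_to_K]
  have : ((‖Φ (complexify g) ψ‖ : ℂ) ^ 2) = ((‖Φ (complexify g) ψ‖ ^ 2 : ℝ) : ℂ) := by
    push_cast; rfl
  erw [this]
  rw [Complex.ofReal_re]
  positivity

/-- The measure is given by the Riesz-Markov-Kakutani theorem for the positive functional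
`f ↦ ⟨ψ, Φ(f) ψ⟩`. -/
theorem exists_rep_measure (ψ : E) : ∃ μ : Measure X, IsFiniteMeasure μ ∧
    ∀ f : C(X, ℂ), ‖Φ f ψ‖ ^ 2 = ∫ x, ‖f x‖ ^ 2 ∂μ := by
  let Λ₀ : CompactlySupportedContinuousMap X ℝ →ₗ[ℝ] ℝ :=
    { toFun := fun f => (inner ℂ ψ (Φ (complexify f.toContinuousMap) ψ)).re
      map_add' := by
        intro f g
        have : complexify (f + g).toContinuousMap =
            complexify f.toContinuousMap + complexify g.toContinuousMap := by
          ext x; simp [complexify]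
        rw [this, map_add, add_apply, inner_add_right, Complex.add_re]
      map_smul' := by
        intro c f
        have : complexify (c • f).toContinuousMap = (c : ℂ) • complexify f.toContinuousMap := by
          ext x; simp [complexify]
        rw [this, map_smul, smul_apply, inner_smul_right, Complex.re_ofReal_mul]
        rfl }
  let Λ : CompactlySupportedContinuousMap X ℝ →ₚ[ℝ] ℝ := PositiveLinearMap.mk₀ Λ₀ (fun f hf =>
    inner_rep_nonneg Φ f.toContinuousMap (fun x => hf x) ψ)
  refine ⟨RealRMK.rieszMeasure Λ, inferInstance, fun f => ?_⟩
  let g : CompactlySupportedContinuousMap X ℝ :=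
    ⟨⟨fun x => ‖f x‖ ^ 2, by fun_prop⟩, HasCompactSupport.of_compactSpace _⟩
  have h1 := RealRMK.integral_rieszMeasure Λ g
  have h2 : complexify g.toContinuousMap = star f * f := by
    ext x
    simp only [complexify, ContinuousMap.coe_mk, ContinuousMap.mul_apply, ContinuousMap.star_apply,
      RCLike.star_def, g]
    rw [Complex.conj_mul']
    push_cast
    rfl
  have h3 : Λ g = ‖Φ f ψ‖ ^ 2 := by
    change (inner ℂ ψ (Φ (complexify g.toContinuousMap) ψ)).re = _
    rw [h2, inner_rep_star_mul]
    exact inner_self_eq_norm_sq (𝕜 := ℂ) _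
  rw [← h3, ← h1]
  rfl

/-- The spectral measure on `X` of a representation of `C(X)` at the vector `ψ`. -/
def repMeasure (ψ : E) : Measure X := (exists_rep_measure Φ ψ).choose

instance (ψ : E) : IsFiniteMeasure (repMeasure Φ ψ) := (exists_rep_measure Φ ψ).choose_spec.1

theorem norm_rep_sq (f : C(X, ℂ)) (ψ : E) : ‖Φ f ψ‖ ^ 2 = ∫ x, ‖f x‖ ^ 2 ∂(repMeasure Φ ψ) :=
  (exists_rep_measure Φ ψ).choose_spec.2 f

theorem Lp_norm_sq_eq_integral {α : Type*} [MeasurableSpace α] {μ : Measure α} (G : Lp ℂ 2 μ) :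
    ‖G‖ ^ 2 = ∫ x, ‖G x‖ ^ 2 ∂μ := by
  rw [← @inner_self_eq_norm_sq ℂ, L2.inner_def]
  rw [integral_congr_ae (g := fun x => ((‖G x‖ ^ 2 : ℝ) : ℂ))]
  · rw [integral_complex_ofReal]
    rfl
  · refine Eventually.of_forall fun x => ?_
    simp only
    rw [inner_self_eq_norm_sq_to_K]
    push_cast
    rfl

/-- Continuous functions as elements of `L²`. -/
def toL2 (μ : Measure X) [IsFiniteMeasure μ] : C(X, ℂ) →ₗ[ℂ] Lp ℂ 2 μ :=
  (ContinuousMap.toLp 2 μ ℂ : C(X, ℂ) →L[ℂ] Lp ℂ 2 μ).toLinearMap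

theorem coeFn_toL2 (μ : Measure X) [IsFiniteMeasure μ] (f : C(X, ℂ)) : toL2 μ f =ᵐ[μ] f :=
  ContinuousMap.coeFn_toLp μ f

theorem denseRange_toL2 (μ : Measure X) [IsFiniteMeasure μ] : DenseRange (toL2 μ) :=
  ContinuousMap.toLp_denseRange ℂ μ ℂ (by simp)

/-- The linear map `f ↦ Φ(f) ψ`. -/
def repOrbit (ψ : E) : C(X, ℂ) →ₗ[ℂ] E where
  toFun := fun f => Φ f ψ
  map_add' := by simp
  map_smul' := by simp

theorem norm_rep_eq (ψ : E) (f : C(X, ℂ)) :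
    ‖repOrbit Φ ψ f‖ = ‖toL2 (repMeasure Φ ψ) f‖ := by
  rw [← sq_eq_sq₀ (norm_nonneg _) (norm_nonneg _), Lp_norm_sq_eq_integral]
  refine (norm_rep_sq Φ f ψ).trans (integral_congr_ae ?_)
  filter_upwards [coeFn_toL2 (repMeasure Φ ψ) f] with x hx
  rw [hx]

theorem memLp_continuousMap (f : C(X, ℂ)) (μ : Measure X) [IsFiniteMeasure μ] : MemLp f 2 μ :=
  MemLp.of_bound f.continuous.aestronglyMeasurable ‖f‖
    (Eventually.of_forall fun x => f.norm_coe_le_norm x)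

/-- The isometry `L²(μ_ψ) → E` with `f ↦ Φ(f) ψ` for continuous `f`. -/
def repIsometry (ψ : E) : Lp ℂ 2 (repMeasure Φ ψ) →L[ℂ] E :=
  LinearMap.extendOfNorm (repOrbit Φ ψ) (toL2 (repMeasure Φ ψ))

theorem repIsometry_toL2 (ψ : E) (f : C(X, ℂ)) :
    repIsometry Φ ψ (toL2 (repMeasure Φ ψ) f) = Φ f ψ :=
  LinearMap.extendOfNorm_eq (f := repOrbit Φ ψ) (denseRange_toL2 _)
    ⟨1, fun f => by rw [one_mul]; exact (norm_rep_eq Φ ψ f).le⟩ f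

theorem norm_repIsometry (ψ : E) (g : Lp ℂ 2 (repMeasure Φ ψ)) :
    ‖repIsometry Φ ψ g‖ = ‖g‖ := by
  refine (denseRange_toL2 (repMeasure Φ ψ)).induction_on g
    (isClosed_eq (by fun_prop) (by fun_prop)) fun f => ?_
  rw [repIsometry_toL2, ← norm_rep_eq]
  rfl

open Classical in
/-- `g(·) ψ` for `g ∈ L²(μ_ψ)`: the vector obtained by applying the extension of the functional
calculus `Φ` to `g`. (The junk value `0` occurs for `g ∉ L²(μ_ψ)`.) -/
def borelVec (ψ : E) (g : X → ℂ) : E :=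
  if h : MemLp g 2 (repMeasure Φ ψ) then repIsometry Φ ψ (h.toLp g) else 0

variable {Φ} {ψ : E} {g g₁ g₂ : X → ℂ}

theorem borelVec_of_memLp (h : MemLp g 2 (repMeasure Φ ψ)) :
    borelVec Φ ψ g = repIsometry Φ ψ (h.toLp g) := dif_pos h

theorem norm_borelVec (h : MemLp g 2 (repMeasure Φ ψ)) :
    ‖borelVec Φ ψ g‖ = (eLpNorm g 2 (repMeasure Φ ψ)).toReal := by
  rw [borelVec_of_memLp h, norm_repIsometry, Lp.norm_toLp]

theorem norm_borelVec_sq (h : MemLp g 2 (repMeasure Φ ψ)) :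
    ‖borelVec Φ ψ g‖ ^ 2 = ∫ x, ‖g x‖ ^ 2 ∂(repMeasure Φ ψ) := by
  rw [borelVec_of_memLp h, norm_repIsometry, Lp_norm_sq_eq_integral]
  refine integral_congr_ae ?_
  filter_upwards [h.coeFn_toLp] with x hx
  rw [hx]

theorem borelVec_add (h₁ : MemLp g₁ 2 (repMeasure Φ ψ)) (h₂ : MemLp g₂ 2 (repMeasure Φ ψ)) :
    borelVec Φ ψ (g₁ + g₂) = borelVec Φ ψ g₁ + borelVec Φ ψ g₂ := by
  rw [borelVec_of_memLp h₁, borelVec_of_memLp h₂, borelVec_of_memLp (h₁.add h₂),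
    MemLp.toLp_add, map_add]

theorem borelVec_sub (h₁ : MemLp g₁ 2 (repMeasure Φ ψ)) (h₂ : MemLp g₂ 2 (repMeasure Φ ψ)) :
    borelVec Φ ψ (g₁ - g₂) = borelVec Φ ψ g₁ - borelVec Φ ψ g₂ := by
  rw [borelVec_of_memLp h₁, borelVec_of_memLp h₂, borelVec_of_memLp (h₁.sub h₂),
    MemLp.toLp_sub, map_sub]

theorem borelVec_congr (h : g₁ =ᵐ[repMeasure Φ ψ] g₂) : borelVec Φ ψ g₁ = borelVec Φ ψ g₂ := by
  by_cases h₁ : MemLp g₁ 2 (repMeasure Φ ψ)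
  · rw [borelVec_of_memLp h₁, borelVec_of_memLp ((memLp_congr_ae h).1 h₁)]
    congr 1
    exact MemLp.toLp_congr _ _ h
  · have h₂ : ¬ MemLp g₂ 2 (repMeasure Φ ψ) := fun h' => h₁ ((memLp_congr_ae h).2 h')
    rw [borelVec, borelVec, dif_neg h₁, dif_neg h₂]

theorem borelVec_continuousMap (f : C(X, ℂ)) : borelVec Φ ψ f = Φ f ψ := by
  rw [borelVec_of_memLp (memLp_continuousMap f _), ← repIsometry_toL2]
  congr 1

theorem tendsto_borelVec {G : ℕ → X → ℂ} (hG : ∀ n, MemLp (G n) 2 (repMeasure Φ ψ))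
    (hg : MemLp g 2 (repMeasure Φ ψ))
    (h : Tendsto (fun n => eLpNorm (G n - g) 2 (repMeasure Φ ψ)) atTop (𝓝 0)) :
    Tendsto (fun n => borelVec Φ ψ (G n)) atTop (𝓝 (borelVec Φ ψ g)) := by
  rw [tendsto_iff_norm_sub_tendsto_zero]
  have e : ∀ n, ‖borelVec Φ ψ (G n) - borelVec Φ ψ g‖ =
      (eLpNorm (G n - g) 2 (repMeasure Φ ψ)).toReal := fun n => by
    rw [← borelVec_sub (hG n) hg, norm_borelVec ((hG n).sub hg)]
  simp_rw [e]
  exact (ENNReal.tendsto_toReal ENNReal.zero_ne_top).comp h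

theorem tendsto_rep_borelVec {f : ℕ → C(X, ℂ)} (hg : MemLp g 2 (repMeasure Φ ψ))
    (h : Tendsto (fun n => eLpNorm (⇑(f n) - g) 2 (repMeasure Φ ψ)) atTop (𝓝 0)) :
    Tendsto (fun n => Φ (f n) ψ) atTop (𝓝 (borelVec Φ ψ g)) := by
  simp_rw [← borelVec_continuousMap]
  exact tendsto_borelVec (fun n => memLp_continuousMap _ _) hg h

/-- Simultaneous approximation by continuous functions in `L²` for several measures. -/
theorem exists_continuousMap_tendsto {ι : Type*} [Finite ι] (μ : ι → Measure X)
    [∀ i, IsFiniteMeasure (μ i)] (hg : ∀ i, MemLp g 2 (μ i)) :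
    ∃ f : ℕ → C(X, ℂ), ∀ i, Tendsto (fun n => eLpNorm (⇑(f n) - g) 2 (μ i)) atTop (𝓝 0) := by
  classical
  have := Fintype.ofFinite ι
  have hfin : IsFiniteMeasure (∑ i, μ i) := inferInstance
  have hσ : MemLp g 2 (∑ i, μ i) := by
    rw [← Measure.sum_fintype]
    refine ⟨aestronglyMeasurable_sum_measure_iff.2 fun i => (hg i).1, ?_⟩
    rw [eLpNorm_lt_top_iff_lintegral_rpow_enorm_lt_top (by simp) (by simp),
      lintegral_sum_measure, tsum_fintype, ENNReal.sum_lt_top]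
    exact fun i _ => (eLpNorm_lt_top_iff_lintegral_rpow_enorm_lt_top (by simp) (by simp)).1 (hg i).2
  have h : ∀ n : ℕ, ∃ f : C(X, ℂ), eLpNorm (⇑f - g) 2 (∑ i, μ i) ≤ (n : ENNReal)⁻¹ := by
    intro n
    obtain ⟨f, hf, -⟩ := hσ.exists_boundedContinuous_eLpNorm_sub_le (by simp)
      (ε := (n : ENNReal)⁻¹) (by simp)
    exact ⟨f.toContinuousMap, by rw [eLpNorm_sub_comm]; exact hf⟩
  choose f hf using h
  refine ⟨f, fun i => ?_⟩
  refine tendsto_of_tendsto_of_tendsto_of_le_of_le tendsto_const_nhds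
    ENNReal.tendsto_inv_nat_nhds_zero (fun n => zero_le) (fun n => ?_)
  refine le_trans (eLpNorm_mono_measure _ ?_) (hf n)
  refine Measure.le_iff.2 fun s _ => ?_
  rw [Measure.finsetSum_apply]
  exact Finset.single_le_sum (f := fun i => μ i s) (fun _ _ => zero_le) (Finset.mem_univ i)

/-- `Φ(f) (g(·) ψ) = (f g)(·) ψ`. -/
theorem rep_borelVec (f : C(X, ℂ)) (hg : MemLp g 2 (repMeasure Φ ψ)) :
    Φ f (borelVec Φ ψ g) = borelVec Φ ψ (⇑f * g) := by
  obtain ⟨G, hG⟩ := exists_continuousMap_tendsto (fun _ : Unit => repMeasure Φ ψ) (fun _ => hg)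
  have h1 := ((Φ f).continuous.tendsto _).comp (tendsto_rep_borelVec hg (hG ()))
  have hfb : ∀ᵐ x ∂(repMeasure Φ ψ), ‖f x‖ ≤ ‖f‖ :=
    Eventually.of_forall fun x => f.norm_coe_le_norm x
  have hfg : MemLp (⇑f * g) 2 (repMeasure Φ ψ) := by
    refine hg.of_le_mul (c := ‖f‖) (f.continuous.aestronglyMeasurable.mul hg.1)
      (hfb.mono fun x hx => ?_)
    rw [Pi.mul_apply, norm_mul]
    exact mul_le_mul_of_nonneg_right hx (norm_nonneg _)
  have h2 : Tendsto (fun n => Φ (f * G n) ψ) atTop (𝓝 (borelVec Φ ψ (⇑f * g))) := by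
    refine tendsto_rep_borelVec hfg ?_
    have h3 := ENNReal.Tendsto.const_mul (a := ENNReal.ofReal ‖f‖) (hG ()) (Or.inr (by simp))
    rw [mul_zero] at h3
    refine tendsto_of_tendsto_of_tendsto_of_le_of_le tendsto_const_nhds h3
      (fun n => zero_le) (fun n => ?_)
    refine eLpNorm_le_mul_eLpNorm_of_ae_le_mul (hfb.mono fun x hx => ?_) _
    simp only [ContinuousMap.coe_mul, Pi.sub_apply, Pi.mul_apply, ← mul_sub, norm_mul]
    exact mul_le_mul_of_nonneg_right hx (norm_nonneg _)
  refine tendsto_nhds_unique h1 ?_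
  simpa [Function.comp_def] using h2

/-- The indicator function of a set, with complex values. -/
abbrev cIndicator (B : Set X) : X → ℂ := B.indicator 1

theorem memLp_cIndicator {B : Set X} (hB : MeasurableSet B) (μ : Measure X) [IsFiniteMeasure μ] :
    MemLp (cIndicator B) 2 μ :=
  (memLp_const (1 : ℂ)).indicator hB

theorem norm_borelVec_cIndicator_sq {B : Set X} (hB : MeasurableSet B) :
    ‖borelVec Φ ψ (cIndicator B)‖ ^ 2 = (repMeasure Φ ψ).real B := by
  rw [norm_borelVec_sq (memLp_cIndicator hB _), ← integral_indicator_one hB]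
  refine integral_congr_ae (Eventually.of_forall fun x => ?_)
  by_cases hx : x ∈ B <;> simp [cIndicator, hx]

theorem repMeasure_real_univ : (repMeasure Φ ψ).real Set.univ = ‖ψ‖ ^ 2 := by
  have := norm_rep_sq Φ 1 ψ
  simpa using this.symm

theorem norm_borelVec_cIndicator_le {B : Set X} (hB : MeasurableSet B) :
    ‖borelVec Φ ψ (cIndicator B)‖ ≤ 1 * ‖ψ‖ := by
  rw [one_mul, ← sq_le_sq₀ (norm_nonneg _) (norm_nonneg _), norm_borelVec_cIndicator_sq hB,
    ← repMeasure_real_univ (Φ := Φ)]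
  exact measureReal_mono (Set.subset_univ _)

variable (Φ) in
/-- The spectral projection `1_B(Φ)`. Its linearity in `ψ` is not built into `borelVec`, whose `L²`
space depends on `ψ`: it follows by approximating the indicator function by continuous functions
in all the `L²` spaces involved simultaneously. -/
def repProj {B : Set X} (hB : MeasurableSet B) : E →L[ℂ] E :=
  LinearMap.mkContinuous
    { toFun := fun ψ => borelVec Φ ψ (cIndicator B)
      map_add' := by
        intro ψ φ
        obtain ⟨f, hf⟩ := exists_continuousMap_tendsto
          (fun i : Fin 3 => repMeasure Φ (![ψ, φ, ψ + φ] i)) (fun i => memLp_cIndicator hB _)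
        have h0 := tendsto_rep_borelVec (memLp_cIndicator hB _) (hf 0)
        have h1 := tendsto_rep_borelVec (memLp_cIndicator hB _) (hf 1)
        have h2 := tendsto_rep_borelVec (memLp_cIndicator hB _) (hf 2)
        refine tendsto_nhds_unique h2 ?_
        simpa using h0.add h1
      map_smul' := by
        intro c ψ
        obtain ⟨f, hf⟩ := exists_continuousMap_tendsto
          (fun i : Fin 2 => repMeasure Φ (![ψ, c • ψ] i)) (fun i => memLp_cIndicator hB _)
        have h0 := tendsto_rep_borelVec (memLp_cIndicator hB _) (hf 0)
        have h1 := tendsto_rep_borelVec (memLp_cIndicator hB _) (hf 1)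
        refine tendsto_nhds_unique h1 ?_
        simpa using h0.const_smul c } 1 (fun ψ => norm_borelVec_cIndicator_le hB)

theorem repProj_apply {B : Set X} (hB : MeasurableSet B) (ψ : E) :
    repProj Φ hB ψ = borelVec Φ ψ (cIndicator B) := rfl

theorem repProj_inter {A B : Set X} (hA : MeasurableSet A) (hB : MeasurableSet B) :
    repProj Φ (hA.inter hB) = repProj Φ hA * repProj Φ hB := by
  ext ψ
  rw [mul_apply_eq_comp, repProj_apply, repProj_apply, repProj_apply]
  obtain ⟨f, hf⟩ := exists_continuousMap_tendsto
    (fun i : Fin 2 => repMeasure Φ (![ψ, borelVec Φ ψ (cIndicator B)] i))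
    (fun i => memLp_cIndicator hA _)
  have h1 := tendsto_rep_borelVec (memLp_cIndicator hA _) (hf 1)
  refine tendsto_nhds_unique ?_ h1
  simp only [Matrix.cons_val_one, Matrix.cons_val_zero]
  simp_rw [fun n => rep_borelVec (f n) (memLp_cIndicator (μ := repMeasure Φ ψ) hB)]
  refine tendsto_borelVec (fun n => ?_) (memLp_cIndicator (hA.inter hB) _) ?_
  · have := (memLp_continuousMap (f n) (repMeasure Φ ψ)).indicator hB
    convert! this using 1
    ext x
    by_cases hx : x ∈ B <;> simp [cIndicator, hx]
  · refine tendsto_of_tendsto_of_tendsto_of_le_of_le tendsto_const_nhds (hf 0)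
      (fun n => zero_le) (fun n => eLpNorm_mono fun x => ?_)
    by_cases hx : x ∈ B <;> by_cases hx' : x ∈ A <;> simp [cIndicator, hx, hx']

theorem isStarProjection_repProj {B : Set X} (hB : MeasurableSet B) :
    IsStarProjection (repProj Φ hB) := by
  constructor
  · have := repProj_inter (Φ := Φ) hB hB
    simp only [Set.inter_self] at this
    exact this.symm
  · rw [ContinuousLinearMap.isSelfAdjoint_iff_isSymmetric]
    intro ψ φ
    change inner ℂ (repProj Φ hB ψ) φ = inner ℂ ψ (repProj Φ hB φ)
    rw [repProj_apply, repProj_apply]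
    obtain ⟨f, hf⟩ := exists_continuousMap_tendsto
      (fun i : Fin 2 => repMeasure Φ (![ψ, φ] i)) (fun i => memLp_cIndicator hB _)
    have h0 := tendsto_rep_borelVec (memLp_cIndicator hB _) (hf 0)
    have h1 : Tendsto (fun n => Φ (star (f n)) φ) atTop (𝓝 (borelVec Φ φ (cIndicator B))) := by
      refine tendsto_rep_borelVec (memLp_cIndicator hB _) (Tendsto.congr (fun n => ?_) (hf 1))
      refine eLpNorm_congr_norm_ae (Eventually.of_forall fun x => ?_)
      have : (⇑(star (f n)) - cIndicator B) x = star ((⇑(f n) - cIndicator B) x) := by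
        by_cases hx : x ∈ B <;> simp [cIndicator, hx]
      rw [this, norm_star]
    have h2 := h0.inner (tendsto_const_nhds (x := φ)) (𝕜 := ℂ)
    have h3 := (tendsto_const_nhds (x := ψ)).inner h1 (𝕜 := ℂ)
    refine tendsto_nhds_unique h2 (h3.congr fun n => ?_)
    rw [map_star, ContinuousLinearMap.star_eq_adjoint, ContinuousLinearMap.adjoint_inner_right]
    rfl

theorem hasSum_repProj {B : ℕ → Set X} (hB : ∀ i, MeasurableSet (B i))
    (hd : Pairwise (Function.onFun Disjoint B)) (ψ : E) :
    HasSum (fun i => repProj Φ (hB i) ψ) (repProj Φ (MeasurableSet.iUnion hB) ψ) := by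
  simp_rw [repProj_apply]
  have hU := memLp_cIndicator (MeasurableSet.iUnion hB) (repMeasure Φ ψ)
  -- the remainders of the series are spectral projections to the remaining part of the union
  have key : ∀ s : Finset ℕ, borelVec Φ ψ (cIndicator (⋃ i, B i)) -
      ∑ i ∈ s, borelVec Φ ψ (cIndicator (B i)) =
        borelVec Φ ψ (cIndicator ((⋃ i, B i) \ ⋃ i ∈ s, B i)) := by
    intro s
    have hs : ∑ i ∈ s, borelVec Φ ψ (cIndicator (B i)) =
        borelVec Φ ψ (cIndicator (⋃ i ∈ s, B i)) := by
      classical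
      induction s using Finset.induction_on with
      | empty =>
        have : cIndicator (∅ : Set X) = (0 : C(X, ℂ)) := by ext; simp [cIndicator]
        simp only [Finset.sum_empty, Finset.notMem_empty, Set.iUnion_of_empty, Set.iUnion_empty]
        rw [this, borelVec_continuousMap, map_zero, zero_apply]
      | insert a s ha ih =>
        rw [Finset.sum_insert ha, ih, ← borelVec_add (memLp_cIndicator (hB a) _)
          (memLp_cIndicator (Finset.measurableSet_biUnion _ fun i _ => hB i) _)]
        congr 1
        rw [Finset.set_biUnion_insert, cIndicator, cIndicator, cIndicator,
          Set.indicator_union_of_disjoint]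
        · rfl
        rw [Set.disjoint_iUnion₂_right]
        intro i hi
        exact hd (fun h => ha (h ▸ hi))
    rw [hs, ← borelVec_sub hU
      (memLp_cIndicator (Finset.measurableSet_biUnion _ fun i _ => hB i) _)]
    congr 1
    have hsub : (⋃ i ∈ s, B i) ⊆ ⋃ i, B i := Set.iUnion₂_subset fun i _ => Set.subset_iUnion B i
    ext x
    by_cases h1 : x ∈ ⋃ i ∈ s, B i
    · simp only [cIndicator, Pi.sub_apply, Set.indicator_of_mem h1, Set.indicator_of_mem (hsub h1),
        sub_self, Set.indicator_of_notMem (fun h : x ∈ (⋃ i, B i) \ ⋃ i ∈ s, B i => h.2 h1)]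
    · by_cases h2 : x ∈ ⋃ i, B i
      · simp only [cIndicator, Pi.sub_apply, Set.indicator_of_notMem h1, Set.indicator_of_mem h2,
          sub_zero, Set.indicator_of_mem (show x ∈ (⋃ i, B i) \ ⋃ i ∈ s, B i from ⟨h2, h1⟩)]
      · simp only [cIndicator, Pi.sub_apply, Set.indicator_of_notMem h1, Set.indicator_of_notMem h2,
          sub_zero, Set.indicator_of_notMem (fun h : x ∈ (⋃ i, B i) \ ⋃ i ∈ s, B i => h2 h.1)]
  rw [HasSum, tendsto_iff_norm_sub_tendsto_zero]
  have hms : HasSum (fun i => (repMeasure Φ ψ).real (B i)) ((repMeasure Φ ψ).real (⋃ i, B i)) := by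
    have h1 := measure_iUnion (μ := repMeasure Φ ψ) hd hB
    have h2 : ∑' i, repMeasure Φ ψ (B i) ≠ ⊤ := h1 ▸ measure_ne_top _ _
    have h3 := ENNReal.hasSum_toReal h2
    rwa [← ENNReal.tsum_toReal_eq (fun i => measure_ne_top _ _), ← h1] at h3
  have h2 : Tendsto (fun s : Finset ℕ => (repMeasure Φ ψ).real (⋃ i, B i) -
      ∑ i ∈ s, (repMeasure Φ ψ).real (B i)) atTop (𝓝 0) := by
    simpa using (tendsto_const_nhds (x := (repMeasure Φ ψ).real (⋃ i, B i))).sub hms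
  have h3 := h2.sqrt
  rw [Real.sqrt_zero] at h3
  refine h3.congr fun s => ?_
  have hm : MeasurableSet (⋃ i ∈ s, B i) := Finset.measurableSet_biUnion _ fun i _ => hB i
  rw [norm_sub_rev, key, ← Real.sqrt_sq (norm_nonneg _),
    norm_borelVec_cIndicator_sq ((MeasurableSet.iUnion hB).diff hm),
    measureReal_sdiff (by exact Set.iUnion₂_subset fun i _ => Set.subset_iUnion B i) hm,
    measureReal_biUnion_finset (fun i _ j _ hij => hd hij) (fun i _ => hB i)]

theorem repProj_univ : repProj Φ (MeasurableSet.univ : MeasurableSet (Set.univ : Set X)) = 1 := by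
  ext ψ
  have : cIndicator (Set.univ : Set X) = (1 : C(X, ℂ)) := by ext; simp [cIndicator]
  rw [repProj_apply, this, borelVec_continuousMap, map_one]

theorem repProj_empty : repProj Φ (MeasurableSet.empty : MeasurableSet (∅ : Set X)) = 0 := by
  ext ψ
  have : cIndicator (∅ : Set X) = (0 : C(X, ℂ)) := by ext; simp [cIndicator]
  rw [repProj_apply, this, borelVec_continuousMap, map_zero]

variable (Φ) in
open Classical in
/-- The projection-valued measure on `ℝ` of a representation of `C(X)` and a Borel function
`h : X → ℝ`, that is, the projection-valued measure of the self-adjoint operator `h(Φ)`. -/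
def repPVM {h : X → ℝ} (hh : Measurable h) : ProjValuedMeasure E where
  proj B := if hB : MeasurableSet B then repProj Φ (hh hB) else 0
  isStarProjection B hB := by rw [dif_pos hB]; exact isStarProjection_repProj _
  proj_empty := by rw [dif_pos MeasurableSet.empty]; exact repProj_empty
  proj_univ := by rw [dif_pos MeasurableSet.univ]; exact repProj_univ
  proj_inter A B hA hB := by
    rw [dif_pos hA, dif_pos hB, dif_pos (hA.inter hB)]; exact repProj_inter _ _
  hasSum_proj B hB hd ψ := by
    rw [dif_pos (MeasurableSet.iUnion hB)]
    have := hasSum_repProj (Φ := Φ) (fun i => hh (hB i))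
      (fun i j hij => (hd hij).preimage h) ψ
    simp_rw [← Set.preimage_iUnion] at this
    refine this.congr_fun fun i => ?_
    rw [dif_pos (hB i)]

theorem repPVM_diag {h : X → ℝ} (hh : Measurable h) (ψ : E) :
    (repPVM Φ hh).diag ψ = (repMeasure Φ ψ).map h := by
  ext B hB
  rw [ProjValuedMeasure.diag_apply _ _ hB, ProjValuedMeasure.inner_eq_norm_sq _ _ hB,
    Complex.ofReal_re, Measure.map_apply hh hB]
  have : (repPVM Φ hh).proj B = repProj Φ (hh hB) := dif_pos hB
  rw [this, repProj_apply, norm_borelVec_cIndicator_sq (hh hB), ofReal_measureReal]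

end BorelCalculus

/-! ### The spectral theorem for operators with a normal resolvent -/

section SpectralTheorem

variable {E : Type*} [NormedAddCommGroup E] [InnerProductSpace ℂ E] [CompleteSpace E]

/-- The coordinate function on the spectrum. -/
def specCoord (R : E →L[ℂ] E) : C(spectrum ℂ R, ℂ) :=
  (ContinuousMap.id ℂ).restrict (spectrum ℂ R)

theorem specCoord_apply (R : E →L[ℂ] E) (z : spectrum ℂ R) : specCoord R z = z := rfl

/-- The measure of `R φ` is `|z|²` times the measure of `φ`. -/
theorem repMeasure_apply_generator {R : E →L[ℂ] E} [IsStarNormal R] (φ : E) :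
    repMeasure (cfcHom (R := ℂ) (‹IsStarNormal R› : IsStarNormal R)) (R φ) =
      (repMeasure (cfcHom (R := ℂ) (‹IsStarNormal R› : IsStarNormal R)) φ).withDensity
        (fun z => ENNReal.ofReal (‖(z : ℂ)‖ ^ 2)) := by
  set Φ := cfcHom (R := ℂ) (‹IsStarNormal R› : IsStarNormal R) with hΦ
  refine ext_of_forall_lintegral_eq_of_IsFiniteMeasure fun f => ?_
  let g : C(spectrum ℂ R, ℂ) := ⟨fun x => ((Real.sqrt (f x : ℝ) : ℝ) : ℂ), by fun_prop⟩
  have hg : ∀ x, ‖g x‖ ^ 2 = (f x : ℝ) := fun x => by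
    change ‖((Real.sqrt (f x : ℝ) : ℝ) : ℂ)‖ ^ 2 = _
    rw [Complex.norm_real, Real.norm_of_nonneg (Real.sqrt_nonneg _),
      Real.sq_sqrt (NNReal.coe_nonneg _)]
  have h1 := norm_rep_sq Φ g (R φ)
  have h2 : Φ g (R φ) = Φ (g * specCoord R) φ := by
    rw [map_mul, mul_apply_eq_comp]
    congr 2
    exact (cfcHom_id (R := ℂ) (‹IsStarNormal R› : IsStarNormal R)).symm
  rw [h2, norm_rep_sq] at h1
  simp only [ContinuousMap.mul_apply, norm_mul, mul_pow, hg, specCoord_apply] at h1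
  rw [lintegral_withDensity_eq_lintegral_mul _ (by fun_prop) (by fun_prop)]
  have e1 : ∀ x, (f x : ENNReal) = ENNReal.ofReal (f x : ℝ) := fun x => by simp
  have e2 : ∀ z : spectrum ℂ R, ((fun z : spectrum ℂ R => ENNReal.ofReal (‖(z : ℂ)‖ ^ 2)) *
      fun z => (f z : ENNReal)) z = ENNReal.ofReal ((f z : ℝ) * ‖(z : ℂ)‖ ^ 2) := fun z => by
    rw [Pi.mul_apply, e1, ENNReal.ofReal_mul (NNReal.coe_nonneg _), mul_comm]
  simp_rw [e2, e1]
  have hint : ∀ (μ : Measure (spectrum ℂ R)) [IsFiniteMeasure μ] (F : C(spectrum ℂ R, ℝ)),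
      Integrable F μ := fun μ _ F =>
    Integrable.of_bound F.continuous.aestronglyMeasurable ‖F‖
      (Eventually.of_forall fun x => F.norm_coe_le_norm x)
  have i1 : Integrable (fun x => (f x : ℝ)) (repMeasure Φ (R φ)) :=
    hint _ ⟨fun x => (f x : ℝ), by fun_prop⟩
  have i2 : Integrable (fun z => (f z : ℝ) * ‖(z : ℂ)‖ ^ 2) (repMeasure Φ φ) :=
    hint _ ⟨fun z => (f z : ℝ) * ‖(z : ℂ)‖ ^ 2, by fun_prop⟩
  rw [← ofReal_integral_eq_lintegral_ofReal i1
    (Eventually.of_forall fun x => NNReal.coe_nonneg _),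
    ← ofReal_integral_eq_lintegral_ofReal i2
    (Eventually.of_forall fun x => mul_nonneg (NNReal.coe_nonneg _) (by positivity))]
  exact congrArg ENNReal.ofReal h1.symm

/-- **Spectral theorem.** A (possibly unbounded) operator `T` with normal resolvent
`R = (T - i l)⁻¹`, `l` real, satisfying the resolvent identity `R - R* = 2 i l R* R`, has a
projection-valued measure: the image of the spectral measure of `R` under `z ↦ z⁻¹ + i l`, which is
real on the spectrum of `R` outside `0`. -/
theorem exists_isResolutionOf (T : E →ₗ.[ℂ] E) (R : E →L[ℂ] E) (l : ℝ)
    (hRnormal : IsStarNormal R) (hR : R - star R = (2 * Complex.I * l) • (star R * R))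
    (hinj : ∀ φ, R φ = 0 → φ = 0) (hdom : ∀ ψ, ψ ∈ T.domain ↔ ∃ φ, R φ = ψ)
    (hT : ∀ φ (ψ : T.domain), (ψ : E) = R φ → T ψ = φ + (Complex.I * l) • (ψ : E)) :
    ∃ P : ProjValuedMeasure E, P.IsResolutionOf T := by
  set Φ := cfcHom (R := ℂ) hRnormal with hΦ
  have hΦR : Φ (specCoord R) = R := cfcHom_id (R := ℂ) hRnormal
  have hRb : ∀ (ψ : E) (g : spectrum ℂ R → ℂ), MemLp g 2 (repMeasure Φ ψ) →
      R (borelVec Φ ψ g) = borelVec Φ ψ (⇑(specCoord R) * g) := fun ψ g hg => by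
    rw [← rep_borelVec (specCoord R) hg]
    exact congrArg (fun S : E →L[ℂ] E => S (borelVec Φ ψ g)) hΦR.symm
  -- the junk value `h 0 = 0` is harmless, as `{0}` turns out to be a null set
  let h : spectrum ℂ R → ℝ := fun z => ((z : ℂ)⁻¹).re
  have hh : Measurable h := by fun_prop
  -- on the spectrum, `z⁻¹ = h z - i l`
  have hz : ∀ z : spectrum ℂ R,
      (z : ℂ) - star (z : ℂ) = 2 * Complex.I * l * (star (z : ℂ) * z) := by
    intro z
    have h1 : Φ (specCoord R - star (specCoord R)) =
        Φ ((2 * Complex.I * l) • (star (specCoord R) * specCoord R)) := by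
      rw [map_sub, map_star, map_smul, map_mul, map_star, hΦR, hR]
    have h2 := cfcHom_injective hRnormal h1
    have h3 := congrArg (fun f : C(spectrum ℂ R, ℂ) => f z) h2
    simpa [specCoord_apply] using h3
  have hzinv : ∀ z : spectrum ℂ R, (z : ℂ) ≠ 0 → (z : ℂ) * ((h z : ℂ) - Complex.I * l) = 1 := by
    intro z hz0
    have h1 := hz z
    have hs0 : star (z : ℂ) ≠ 0 := star_ne_zero.2 hz0
    have h2 : (h z : ℂ) - Complex.I * l = (z : ℂ)⁻¹ := by
      have h3 : (star (z : ℂ))⁻¹ - (z : ℂ)⁻¹ = 2 * Complex.I * l := by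
        field_simp
        linear_combination h1
      have h4 : star ((z : ℂ)⁻¹) = (star (z : ℂ))⁻¹ := star_inv₀ _
      rw [← h4] at h3
      have h5 := congrArg Complex.im h3
      simp at h5
      apply Complex.ext
      · simp [h]
      · simp only [Complex.sub_im, Complex.ofReal_im, Complex.mul_im, Complex.I_re, Complex.I_im,
          Complex.ofReal_re, Complex.inv_im, neg_div] at h5 ⊢
        linarith
    rw [h2, mul_inv_cancel₀ hz0]
  -- `{0}` is a null set for every spectral measure, as `R` is injective
  have hnull : ∀ ψ : E, ∀ᵐ z : spectrum ℂ R ∂(repMeasure Φ ψ), (z : ℂ) ≠ 0 := by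
    intro ψ
    have hm : MeasurableSet {z : spectrum ℂ R | (z : ℂ) = 0} :=
      (measurableSet_singleton (0 : ℂ)).preimage measurable_subtype_coe
    have h1 : R (borelVec Φ ψ (cIndicator {z : spectrum ℂ R | (z : ℂ) = 0})) = 0 := by
      rw [hRb _ _ (memLp_cIndicator hm _)]
      have : ⇑(specCoord R) * cIndicator {z : spectrum ℂ R | (z : ℂ) = 0} =
          (0 : C(spectrum ℂ R, ℂ)) := by
        ext z
        by_cases h0 : (z : ℂ) = 0 <;> simp [cIndicator, h0, specCoord_apply]
      rw [this, borelVec_continuousMap, map_zero, zero_apply]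
    have h2 := norm_borelVec_cIndicator_sq (Φ := Φ) (ψ := ψ) hm
    rw [hinj _ h1, norm_zero, zero_pow two_ne_zero] at h2
    rw [ae_iff]
    simp only [not_not]
    exact (measureReal_eq_zero_iff).1 h2.symm
  have hbdd : ∀ (μ : Measure (spectrum ℂ R)) [IsFiniteMeasure μ] (F : C(spectrum ℂ R, ℝ)),
      Integrable F μ := fun μ _ F =>
    Integrable.of_bound F.continuous.aestronglyMeasurable ‖F‖
      (Eventually.of_forall fun x => F.norm_coe_le_norm x)
  have habs : ∀ z : spectrum ℂ R, (z : ℂ) ≠ 0 →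
      ‖(z : ℂ)‖ ^ 2 * (h z ^ 2 + l ^ 2) = 1 := by
    intro z hz0
    have h1 := congrArg (fun w => ‖w‖ ^ 2) (hzinv z hz0)
    simp only [norm_mul, mul_pow, norm_one, one_pow] at h1
    rw [← h1, ← Complex.normSq_eq_norm_sq ((h z : ℂ) - Complex.I * l), Complex.normSq_apply]
    simp only [Complex.sub_re, Complex.ofReal_re, Complex.mul_re, Complex.I_re, Complex.I_im,
      Complex.ofReal_im, Complex.sub_im, Complex.mul_im]
    ring
  refine ⟨repPVM Φ hh, fun ψ => ?_, fun ψ => ?_⟩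
  -- the domain: if `ψ` has a finite second moment, then `ψ = R ((h - i l)(·) ψ)`
  · rw [hdom, repPVM_diag, integrable_map_measure (by fun_prop) hh.aemeasurable]
    constructor
    · rintro ⟨φ, rfl⟩
      rw [repMeasure_apply_generator, integrable_withDensity_iff (by fun_prop) (by simp)]
      refine (integrable_const (1 : ℝ)).mono' (by fun_prop) ?_
      filter_upwards [hnull φ] with z hz0
      rw [ENNReal.toReal_ofReal (by positivity), Function.comp_apply, Real.norm_of_nonneg
        (by positivity), ← habs z hz0]
      nlinarith [mul_nonneg (sq_nonneg ‖(z : ℂ)‖) (sq_nonneg l)]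
    · intro hint
      have hg : MemLp (fun z : spectrum ℂ R => (h z : ℂ) - Complex.I * l) 2 (repMeasure Φ ψ) := by
        refine MemLp.sub ?_ (memLp_const _)
        refine MemLp.ofReal ?_
        exact (memLp_two_iff_integrable_sq hh.aestronglyMeasurable).2 hint
      refine ⟨borelVec Φ ψ (fun z => (h z : ℂ) - Complex.I * l), ?_⟩
      rw [hRb _ _ hg]
      have h1 : ⇑(specCoord R) * (fun z : spectrum ℂ R => (h z : ℂ) - Complex.I * l)
          =ᵐ[repMeasure Φ ψ] ⇑(1 : C(spectrum ℂ R, ℂ)) := by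
        filter_upwards [hnull ψ] with z hz0
        exact hzinv z hz0
      rw [borelVec_congr h1, borelVec_continuousMap, map_one]
      rfl
  · obtain ⟨ψ, hψ⟩ := ψ
    obtain ⟨φ, rfl⟩ := (hdom ψ).1 hψ
    rw [hT φ ⟨R φ, hψ⟩ rfl, repPVM_diag, integral_map hh.aemeasurable (by fun_prop),
      repMeasure_apply_generator,
      integral_withDensity_eq_integral_toReal_smul (by fun_prop) (by simp)]
    have hre : ∀ z : spectrum ℂ R, (ENNReal.ofReal (‖(z : ℂ)‖ ^ 2)).toReal • h z = (z : ℂ).re := by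
      intro z
      rw [ENNReal.toReal_ofReal (by positivity), smul_eq_mul]
      by_cases hz0 : (z : ℂ) = 0
      · simp [hz0]
      · simp only [h, Complex.inv_re, Complex.normSq_eq_norm_sq]
        have : ‖(z : ℂ)‖ ≠ 0 := norm_ne_zero_iff.2 hz0
        field_simp
    simp_rw [hre]
    -- `⟪φ, R φ⟫.re = ∫ z.re` by polarization, and the imaginary parts cancel by the resolvent
    -- identity
    have hcoord : Φ (specCoord R) φ = R φ := congrArg (fun S : E →L[ℂ] E => S φ) hΦR
    have n0 : ‖φ‖ ^ 2 = ∫ x, (1 : ℝ) ∂(repMeasure Φ φ) := by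
      rw [← repMeasure_real_univ (Φ := Φ)]; simp
    have n1 : ‖R φ‖ ^ 2 = ∫ x : spectrum ℂ R, ‖(x : ℂ)‖ ^ 2 ∂(repMeasure Φ φ) := by
      rw [← hcoord, norm_rep_sq]; rfl
    have n2 : ‖φ + R φ‖ ^ 2 = ∫ x : spectrum ℂ R, ‖1 + (x : ℂ)‖ ^ 2 ∂(repMeasure Φ φ) := by
      have : φ + R φ = Φ (1 + specCoord R) φ := by
        rw [map_add, map_one, add_apply, hcoord]; rfl
      rw [this, norm_rep_sq]; rfl
    have i0 : Integrable (fun x : spectrum ℂ R => (x : ℂ).re) (repMeasure Φ φ) :=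
      hbdd _ ⟨fun x : spectrum ℂ R => (x : ℂ).re, by fun_prop⟩
    have i1 : Integrable (fun x : spectrum ℂ R => ‖(x : ℂ)‖ ^ 2) (repMeasure Φ φ) :=
      hbdd _ ⟨fun x : spectrum ℂ R => ‖(x : ℂ)‖ ^ 2, by fun_prop⟩
    have n3 : ∫ x : spectrum ℂ R, ‖1 + (x : ℂ)‖ ^ 2 ∂(repMeasure Φ φ) =
        (∫ x, (1 : ℝ) ∂(repMeasure Φ φ)) +
          (∫ x : spectrum ℂ R, ‖(x : ℂ)‖ ^ 2 ∂(repMeasure Φ φ)) +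
          2 * ∫ x : spectrum ℂ R, (x : ℂ).re ∂(repMeasure Φ φ) := by
      have i2 : Integrable (fun x : spectrum ℂ R => 1 + ‖(x : ℂ)‖ ^ 2) (repMeasure Φ φ) :=
        (integrable_const _).add i1
      rw [← integral_const_mul, ← integral_add (integrable_const _) i1,
        ← integral_add i2 (i0.const_mul 2)]
      refine integral_congr_ae (Eventually.of_forall fun x => ?_)
      simp only
      rw [← Complex.normSq_eq_norm_sq, ← Complex.normSq_eq_norm_sq, Complex.normSq_apply,
        Complex.normSq_apply]
      simp only [Complex.add_re, Complex.one_re, Complex.add_im, Complex.one_im]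
      ring
    have n4 := norm_add_sq (𝕜 := ℂ) φ (R φ)
    have hre1 : (inner ℂ φ (R φ)).re = ∫ x : spectrum ℂ R, (x : ℂ).re ∂(repMeasure Φ φ) := by
      have : RCLike.re (inner ℂ φ (R φ)) = (inner ℂ φ (R φ)).re := rfl
      linarith
    have him : inner ℂ φ (R φ) - inner ℂ (R φ) φ = 2 * Complex.I * l * (‖R φ‖ ^ 2 : ℝ) := by
      have h1 := congrArg (fun S : E →L[ℂ] E => inner ℂ φ (S φ)) hR
      simp only [sub_apply, inner_sub_right, smul_apply, inner_smul_right, mul_apply_eq_comp,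
        ContinuousLinearMap.star_eq_adjoint, ContinuousLinearMap.adjoint_inner_right] at h1
      rw [h1, inner_self_eq_norm_sq_to_K]
      push_cast
      rfl
    rw [inner_add_right, inner_smul_right, inner_self_eq_norm_sq_to_K, ← hre1]
    have hconj : (starRingEnd ℂ) (inner ℂ φ (R φ)) = inner ℂ (R φ) φ := inner_conj_symm _ _
    have hadd : inner ℂ φ (R φ) + inner ℂ (R φ) φ = (2 * (inner ℂ φ (R φ)).re : ℝ) := by
      rw [← hconj, Complex.add_conj]
    push_cast at him hadd ⊢
    change _ + _ * ((‖R φ‖ : ℂ) ^ 2) = _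
    linear_combination (1 / 2) * hadd - (1 / 2) * him

end SpectralTheorem

/-! ### Projection-valued measures and their operators -/

namespace ProjValuedMeasure

variable {E : Type*} [NormedAddCommGroup E] [InnerProductSpace ℂ E] [CompleteSpace E]
variable (P : ProjValuedMeasure E) {A B : Set ℝ} {φ ψ : E}

theorem proj_proj (hA : MeasurableSet A) (hB : MeasurableSet B) (ψ : E) :
    P.proj A (P.proj B ψ) = P.proj (A ∩ B) ψ := by
  rw [P.proj_inter A B hA hB, mul_apply_eq_comp]

theorem inner_proj_left (hB : MeasurableSet B) (φ ψ : E) :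
    inner ℂ (P.proj B φ) ψ = inner ℂ φ (P.proj B ψ) := by
  rw [← ContinuousLinearMap.adjoint_inner_right,
    (P.isStarProjection B hB).isSelfAdjoint.adjoint_eq]

theorem proj_compl_add (hB : MeasurableSet B) (ψ : E) : P.proj Bᶜ ψ + P.proj B ψ = ψ := by
  -- finite additivity, from countable additivity along the sequence `Bᶜ, B, ∅, ∅, …`
  let C : ℕ → Set ℝ := fun n => if n = 0 then Bᶜ else if n = 1 then B else ∅
  have hC : ∀ i, MeasurableSet (C i) := by
    intro i
    simp only [C]
    split_ifs
    exacts [hB.compl, hB, MeasurableSet.empty]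
  have hd : Pairwise (Function.onFun Disjoint C) := by
    intro i j hij
    simp only [C, Function.onFun]
    split_ifs with h1 h2 h3 h4 h5 h6
    · omega
    · exact disjoint_compl_left
    · exact Set.disjoint_empty _
    · exact disjoint_compl_right
    · omega
    · exact Set.disjoint_empty _
    all_goals exact Set.empty_disjoint _
  have hU : ⋃ i, C i = Set.univ := by
    refine Set.eq_univ_of_forall fun x => Set.mem_iUnion.2 ?_
    by_cases hx : x ∈ B
    · exact ⟨1, by simpa [C] using hx⟩
    · exact ⟨0, by simpa [C] using hx⟩
  have h1 := P.hasSum_proj C hC hd ψ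
  rw [hU, P.proj_univ] at h1
  have h2 : HasSum (fun i => P.proj (C i) ψ) (∑ i ∈ Finset.range 2, P.proj (C i) ψ) :=
    hasSum_sum_of_ne_finset_zero (by
    intro i hi
    have h0 : i ≠ 0 := by rintro rfl; simp at hi
    have h1 : i ≠ 1 := by rintro rfl; simp at hi
    simp [C, h0, h1, P.proj_empty])
  have h3 := h2.unique h1
  simpa [Finset.sum_range_succ, C] using h3

theorem diag_apply_eq_norm_sq (hB : MeasurableSet B) (ψ : E) :
    P.diag ψ B = ENNReal.ofReal (‖P.proj B ψ‖ ^ 2) := by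
  rw [P.diag_apply ψ hB, P.inner_eq_norm_sq ψ hB, Complex.ofReal_re]

theorem diag_univ (ψ : E) : P.diag ψ Set.univ = ENNReal.ofReal (‖ψ‖ ^ 2) := by
  rw [P.diag_apply_eq_norm_sq MeasurableSet.univ, P.proj_univ, one_apply_eq_self]

instance (ψ : E) : IsFiniteMeasure (P.diag ψ) := ⟨by rw [P.diag_univ]; exact ENNReal.ofReal_lt_top⟩

theorem diag_real (hB : MeasurableSet B) (ψ : E) : (P.diag ψ).real B = ‖P.proj B ψ‖ ^ 2 := by
  rw [Measure.real, P.diag_apply_eq_norm_sq hB, ENNReal.toReal_ofReal (by positivity)]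

theorem diag_proj (hB : MeasurableSet B) (ψ : E) :
    P.diag (P.proj B ψ) = (P.diag ψ).restrict B := by
  ext A hA
  rw [Measure.restrict_apply hA, P.diag_apply_eq_norm_sq hA, P.diag_apply_eq_norm_sq (hA.inter hB),
    P.proj_proj hA hB]

/-- Polarization of the scalar measures. -/
theorem diag_add_real (hB : MeasurableSet B) (φ ψ : E) :
    (P.diag (φ + ψ)).real B =
      (P.diag φ).real B + (P.diag ψ).real B + 2 * (inner ℂ φ (P.proj B ψ)).re := by
  rw [P.diag_real hB, P.diag_real hB, P.diag_real hB, map_add, norm_add_sq (𝕜 := ℂ),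
    P.inner_proj_left hB, P.proj_proj hB hB, Set.inter_self]
  change _ + 2 * (inner ℂ φ (P.proj B ψ)).re + _ = _
  ring

namespace IsResolutionOf

variable {P} {T : E →ₗ.[ℂ] E} (hP : P.IsResolutionOf T)
include hP

theorem integrable_id (hψ : ψ ∈ T.domain) : Integrable (fun x : ℝ => x) (P.diag ψ) :=
  ((memLp_two_iff_integrable_sq aestronglyMeasurable_id).2 ((hP.1 ψ).1 hψ)).integrable (by simp)

theorem proj_mem_domain (hB : MeasurableSet B) (hψ : ψ ∈ T.domain) : P.proj B ψ ∈ T.domain := by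
  rw [hP.1, P.diag_proj hB]
  exact ((hP.1 ψ).1 hψ).restrict

theorem proj_mem_domain_of_bounded (hB : MeasurableSet B) {n : ℝ} (hn : B ⊆ Set.Icc (-n) n)
    (ψ : E) : P.proj B ψ ∈ T.domain := by
  rw [hP.1, P.diag_proj hB]
  refine (integrable_const (n ^ 2)).mono' (by fun_prop) ?_
  filter_upwards [ae_restrict_mem hB] with x hx
  rw [Real.norm_of_nonneg (sq_nonneg x)]
  exact sq_le_sq' (hn hx).1 (hn hx).2

theorem inner_apply_im (ψ : T.domain) : (inner ℂ (ψ : E) (T ψ)).im = 0 := by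
  rw [hP.2 ψ, Complex.ofReal_im]

/-- An operator with a projection-valued measure is symmetric, since its quadratic form is real. -/
theorem inner_apply_symm (φ ψ : T.domain) :
    inner ℂ (φ : E) (T ψ) = inner ℂ (T φ) (ψ : E) := by
  have h0 := hP.inner_apply_im φ
  have h1 := hP.inner_apply_im ψ
  have h2 := hP.inner_apply_im (φ + ψ)
  have h3 := hP.inner_apply_im (φ + Complex.I • ψ)
  have hc : inner ℂ (T φ) (ψ : E) = (starRingEnd ℂ) (inner ℂ (ψ : E) (T φ)) :=
    (inner_conj_symm _ _).symm
  simp only [LinearPMap.map_add, LinearPMap.map_smul, Submodule.coe_add, Submodule.coe_smul,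
    inner_add_left, inner_add_right, inner_smul_left, inner_smul_right, Complex.add_im,
    Complex.mul_im, Complex.conj_I, Complex.I_re, Complex.I_im, Complex.neg_re, Complex.neg_im,
    Complex.add_re, Complex.mul_re] at h2 h3
  rw [hc]
  apply Complex.ext
  · rw [Complex.conj_re]; linarith
  · rw [Complex.conj_im]; linarith

theorem re_inner_apply (ψ : T.domain) :
    (inner ℂ (ψ : E) (T ψ)).re = ∫ x, x ∂(P.diag (ψ : E)) := by
  rw [hP.2 ψ, Complex.ofReal_re]

/-- If the mixed spectral measure of `φ` and `ψ` vanishes, then so does the mixed form of `T`,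
because the spectral measure of `φ + ψ` is then the sum of those of `φ` and `ψ`. -/
theorem re_inner_apply_eq_zero (φ ψ : T.domain)
    (h : ∀ B, MeasurableSet B → inner ℂ (φ : E) (P.proj B ψ) = 0) :
    (inner ℂ (φ : E) (T ψ)).re = 0 := by
  have hm : P.diag ((φ + ψ : T.domain) : E) = P.diag (φ : E) + P.diag (ψ : E) := by
    ext B hB
    rw [← measureReal_eq_measureReal_iff, Submodule.coe_add, P.diag_add_real hB, h B hB,
      measureReal_add_apply]
    simp
  have h1 := hP.re_inner_apply (φ + ψ)
  rw [hm, integral_add_measure (hP.integrable_id φ.2) (hP.integrable_id ψ.2),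
    ← hP.re_inner_apply, ← hP.re_inner_apply, LinearPMap.map_add, Submodule.coe_add, inner_add_left,
    inner_add_right, inner_add_right, Complex.add_re, Complex.add_re, Complex.add_re] at h1
  have h2 : (inner ℂ (ψ : E) (T φ)).re = (inner ℂ (φ : E) (T ψ)).re := by
    rw [hP.inner_apply_symm φ ψ, ← inner_conj_symm, Complex.conj_re]
  linarith

theorem inner_apply_eq_zero (φ ψ : T.domain)
    (h : ∀ B, MeasurableSet B → inner ℂ (φ : E) (P.proj B ψ) = 0) :
    inner ℂ (φ : E) (T ψ) = 0 := by
  have h1 := hP.re_inner_apply_eq_zero φ ψ h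
  have h2 := hP.re_inner_apply_eq_zero φ (Complex.I • ψ) (fun B hB => by
    rw [Submodule.coe_smul, map_smul, inner_smul_right, h B hB, mul_zero])
  rw [LinearPMap.map_smul, inner_smul_right, Complex.I_mul_re] at h2
  exact Complex.ext h1 (by simpa using h2)

/-- `T` maps the range of a spectral projection to itself: `T (P(B) ψ)` is orthogonal to the vectors
of bounded spectral support in the range of `P(Bᶜ)`, and these are dense there. -/
theorem proj_compl_apply_proj (hB : MeasurableSet B) (ψ : T.domain) :
    P.proj Bᶜ (T ⟨P.proj B ψ, hP.proj_mem_domain hB ψ.2⟩) = 0 := by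
  set w := T ⟨P.proj B ψ, hP.proj_mem_domain hB ψ.2⟩ with hw
  have hn : ∀ n : ℕ, P.proj (Set.Icc (-(n : ℝ)) n) (P.proj Bᶜ w) = 0 := by
    intro n
    have hm : MeasurableSet (Set.Icc (-(n : ℝ)) n) := measurableSet_Icc
    have hdom := hP.proj_mem_domain_of_bounded hm subset_rfl (P.proj Bᶜ w)
    have h0 := hP.inner_apply_eq_zero ⟨_, hdom⟩ ⟨P.proj B ψ, hP.proj_mem_domain hB ψ.2⟩ (by
      intro C hC
      simp only
      rw [P.inner_proj_left hm, P.inner_proj_left hB.compl, P.proj_proj hC hB,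
        P.proj_proj hm (hC.inter hB), P.proj_proj hB.compl (hm.inter (hC.inter hB))]
      have : Bᶜ ∩ (Set.Icc (-(n : ℝ)) n ∩ (C ∩ B)) = ∅ := by
        ext x; simp; tauto
      rw [this, P.proj_empty, zero_apply, inner_zero_right])
    rw [← hw] at h0
    simp only at h0
    rw [P.proj_proj hm hB.compl] at h0 ⊢
    rw [P.inner_proj_left (hm.inter hB.compl), P.inner_eq_norm_sq _ (hm.inter hB.compl)] at h0
    simpa using h0
  have h1 : P.diag (P.proj Bᶜ w) Set.univ = 0 := by
    have hU : (Set.univ : Set ℝ) = ⋃ n : ℕ, Set.Icc (-(n : ℝ)) n := by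
      refine (Set.eq_univ_of_forall fun x => Set.mem_iUnion.2 ?_).symm
      obtain ⟨n, hn⟩ := exists_nat_ge |x|
      exact ⟨n, abs_le.1 hn⟩
    rw [hU]
    refine measure_iUnion_null fun n => ?_
    rw [P.diag_apply_eq_norm_sq measurableSet_Icc, hn]
    simp
  rw [P.diag_univ] at h1
  simpa using h1

/-- The operator commutes with its spectral projections. -/
theorem apply_proj (hB : MeasurableSet B) (ψ : T.domain) :
    T ⟨P.proj B ψ, hP.proj_mem_domain hB ψ.2⟩ = P.proj B (T ψ) := by
  have h1 := hP.proj_compl_apply_proj hB ψ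
  have h2 := hP.proj_compl_apply_proj hB.compl ψ
  simp only [compl_compl] at h2
  set a : T.domain := ⟨P.proj B ψ, hP.proj_mem_domain hB ψ.2⟩
  set b : T.domain := ⟨P.proj Bᶜ ψ, hP.proj_mem_domain hB.compl ψ.2⟩
  have h3 : ψ = b + a := Subtype.ext (P.proj_compl_add hB ψ).symm
  have h4 := P.proj_compl_add hB (T a)
  rw [h1, zero_add] at h4
  conv_rhs => rw [h3]
  rw [LinearPMap.map_add, map_add, h2, zero_add, h4]

/-- `‖T ψ‖² = ∫ x² d⟨ψ, P(x) ψ⟩` for vectors with bounded spectral support. For such a vector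
`φ = T ψ` is again in the domain, and `⟨φ, T ψ⟩` is computed by polarization, in terms of the scalar
measures of `φ + ψ` and `φ - ψ`. -/
theorem norm_apply_sq_of_bounded {n : ℝ} (hn : 0 ≤ n) (ψ : T.domain)
    (hψ : P.proj (Set.Icc (-n) n) ψ = ψ) :
    ‖T ψ‖ ^ 2 = ∫ x, x ^ 2 ∂(P.diag (ψ : E)) := by
  have hK : MeasurableSet (Set.Icc (-n) n) := measurableSet_Icc
  have hTK : P.proj (Set.Icc (-n) n) (T ψ) = T ψ := by
    rw [← hP.apply_proj hK]
    congr 1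
    exact Subtype.ext hψ
  have hdom : T ψ ∈ T.domain := by
    rw [← hTK]
    exact hP.proj_mem_domain_of_bounded hK subset_rfl _
  set φ : T.domain := ⟨T ψ, hdom⟩ with hφ
  have hsupp : ∀ᵐ x ∂(P.diag (ψ : E)), x ∈ Set.Icc (-n) n := by
    rw [← hψ, P.diag_proj hK]
    exact ae_restrict_mem hK
  have hx : Integrable (fun x : ℝ => x) (P.diag (ψ : E)) := hP.integrable_id ψ.2
  have hx2 : Integrable (fun x : ℝ => x ^ 2) (P.diag (ψ : E)) := (hP.1 ψ).1 ψ.2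
  -- the mixed spectral measure of `T ψ` and `ψ` is `x` times that of `ψ`
  have hmix : ∀ B, MeasurableSet B →
      (inner ℂ (φ : E) (P.proj B ψ)).re = ∫ x in B, x ∂(P.diag (ψ : E)) := by
    intro B hB
    have h1 := hP.re_inner_apply ⟨P.proj B ψ, hP.proj_mem_domain hB ψ.2⟩
    rw [hP.apply_proj hB] at h1
    simp only at h1
    rw [P.diag_proj hB, P.inner_proj_left hB, P.proj_proj hB hB, Set.inter_self,
      ← P.inner_proj_left hB, ← inner_conj_symm, Complex.conj_re] at h1
    exact h1
  -- `x` times the measure of `ψ` is a signed measure; adding `n` times the measure of `ψ` makes it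
  -- positive, as the measure of `ψ` lives on `[-n, n]`
  set σ := (P.diag (ψ : E)).withDensity (fun x => ENNReal.ofReal (x + n)) with hσ
  have hxn : Integrable (fun x => x + n) (P.diag (ψ : E)) := hx.add (integrable_const _)
  have hpos : 0 ≤ᵐ[P.diag (ψ : E)] fun x => x + n := by
    filter_upwards [hsupp] with x h
    have := h.1
    simp only [Pi.zero_apply]
    linarith
  have hσB : ∀ B, MeasurableSet B → σ B = ENNReal.ofReal (∫ x in B, (x + n) ∂(P.diag (ψ : E))) := by
    intro B hB
    rw [hσ, withDensity_apply _ hB, ofReal_integral_eq_lintegral_ofReal hxn.restrict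
      (ae_restrict_of_ae hpos)]
  have hσfin : IsFiniteMeasure σ := ⟨by rw [hσB _ MeasurableSet.univ]; exact ENNReal.ofReal_lt_top⟩
  have hσreal : ∀ B, MeasurableSet B → σ.real B =
      (∫ x in B, x ∂(P.diag (ψ : E))) + n * (P.diag (ψ : E)).real B := by
    intro B hB
    rw [Measure.real, hσB B hB, ENNReal.toReal_ofReal
      (integral_nonneg_of_ae (ae_restrict_of_ae hpos)),
      integral_add hx.restrict (integrable_const _)]
    simp [mul_comm]
  -- polarization, rearranged into an identity of positive measures
  have hmeas : P.diag ((φ + ψ : T.domain) : E) + ENNReal.ofReal (4 * n) • P.diag (ψ : E) =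
      P.diag ((φ - ψ : T.domain) : E) + ENNReal.ofReal 4 • σ := by
    ext B hB
    have hfin1 : IsFiniteMeasure (ENNReal.ofReal (4 * n) • P.diag (ψ : E)) :=
      Measure.smul_finite _ ENNReal.ofReal_ne_top
    have hfin2 : IsFiniteMeasure (ENNReal.ofReal 4 • σ) :=
      Measure.smul_finite _ ENNReal.ofReal_ne_top
    rw [← measureReal_eq_measureReal_iff, measureReal_add_apply, measureReal_add_apply,
      measureReal_ennreal_smul_apply, measureReal_ennreal_smul_apply, hσreal B hB,
      ENNReal.toReal_ofReal (by positivity), ENNReal.toReal_ofReal (by norm_num),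
      sub_eq_add_neg, Submodule.coe_add, Submodule.coe_add, P.diag_add_real hB,
      P.diag_add_real hB, hmix B hB, Submodule.coe_neg, map_neg, inner_neg_right, Complex.neg_re,
      hmix B hB, P.diag_real hB (-(ψ : E)), P.diag_real hB (ψ : E), map_neg, norm_neg]
    ring
  have hint : ∫ x, x ∂(P.diag ((φ + ψ : T.domain) : E) + ENNReal.ofReal (4 * n) • P.diag (ψ : E)) =
      ∫ x, x ∂(P.diag ((φ - ψ : T.domain) : E) + ENNReal.ofReal 4 • σ) := by rw [hmeas]
  have hσx : Integrable (fun x : ℝ => x) σ := by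
    rw [hσ, integrable_withDensity_iff (by fun_prop) (by simp)]
    have : Integrable (fun x => x ^ 2 + n * x) (P.diag (ψ : E)) := hx2.add (hx.const_mul n)
    refine this.congr ?_
    filter_upwards [hpos] with x h
    rw [ENNReal.toReal_ofReal h]
    ring
  have hσint : ∫ x, x ∂σ = (∫ x, x ^ 2 ∂(P.diag (ψ : E))) + n * ∫ x, x ∂(P.diag (ψ : E)) := by
    rw [hσ, integral_withDensity_eq_integral_toReal_smul (by fun_prop) (by simp),
      ← integral_const_mul, ← integral_add hx2 (hx.const_mul n)]
    refine integral_congr_ae ?_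
    filter_upwards [hpos] with x h
    rw [ENNReal.toReal_ofReal h, smul_eq_mul]
    ring
  rw [integral_add_measure (hP.integrable_id (φ + ψ).2)
      (hx.smul_measure ENNReal.ofReal_ne_top),
    integral_add_measure (hP.integrable_id (φ - ψ).2) (hσx.smul_measure ENNReal.ofReal_ne_top),
    integral_smul_measure, integral_smul_measure, hσint, ← hP.re_inner_apply (φ + ψ),
    ← hP.re_inner_apply (φ - ψ), ← hP.re_inner_apply ψ,
    ENNReal.toReal_ofReal (by positivity), ENNReal.toReal_ofReal (by norm_num), smul_eq_mul,
    smul_eq_mul, LinearPMap.map_add, LinearPMap.map_sub, Submodule.coe_add, Submodule.coe_sub,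
    inner_add_left, inner_add_right, inner_add_right, inner_sub_left, inner_sub_right,
    inner_sub_right] at hint
  have hs : inner ℂ (ψ : E) (T φ) = inner ℂ (φ : E) (T ψ) := by
    rw [hP.inner_apply_symm ψ φ]
  have hnorm : (inner ℂ (φ : E) (T ψ)).re = ‖T ψ‖ ^ 2 := inner_self_eq_norm_sq (𝕜 := ℂ) _
  rw [hs] at hint
  simp only [Complex.add_re, Complex.sub_re, hnorm] at hint
  linarith

/-- The spectral measure of `T` at `T ψ` is `x²` times the spectral measure at `ψ`. -/
theorem diag_apply_eq (ψ : T.domain) :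
    P.diag (T ψ) = (P.diag (ψ : E)).withDensity (fun x => ENNReal.ofReal (x ^ 2)) := by
  have hU : ⋃ n : ℕ, Set.Icc (-(n : ℝ)) n = Set.univ := by
    refine Set.eq_univ_of_forall fun x => Set.mem_iUnion.2 ?_
    obtain ⟨n, hn⟩ := exists_nat_ge |x|
    exact ⟨n, abs_le.1 hn⟩
  -- it suffices to compare the two measures on bounded sets, which reduces to bounded support
  refine Measure.ext_of_iUnion_eq_univ hU fun n => ?_
  ext B hB
  have hK : MeasurableSet (Set.Icc (-(n : ℝ)) n) := measurableSet_Icc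
  have hBK := hB.inter hK
  rw [Measure.restrict_apply hB, Measure.restrict_apply hB, P.diag_apply_eq_norm_sq hBK,
    ← hP.apply_proj hBK, withDensity_apply _ hBK]
  rw [hP.norm_apply_sq_of_bounded (n := n) (by positivity)]
  · simp only
    rw [P.diag_proj hBK, ofReal_integral_eq_lintegral_ofReal ((hP.1 ψ).1 ψ.2).restrict
      (Eventually.of_forall fun x => sq_nonneg x)]
  · simp only
    rw [P.proj_proj hK hBK]
    congr 2
    ext x
    simp only [Set.mem_inter_iff]
    tauto

end IsResolutionOf

end ProjValuedMeasure

/-! ### Self-adjointness of the Anderson Hamiltonian -/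

section AndersonResolvent

variable {d : ℕ}

/-- Translation of the argument on `ℓ²(ℤ^d)`. -/
def shiftL2 (a : LatticeZ d) : LatticeL2 d →L[ℂ] LatticeL2 d :=
  LinearMap.mkContinuous
    { toFun := fun u => ⟨fun n => u (n + a), memℓp_gen
        ((Equiv.addRight a).summable_iff.2 ((lp.memℓp u).summable (by simp)))⟩
      map_add' := fun _ _ => rfl
      map_smul' := fun _ _ => rfl } 1 (fun u => by
    rw [one_mul, lp.norm_eq_tsum_rpow (by simp), lp.norm_eq_tsum_rpow (by simp)]
    refine le_of_eq (congrArg (fun t : ℝ => t ^ (1 / (2 : ENNReal).toReal)) ?_)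
    exact (Equiv.addRight a).tsum_eq (fun n => ‖u n‖ ^ (2 : ENNReal).toReal))

theorem shiftL2_apply (a : LatticeZ d) (u : LatticeL2 d) (n : LatticeZ d) :
    shiftL2 a u n = u (n + a) := rfl

theorem norm_shiftL2_le (a : LatticeZ d) : ‖shiftL2 a‖ ≤ 1 :=
  LinearMap.mkContinuous_norm_le _ zero_le_one _

theorem inner_shiftL2 (a : LatticeZ d) (u v : LatticeL2 d) :
    inner ℂ u (shiftL2 a v) = inner ℂ (shiftL2 (-a) u) v := by
  rw [lp.inner_eq_tsum, lp.inner_eq_tsum]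
  rw [← (Equiv.addRight a).tsum_eq (fun n => inner ℂ ((shiftL2 (-a) u) n) (v n))]
  refine tsum_congr fun n => ?_
  simp [shiftL2_apply]

/-- The hopping term `Δ` as a bounded operator on `ℓ²(ℤ^d)`. -/
def hoppingL2 (d : ℕ) : LatticeL2 d →L[ℂ] LatticeL2 d :=
  ∑ i : Fin d, (shiftL2 (Pi.single i 1) + shiftL2 (-Pi.single i 1))

theorem hoppingL2_apply (u : LatticeL2 d) (n : LatticeZ d) :
    hoppingL2 d u n = ∑ i : Fin d, (u (n + Pi.single i 1) + u (n - Pi.single i 1)) := by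
  rw [hoppingL2, sum_apply, lp.coeFn_sum, Finset.sum_apply]
  rfl

theorem norm_hoppingL2_le : ‖hoppingL2 d‖ ≤ 2 * d := by
  refine (norm_sum_le _ _).trans ?_
  refine (Finset.sum_le_card_nsmul _ _ 2 fun i _ => ?_).trans (by simp [mul_comm])
  refine (norm_add_le _ _).trans ?_
  linarith [norm_shiftL2_le (Pi.single i 1 : LatticeZ d),
    norm_shiftL2_le (-Pi.single i 1 : LatticeZ d)]

theorem inner_hoppingL2 (u v : LatticeL2 d) :
    inner ℂ u (hoppingL2 d v) = inner ℂ (hoppingL2 d u) v := by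
  simp only [hoppingL2, sum_apply, add_apply, inner_sum, sum_inner, inner_add_left, inner_add_right,
    inner_shiftL2, neg_neg]
  exact Finset.sum_congr rfl fun i _ => add_comm _ _

theorem andersonFormal_apply (ω : LatticeZ d → ℝ) (u : LatticeL2 d) (n : LatticeZ d) :
    andersonFormal ω u n = hoppingL2 d u n + ω n * u n := by
  rw [hoppingL2_apply]
  rfl

theorem norm_mul_le_norm_smul_apply {m : LatticeZ d → ℂ} {c : ℝ} (hc : 0 ≤ c)
    (hm : ∀ n, ‖m n‖ ≤ c) (u : LatticeL2 d) (n : LatticeZ d) :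
    ‖m n * u n‖ ≤ ‖((c : ℂ) • u) n‖ := by
  rw [lp.coeFn_smul, Pi.smul_apply, norm_mul, norm_smul, Complex.norm_real, Real.norm_of_nonneg hc]
  exact mul_le_mul_of_nonneg_right (hm n) (norm_nonneg _)

/-- Multiplication by a bounded function on `ℓ²(ℤ^d)`. -/
def mulL2 (m : LatticeZ d → ℂ) (c : ℝ) (hc : 0 ≤ c) (hm : ∀ n, ‖m n‖ ≤ c) :
    LatticeL2 d →L[ℂ] LatticeL2 d :=
  LinearMap.mkContinuous
    { toFun := fun u => ⟨fun n => m n * u n,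
        (lp.memℓp ((c : ℂ) • u)).mono' (norm_mul_le_norm_smul_apply hc hm u)⟩
      map_add' := fun u v => by
        ext n
        exact mul_add _ _ _
      map_smul' := fun a u => by
        ext n
        exact mul_left_comm _ _ _ } c (fun u => by
    refine (lp.norm_mono two_ne_zero (norm_mul_le_norm_smul_apply hc hm u)).trans ?_
    rw [norm_smul, Complex.norm_real, Real.norm_of_nonneg hc])

theorem norm_mulL2_le {m : LatticeZ d → ℂ} {c : ℝ} (hc : 0 ≤ c) (hm : ∀ n, ‖m n‖ ≤ c) :
    ‖mulL2 m c hc hm‖ ≤ c :=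
  LinearMap.mkContinuous_norm_le _ hc _

/-- The resolvent `(H^ω - i l)⁻¹` for `|l| > 2 d`, from a Neumann series around the resolvent of the
potential: `H^ω - i l = (1 + Δ (V^ω - i l)⁻¹) (V^ω - i l)`, where `‖Δ‖ ≤ 2 d` and
`‖(V^ω - i l)⁻¹‖ ≤ |l|⁻¹`. -/
theorem exists_andersonResolvent (ω : LatticeZ d → ℝ) {l : ℝ} (hl : 2 * d < |l|) :
    ∃ R : LatticeL2 d →L[ℂ] LatticeL2 d,
      (∀ φ n, andersonFormal ω (R φ) n = φ n + Complex.I * l * R φ n) ∧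
      ∀ u φ : LatticeL2 d, (∀ n, andersonFormal ω u n = φ n + Complex.I * l * u n) → u = R φ := by
  have hl0 : 0 < |l| := lt_of_le_of_lt (by positivity) hl
  have hm : ∀ n, ‖((ω n : ℂ) - Complex.I * l)⁻¹‖ ≤ |l|⁻¹ := fun n => by
    rw [norm_inv]
    refine inv_anti₀ hl0 ?_
    have := Complex.abs_im_le_norm ((ω n : ℂ) - Complex.I * l)
    simpa using this
  have hne : ∀ n, (ω n : ℂ) - Complex.I * l ≠ 0 := fun n h => by
    have := congrArg Complex.im h
    simp at this
    simp [this] at hl0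
  set M := mulL2 (fun n => ((ω n : ℂ) - Complex.I * l)⁻¹) |l|⁻¹ (by positivity) hm with hM
  have hMapp : ∀ u n, M u n = ((ω n : ℂ) - Complex.I * l)⁻¹ * u n := fun u n => rfl
  have hnorm : ‖-(hoppingL2 d * M)‖ < 1 := by
    rw [norm_neg]
    refine (norm_mul_le _ _).trans_lt ?_
    have h1 := mul_le_mul (norm_hoppingL2_le (d := d))
      (norm_mulL2_le (by positivity : (0 : ℝ) ≤ |l|⁻¹) hm) (norm_nonneg _) (by positivity)
    refine h1.trans_lt ?_
    rwa [← div_eq_mul_inv, div_lt_one hl0]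
  obtain ⟨A, hA⟩ := isUnit_one_sub_of_norm_lt_one hnorm
  rw [sub_neg_eq_add] at hA
  have h1 : ∀ φ, (A⁻¹ : (LatticeL2 d →L[ℂ] LatticeL2 d)ˣ).1 φ +
      hoppingL2 d (M ((A⁻¹ : (LatticeL2 d →L[ℂ] LatticeL2 d)ˣ).1 φ)) = φ := fun φ => by
    have h := congrArg (fun S : LatticeL2 d →L[ℂ] LatticeL2 d => S φ) A.mul_inv
    simp only [hA] at h
    exact h
  have h2 : ∀ χ φ, χ + hoppingL2 d (M χ) = φ →
      χ = (A⁻¹ : (LatticeL2 d →L[ℂ] LatticeL2 d)ˣ).1 φ := fun χ φ hχ => by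
    have h := congrArg (fun S : LatticeL2 d →L[ℂ] LatticeL2 d => S χ) A.inv_mul
    simp only [hA] at h
    rw [← hχ]
    exact h.symm
  refine ⟨M * (A⁻¹ : (LatticeL2 d →L[ℂ] LatticeL2 d)ˣ).1, fun φ n => ?_, fun u φ hu => ?_⟩
  · rw [mul_apply_eq_comp, andersonFormal_apply]
    have h := congrArg (fun v : LatticeL2 d => v n) (h1 φ)
    simp only [lp.coeFn_add, Pi.add_apply] at h
    set χ := (A⁻¹ : (LatticeL2 d →L[ℂ] LatticeL2 d)ˣ).1 φ
    have h3 : ((ω n : ℂ) - Complex.I * l) * M χ n = χ n := by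
      rw [hMapp, mul_inv_cancel_left₀ (hne n)]
    linear_combination h + h3
  · have h3 : M (φ - hoppingL2 d u) = u := by
      ext n
      have h4 := hu n
      rw [andersonFormal_apply] at h4
      rw [hMapp, lp.coeFn_sub, Pi.sub_apply, inv_mul_eq_iff_eq_mul₀ (hne n)]
      linear_combination -h4
    rw [mul_apply_eq_comp, ← h2 (φ - hoppingL2 d u) φ (by rw [h3]; abel), h3]

theorem mem_andersonOperator_domain (ω : LatticeZ d → ℝ) (u : LatticeL2 d) :
    u ∈ (andersonOperator ω).domain ↔ Memℓp (andersonFormal ω u) 2 := Iff.rfl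

theorem andersonOperator_apply (ω : LatticeZ d → ℝ) (u : (andersonOperator ω).domain)
    (n : LatticeZ d) : andersonOperator ω u n = andersonFormal ω (u : LatticeL2 d) n := rfl

/-- `H^ω` is symmetric. The potential part `H^ω u - Δ u = V^ω u` of `u` in the domain is in `ℓ²`. -/
theorem inner_andersonOperator (ω : LatticeZ d → ℝ) (u v : (andersonOperator ω).domain) :
    inner ℂ (u : LatticeL2 d) (andersonOperator ω v) =
      inner ℂ (andersonOperator ω u) (v : LatticeL2 d) := by
  have h1 : ∀ w : (andersonOperator ω).domain, andersonOperator ω w =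
      hoppingL2 d w + (andersonOperator ω w - hoppingL2 d w) := fun w => by abel
  have h2 : ∀ (w : (andersonOperator ω).domain) n,
      (andersonOperator ω w - hoppingL2 d w) n = ω n * (w : LatticeL2 d) n := fun w n => by
    rw [lp.coeFn_sub, Pi.sub_apply, andersonOperator_apply, andersonFormal_apply]
    ring
  rw [h1 u, h1 v, inner_add_left, inner_add_right, inner_hoppingL2]
  congr 1
  rw [lp.inner_eq_tsum, lp.inner_eq_tsum]
  refine tsum_congr fun n => ?_
  rw [h2, h2]
  simp only [RCLike.inner_apply, map_mul, Complex.conj_ofReal]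
  ring

/-- **Spectral theorem for the Anderson Hamiltonian.** The resolvent is normal, and the resolvent
identity holds, because `(H^ω - i l)⁻¹` and its adjoint `(H^ω + i l)⁻¹` both exist. -/
theorem exists_isResolutionOf_andersonOperator (ω : LatticeZ d → ℝ) :
    ∃ P : ProjValuedMeasure (LatticeL2 d), P.IsResolutionOf (andersonOperator ω) := by
  set l : ℝ := 2 * d + 1 with hl
  have hl1 : 2 * d < |l| := by rw [abs_of_nonneg (by positivity)]; linarith
  have hl2 : 2 * d < |-l| := by rwa [abs_neg]
  obtain ⟨R, hR, hRu⟩ := exists_andersonResolvent ω hl1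
  obtain ⟨S, hS, hSu⟩ := exists_andersonResolvent ω hl2
  have hRdom : ∀ φ, R φ ∈ (andersonOperator ω).domain := fun φ => by
    rw [mem_andersonOperator_domain]
    have : andersonFormal ω (R φ) = (φ + (Complex.I * l) • R φ : LatticeL2 d) := by
      ext n; rw [hR]; rfl
    rw [this]
    exact lp.memℓp _
  have hSdom : ∀ φ, S φ ∈ (andersonOperator ω).domain := fun φ => by
    rw [mem_andersonOperator_domain]
    have : andersonFormal ω (S φ) = (φ + (Complex.I * (-l : ℝ)) • S φ : LatticeL2 d) := by
      ext n; rw [hS]; rfl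
    rw [this]
    exact lp.memℓp _
  have hTR : ∀ φ, andersonOperator ω ⟨R φ, hRdom φ⟩ = φ + (Complex.I * l) • R φ := fun φ => by
    ext n; exact hR φ n
  have hTS : ∀ φ, andersonOperator ω ⟨S φ, hSdom φ⟩ =
      φ + (Complex.I * (-l : ℝ)) • S φ := fun φ => by
    ext n; exact hS φ n
  -- the resolvents `R` at `i l` and `S` at `-i l` are adjoint to each other, as `H^ω` is symmetric
  have hadj : star R = S := by
    rw [ContinuousLinearMap.star_eq_adjoint]
    symm
    rw [ContinuousLinearMap.eq_adjoint_iff]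
    intro φ χ
    have h := inner_andersonOperator ω ⟨S φ, hSdom φ⟩ ⟨R χ, hRdom χ⟩
    rw [hTR, hTS] at h
    simp only [inner_add_left, inner_add_right, inner_smul_left, inner_smul_right, map_mul,
      Complex.conj_I, Complex.conj_ofReal] at h
    push_cast at h
    linear_combination h
  have hRS : ∀ φ, R φ = S φ + (2 * Complex.I * l) • S (R φ) := fun φ => by
    have h := hSu (R φ) (φ + (2 * Complex.I * l) • R φ) (fun n => by
      rw [hR, lp.coeFn_add, Pi.add_apply, lp.coeFn_smul, Pi.smul_apply, smul_eq_mul]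
      push_cast
      ring)
    rw [map_add, map_smul] at h
    exact h
  have hSR : ∀ φ, S φ = R φ - (2 * Complex.I * l) • R (S φ) := fun φ => by
    have h := hRu (S φ) (φ - (2 * Complex.I * l) • S φ) (fun n => by
      rw [hS, lp.coeFn_sub, Pi.sub_apply, lp.coeFn_smul, Pi.smul_apply, smul_eq_mul]
      push_cast
      ring)
    rw [map_sub, map_smul] at h
    exact h
  have hl0 : (2 * Complex.I * l : ℂ) ≠ 0 := by
    have : (l : ℂ) ≠ 0 := by
      have : l ≠ 0 := by positivity
      exact_mod_cast this
    simp [this]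
  refine exists_isResolutionOf (andersonOperator ω) R l ⟨?_⟩ ?_ ?_ ?_ ?_
  · rw [hadj]
    refine ContinuousLinearMap.ext fun φ => ?_
    have hpq : ∀ x y p q : LatticeL2 d, x = y + p → y = x - q → p = q := by
      intro x y p q h1 h2
      have h3 : p - q = (y + p) - x + ((x - q) - y) := by abel
      rw [← h1, ← h2, sub_self, sub_self, add_zero] at h3
      exact sub_eq_zero.1 h3
    have h := hpq _ _ _ _ (hRS φ) (hSR φ)
    exact smul_right_injective _ hl0 h
  · rw [hadj]
    refine ContinuousLinearMap.ext fun φ => ?_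
    change R φ - S φ = (2 * Complex.I * l) • S (R φ)
    conv_lhs => rw [hRS φ]
    abel
  · intro φ hφ
    ext n
    have h := hR φ n
    rw [hφ, lp.coeFn_zero, map_zero] at h
    simpa using h.symm
  · intro ψ
    constructor
    · intro hψ
      refine ⟨andersonOperator ω ⟨ψ, hψ⟩ - (Complex.I * l) • ψ, (hRu ψ _ fun n => ?_).symm⟩
      rw [lp.coeFn_sub, Pi.sub_apply, andersonOperator_apply, lp.coeFn_smul, Pi.smul_apply,
        smul_eq_mul]
      ring
    · rintro ⟨φ, rfl⟩
      exact hRdom φ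
  · rintro φ ⟨ψ, hψ⟩ rfl
    exact hTR φ

/-- The projection-valued measure chosen in `spectralMeasureAt` for the Anderson Hamiltonian. -/
theorem exists_spectralMeasureAt_eq (ω : LatticeZ d → ℝ) :
    ∃ P : ProjValuedMeasure (LatticeL2 d), P.IsResolutionOf (andersonOperator ω) ∧
      ∀ ψ, spectralMeasureAt (andersonOperator ω) ψ = P.diag ψ := by
  have h := exists_isResolutionOf_andersonOperator ω
  exact ⟨h.choose, h.choose_spec, fun ψ => dif_pos h⟩

end AndersonResolvent

/-! ### Powers of the Hamiltonian and finite propagation -/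

section FinitePropagation

variable {d : ℕ}

theorem mem_latticeBox {L : ℕ} {n : LatticeZ d} : n ∈ latticeBox d L ↔ ∀ i, |n i| ≤ L := by
  simp [latticeBox, abs_le]

theorem latticeBox_mono {k l : ℕ} (h : k ≤ l) : latticeBox d k ⊆ latticeBox d l := fun n hn => by
  rw [mem_latticeBox] at *
  exact fun i => (hn i).trans (by exact_mod_cast h)

theorem add_mem_latticeBox {k l : ℕ} {n m : LatticeZ d} (hn : n ∈ latticeBox d k)
    (hm : m ∈ latticeBox d l) : n + m ∈ latticeBox d (k + l) := by
  rw [mem_latticeBox] at *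
  intro i
  have := abs_add_le (n i) (m i)
  have := hn i
  have := hm i
  rw [Pi.add_apply]
  push_cast
  omega

theorem neg_mem_latticeBox {k : ℕ} {n : LatticeZ d} (hn : n ∈ latticeBox d k) :
    -n ∈ latticeBox d k := by
  rw [mem_latticeBox] at *
  intro i
  rw [Pi.neg_apply, abs_neg]
  exact hn i

theorem single_mem_latticeBox (i : Fin d) : (Pi.single i 1 : LatticeZ d) ∈ latticeBox d 1 := by
  rw [mem_latticeBox]
  intro j
  by_cases h : j = i
  · subst h; simp
  · simp [h]

theorem card_latticeBox (d L : ℕ) : (latticeBox d L).card = (2 * L + 1) ^ d := by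
  rw [latticeBox, Fintype.card_piFinset]
  simp only [Int.card_Icc, Finset.prod_const, Finset.card_univ, Fintype.card_fin]
  congr 1
  omega

theorem andersonFormal_eq (ω : LatticeZ d → ℝ) (u : LatticeZ d → ℂ) (n : LatticeZ d) :
    andersonFormal ω u n =
      (∑ i : Fin d, (u (n + Pi.single i 1) + u (n - Pi.single i 1))) + (ω n : ℂ) * u n := rfl

/-- The orbit `(χ_S H^ω)^k δ_m` of a basis vector under the Hamiltonian restricted to `S ⊆ ℤ^d`. -/
def restrictedOrbit (S : Set (LatticeZ d)) (ω : LatticeZ d → ℝ) (m : LatticeZ d) :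
    ℕ → LatticeZ d → ℂ
  | 0 => Pi.single m 1
  | k + 1 => S.indicator (andersonFormal ω (restrictedOrbit S ω m k))

variable {S : Set (LatticeZ d)} {ω ω' : LatticeZ d → ℝ} {m n : LatticeZ d} {k : ℕ}

/-- Finite propagation: `k` steps reach at most distance `k`. -/
theorem restrictedOrbit_eq_zero (h : n - m ∉ latticeBox d k) : restrictedOrbit S ω m k n = 0 := by
  induction k generalizing n with
  | zero =>
    have : n ≠ m := by
      rintro rfl
      exact h (by rw [mem_latticeBox]; simp)
    simp [restrictedOrbit, this]
  | succ k ih =>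
    have h0 : restrictedOrbit S ω m k n = 0 :=
      ih fun h' => h (latticeBox_mono (Nat.le_succ k) h')
    have h1 : ∀ i, restrictedOrbit S ω m k (n + Pi.single i 1) = 0 := fun i => ih fun h' => h (by
      have := add_mem_latticeBox h' (neg_mem_latticeBox (single_mem_latticeBox i))
      convert! this using 1
      abel)
    have h2 : ∀ i, restrictedOrbit S ω m k (n - Pi.single i 1) = 0 := fun i => ih fun h' => h (by
      have := add_mem_latticeBox h' (single_mem_latticeBox i)
      convert! this using 1
      abel)
    rw [restrictedOrbit, Set.indicator_apply_eq_zero]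
    intro _
    rw [andersonFormal_eq, h0]
    simp [h1, h2]

/-- Each application of the Hamiltonian adds `2 * d` neighbours and one value of the potential, and
only sites at distance at most `k` from `m` are visited. -/
theorem norm_restrictedOrbit_le {M : ℝ} (hM : 0 ≤ M)
    (h : ∀ j, j - m ∈ latticeBox d k → |ω j| ≤ M) :
    ‖restrictedOrbit S ω m k n‖ ≤ (2 * d + M) ^ k := by
  induction k generalizing n with
  | zero =>
    by_cases hnm : n = m
    · subst hnm; simp [restrictedOrbit]
    · simp [restrictedOrbit, hnm]
  | succ k ih =>
    have ih' := fun n => ih (n := n) fun j hj => h j (latticeBox_mono (Nat.le_succ k) hj)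
    refine (norm_indicator_le_norm_self _ _).trans ?_
    rw [andersonFormal_eq, pow_succ', add_mul]
    refine (norm_add_le _ _).trans (add_le_add ?_ ?_)
    · refine (norm_sum_le _ _).trans ?_
      refine (Finset.sum_le_card_nsmul _ _ (2 * (2 * d + M) ^ k) fun i _ => ?_).trans
        (le_of_eq ?_)
      · refine (norm_add_le _ _).trans ?_
        linarith [ih' (n + Pi.single i 1), ih' (n - Pi.single i 1)]
      · simp
        ring
    · rw [norm_mul, Complex.norm_real, Real.norm_eq_abs]
      by_cases hn : n - m ∈ latticeBox d k
      · exact mul_le_mul (h n (latticeBox_mono (Nat.le_succ k) hn)) (ih' n) (norm_nonneg _) hM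
      · rw [restrictedOrbit_eq_zero hn, norm_zero, mul_zero]
        positivity

/-- The restriction is not felt before the boundary is reached. -/
theorem restrictedOrbit_eq_univ (h : ∀ j, j - m ∈ latticeBox d k → j ∈ S) :
    restrictedOrbit S ω m k = restrictedOrbit Set.univ ω m k := by
  induction k with
  | zero => rfl
  | succ k ih =>
    have ih' := ih fun j hj => h j (latticeBox_mono (Nat.le_succ k) hj)
    funext n
    by_cases hn : n ∈ S
    · rw [restrictedOrbit, restrictedOrbit, ih', Set.indicator_of_mem hn,
        Set.indicator_of_mem (Set.mem_univ n)]
    · have hn' : n - m ∉ latticeBox d (k + 1) := fun h' => hn (h n h')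
      rw [restrictedOrbit_eq_zero hn', restrictedOrbit_eq_zero hn']

theorem restrictedOrbit_congr (h : ∀ j, j - m ∈ latticeBox d k → ω j = ω' j) :
    restrictedOrbit S ω m k = restrictedOrbit S ω' m k := by
  induction k with
  | zero => rfl
  | succ k ih =>
    have ih' := ih fun j hj => h j (latticeBox_mono (Nat.le_succ k) hj)
    rw [restrictedOrbit, restrictedOrbit, ih']
    congr 1
    funext n
    rw [andersonFormal_eq, andersonFormal_eq]
    by_cases hn : n - m ∈ latticeBox d k
    · rw [h n (latticeBox_mono (Nat.le_succ k) hn)]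
    · rw [restrictedOrbit_eq_zero hn]
      simp

/-- Translation covariance. -/
theorem restrictedOrbit_translate (a : LatticeZ d) :
    restrictedOrbit Set.univ (fun j => ω (j + a)) m k n =
      restrictedOrbit Set.univ ω (m + a) k (n + a) := by
  induction k generalizing n with
  | zero =>
    by_cases h : n = m
    · subst h; simp [restrictedOrbit]
    · simp [restrictedOrbit, h]
  | succ k ih =>
    simp only [restrictedOrbit, Set.indicator_univ, andersonFormal_eq, ih]
    congr 2
    funext i
    congr 2 <;> abel

theorem measurable_restrictedOrbit (S : Set (LatticeZ d)) (m n : LatticeZ d) (k : ℕ) :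
    Measurable fun ω => restrictedOrbit S ω m k n := by
  induction k generalizing n with
  | zero => exact measurable_const
  | succ k ih =>
    by_cases hn : n ∈ S
    · simp only [restrictedOrbit, Set.indicator_of_mem hn, andersonFormal_eq]
      refine Measurable.add (Finset.measurable_sum _ fun i _ => (ih _).add (ih _)) ?_
      exact (Complex.measurable_ofReal.comp (measurable_pi_apply n)).mul (ih n)
    · simp only [restrictedOrbit, Set.indicator_of_notMem hn]
      exact measurable_const

/-! ### Moments of the spectral measure at `δ_0` -/

theorem memℓp_restrictedOrbit (S : Set (LatticeZ d)) (ω : LatticeZ d → ℝ) (m : LatticeZ d)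
    (k : ℕ) :
    Memℓp (restrictedOrbit S ω m k) 2 := by
  refine (memℓp_zero ?_).of_exponent_ge zero_le
  refine ((latticeBox d k).finite_toSet.preimage (sub_left_injective (b := m)).injOn).subset ?_
  intro n hn
  by_contra h
  exact hn (restrictedOrbit_eq_zero h)

/-- `(H^ω)^k δ_m` as a vector of `ℓ²`. -/
def orbitL2 (ω : LatticeZ d → ℝ) (m : LatticeZ d) (k : ℕ) : LatticeL2 d :=
  ⟨restrictedOrbit Set.univ ω m k, memℓp_restrictedOrbit _ _ _ _⟩

theorem orbitL2_apply : orbitL2 ω m k n = restrictedOrbit Set.univ ω m k n := rfl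

theorem orbitL2_zero : orbitL2 ω m 0 = latticeDelta m := rfl

theorem andersonFormal_orbitL2 : andersonFormal ω (orbitL2 ω m k) = orbitL2 ω m (k + 1) := by
  funext n
  rw [orbitL2_apply, restrictedOrbit, Set.indicator_univ]
  rfl

theorem orbitL2_mem_domain (ω : LatticeZ d → ℝ) (m : LatticeZ d) (k : ℕ) :
    orbitL2 ω m k ∈ (andersonOperator ω).domain := by
  rw [mem_andersonOperator_domain, andersonFormal_orbitL2]
  exact lp.memℓp _

theorem andersonOperator_orbitL2 :
    andersonOperator ω ⟨orbitL2 ω m k, orbitL2_mem_domain ω m k⟩ = orbitL2 ω m (k + 1) := by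
  ext n
  rw [andersonOperator_apply, andersonFormal_orbitL2]

/-- `⟨H^j δ_m, H^k δ_m⟩ = ⟨δ_m, H^{j+k} δ_m⟩`. -/
theorem inner_orbitL2 (j k : ℕ) :
    inner ℂ (orbitL2 ω m j) (orbitL2 ω m k) = restrictedOrbit Set.univ ω m (j + k) m := by
  induction j generalizing k with
  | zero =>
    rw [orbitL2_zero, latticeDelta, lp.inner_single_left, zero_add, orbitL2_apply]
    simp
  | succ j ih =>
    have h := inner_andersonOperator ω ⟨_, orbitL2_mem_domain ω m j⟩ ⟨_, orbitL2_mem_domain ω m k⟩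
    rw [andersonOperator_orbitL2, andersonOperator_orbitL2] at h
    simp only at h
    rw [← h, ih, show j + 1 + k = j + (k + 1) by ring]

/-- The `k`-th moment `⟨δ_0, (H^ω)^k δ_0⟩` of the spectral measure at the origin. -/
def originMoment (k : ℕ) (ω : LatticeZ d → ℝ) : ℝ := (restrictedOrbit Set.univ ω 0 k 0).re

/-- The spectral measure at `(H^ω)^k δ_m` is `x ^ (2 * k)` times the one at `δ_m`; in particular the
latter has finite moments. -/
theorem diag_orbitL2 {P : ProjValuedMeasure (LatticeL2 d)}
    (hP : P.IsResolutionOf (andersonOperator ω)) (k : ℕ) : P.diag (orbitL2 ω m k) =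
      (P.diag (latticeDelta m)).withDensity (fun x => ENNReal.ofReal (x ^ (2 * k))) := by
  induction k with
  | zero => simp [orbitL2_zero]
  | succ k ih =>
    have h := hP.diag_apply_eq ⟨_, orbitL2_mem_domain ω m k⟩
    rw [andersonOperator_orbitL2] at h
    rw [h]
    simp only
    rw [ih, ← withDensity_mul _ (by fun_prop) (by fun_prop)]
    congr 1
    funext x
    rw [Pi.mul_apply, ← ENNReal.ofReal_mul ((even_two_mul k).pow_nonneg x)]
    congr 1
    ring

theorem integrable_pow_of_even {m : Measure ℝ} [IsFiniteMeasure m]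
    (h : ∀ k : ℕ, Integrable (fun x : ℝ => x ^ (2 * k)) m) (k : ℕ) :
    Integrable (fun x : ℝ => x ^ k) m := by
  refine ((integrable_const (1 : ℝ)).add (h k)).mono' (by fun_prop)
    (Eventually.of_forall fun x => ?_)
  rw [Pi.add_apply, Real.norm_eq_abs, abs_pow, ← (even_two_mul k).pow_abs x]
  rcases le_total |x| 1 with h | h
  · have := pow_le_one₀ (n := k) (abs_nonneg x) h
    have : 0 ≤ |x| ^ (2 * k) := by positivity
    linarith
  · have := pow_le_pow_right₀ h (show k ≤ 2 * k by omega)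
    linarith

theorem integrable_pow_diag {P : ProjValuedMeasure (LatticeL2 d)}
    (hP : P.IsResolutionOf (andersonOperator ω)) (k : ℕ) :
    Integrable (fun x : ℝ => x ^ k) (P.diag (latticeDelta m)) := by
  refine integrable_pow_of_even (fun k => ?_) k
  refine ⟨by fun_prop, ?_⟩
  rw [hasFiniteIntegral_iff_ofReal (Eventually.of_forall fun x => (even_two_mul k).pow_nonneg x)]
  have h := congrArg (fun ρ : Measure ℝ => ρ Set.univ) (diag_orbitL2 (m := m) hP k)
  simp only [withDensity_apply _ MeasurableSet.univ, Measure.restrict_univ] at h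
  rw [← h]
  exact measure_lt_top _ _

theorem integral_pow_diag {P : ProjValuedMeasure (LatticeL2 d)}
    (hP : P.IsResolutionOf (andersonOperator ω)) (k : ℕ) :
    ∫ x, x ^ k ∂(P.diag (latticeDelta 0)) = originMoment k ω := by
  have hd : ∀ (j : ℕ) (f : ℝ → ℝ), ∫ x, f x ∂(P.diag (orbitL2 ω 0 j)) =
      ∫ x, x ^ (2 * j) * f x ∂(P.diag (latticeDelta 0)) := by
    intro j f
    rw [diag_orbitL2 hP, integral_withDensity_eq_integral_toReal_smul (by fun_prop) (by simp)]
    refine integral_congr_ae (Eventually.of_forall fun x => ?_)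
    simp only
    rw [ENNReal.toReal_ofReal ((even_two_mul j).pow_nonneg x), smul_eq_mul]
  -- even moments `2 * j` are squared norms of `H^j δ_0`, odd ones `2 * j + 1` are values of the
  -- quadratic form of `H` at `H^j δ_0`
  obtain ⟨j, rfl | rfl⟩ := Nat.even_or_odd' k
  · have h1 := hd j (fun _ => 1)
    simp only [mul_one] at h1
    have h2 : ∫ _, (1 : ℝ) ∂(P.diag (orbitL2 ω 0 j)) = ‖orbitL2 ω 0 j‖ ^ 2 := by
      rw [integral_const, smul_eq_mul, mul_one, P.diag_real MeasurableSet.univ, P.proj_univ,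
        one_apply_eq_self]
    rw [← h1, h2, originMoment, two_mul, ← inner_orbitL2]
    exact (inner_self_eq_norm_sq (𝕜 := ℂ) _).symm
  · have h1 := hd j (fun x => x)
    have h2 := hP.re_inner_apply ⟨_, orbitL2_mem_domain ω 0 j⟩
    rw [andersonOperator_orbitL2] at h2
    simp only at h2
    rw [inner_orbitL2, h1] at h2
    rw [originMoment, show 2 * j + 1 = j + (j + 1) by ring, h2]
    refine integral_congr_ae (Eventually.of_forall fun x => ?_)
    simp only
    ring

/-! ### Finite-volume matrices -/

theorem andersonMatrix_apply (ω : LatticeZ d → ℝ) (L : ℕ) (n m : latticeBox d L) :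
    andersonMatrix ω L n m = andersonFormal ω (Pi.single (m : LatticeZ d) 1) (n : LatticeZ d) := rfl

theorem andersonMatrix_isHermitian (ω : LatticeZ d → ℝ) (L : ℕ) :
    (andersonMatrix ω L).IsHermitian := by
  ext n m
  rw [Matrix.conjTranspose_apply, andersonMatrix_apply, andersonMatrix_apply, andersonFormal_eq,
    andersonFormal_eq]
  simp only [Pi.single_apply, star_add, star_sum, star_mul']
  congr 1
  · refine Finset.sum_congr rfl fun i _ => ?_
    have e1 : ((m : LatticeZ d) + Pi.single i 1 = (n : LatticeZ d)) ↔
        ((n : LatticeZ d) - Pi.single i 1 = (m : LatticeZ d)) := by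
      rw [← eq_sub_iff_add_eq, eq_comm]
    have e2 : ((m : LatticeZ d) - Pi.single i 1 = (n : LatticeZ d)) ↔
        ((n : LatticeZ d) + Pi.single i 1 = (m : LatticeZ d)) := by
      rw [← eq_sub_iff_add_eq, eq_comm]
    simp only [e1, e2, apply_ite star, star_one, star_zero]
    exact add_comm _ _
  · by_cases h : (m : LatticeZ d) = n
    · simp [h]
    · simp [h, Ne.symm h]

theorem andersonMatrix_pow_apply (ω : LatticeZ d → ℝ) (L k : ℕ) (n m : latticeBox d L) :
    (andersonMatrix ω L ^ k) n m = restrictedOrbit (latticeBox d L) ω m k n := by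
  induction k generalizing n with
  | zero =>
    rw [pow_zero, Matrix.one_apply, restrictedOrbit, Pi.single_apply]
    by_cases h : n = m
    · rw [if_pos h, if_pos (congrArg Subtype.val h)]
    · rw [if_neg h, if_neg fun h' => h (Subtype.ext h')]
  | succ k ih =>
    rw [pow_succ', Matrix.mul_apply]
    -- the orbit is supported in the cube, hence a combination of the basis vectors of the cube
    have hsum : restrictedOrbit (latticeBox d L) ω m k =
        ∑ j : latticeBox d L, restrictedOrbit (latticeBox d L) ω m k j •
          (Pi.single (j : LatticeZ d) 1 : LatticeZ d → ℂ) := by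
      funext x
      rw [Finset.sum_apply]
      simp only [Pi.smul_apply, Pi.single_apply, smul_eq_mul, mul_ite, mul_one, mul_zero]
      by_cases hx : x ∈ latticeBox d L
      · rw [Finset.sum_eq_single ⟨x, hx⟩]
        · simp
        · intro j _ hj
          rw [if_neg]
          rintro rfl
          exact hj rfl
        · simp
      · rw [Finset.sum_eq_zero]
        · cases k with
          | zero =>
            have : x ≠ m := by rintro rfl; exact hx m.2
            simp [restrictedOrbit, this]
          | succ k => rw [restrictedOrbit, Set.indicator_of_notMem (by simpa using hx)]
        · intro j _
          rw [if_neg]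
          rintro rfl
          exact hx j.2
    rw [restrictedOrbit, Set.indicator_of_mem (by simp), hsum, map_sum, Finset.sum_apply]
    refine Finset.sum_congr rfl fun j _ => ?_
    rw [ih, andersonMatrix_apply, map_smul, Pi.smul_apply, smul_eq_mul, mul_comm]

end FinitePropagation

section MatrixSpectralMeasure

variable {ι : Type*} [Fintype ι] [DecidableEq ι] {A : Matrix ι ι ℂ}

/-- The spectral measure of a Hermitian matrix at the `i`-th standard basis vector: the eigenvalues,
weighted by the squared `i`-th coordinates of an orthonormal basis of eigenvectors. -/
def matrixSpectralMeasure (hA : A.IsHermitian) (i : ι) : Measure ℝ :=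
  ∑ j, ENNReal.ofReal (‖(hA.eigenvectorUnitary : Matrix ι ι ℂ) i j‖ ^ 2) •
    Measure.dirac (hA.eigenvalues j)

theorem integrable_matrixSpectralMeasure (hA : A.IsHermitian) (i : ι) (f : ℝ → ℝ) :
    Integrable f (matrixSpectralMeasure hA i) := by
  rw [matrixSpectralMeasure, integrable_finsetSum_measure]
  exact fun j _ => (integrable_dirac (by simp)).smul_measure ENNReal.ofReal_ne_top

theorem integral_matrixSpectralMeasure (hA : A.IsHermitian) (i : ι) (f : ℝ → ℝ) :
    ∫ x, f x ∂(matrixSpectralMeasure hA i) =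
      ∑ j, ‖(hA.eigenvectorUnitary : Matrix ι ι ℂ) i j‖ ^ 2 * f (hA.eigenvalues j) := by
  rw [matrixSpectralMeasure, integral_finsetSum_measure (fun j _ =>
    (integrable_dirac (by simp)).smul_measure ENNReal.ofReal_ne_top)]
  refine Finset.sum_congr rfl fun j _ => ?_
  rw [integral_smul_measure, integral_dirac, ENNReal.toReal_ofReal (by positivity), smul_eq_mul]

theorem cfc_apply_diag (hA : A.IsHermitian) (i : ι) (f : ℝ → ℝ) :
    (cfc f A) i i = ((∫ x, f x ∂(matrixSpectralMeasure hA i) : ℝ) : ℂ) := by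
  rw [integral_matrixSpectralMeasure, hA.cfc_eq, Matrix.IsHermitian.cfc,
    Unitary.conjStarAlgAut_apply, Matrix.mul_apply]
  push_cast
  refine Finset.sum_congr rfl fun j _ => ?_
  rw [Matrix.mul_diagonal, Matrix.star_apply, Function.comp_apply, Function.comp_apply]
  rw [← Complex.mul_conj']
  change _ * (f _ : ℂ) * _ = _
  simp only [RCLike.star_def]
  ring

theorem isProbabilityMeasure_matrixSpectralMeasure (hA : A.IsHermitian) (i : ι) :
    IsProbabilityMeasure (matrixSpectralMeasure hA i) := by
  have h := cfc_apply_diag hA i (fun _ => 1)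
  have h1 : cfc (fun _ : ℝ => (1 : ℝ)) A = 1 := cfc_const_one ℝ A
  rw [h1, Matrix.one_apply_eq, integral_const, smul_eq_mul, mul_one] at h
  have hfin : matrixSpectralMeasure hA i Set.univ ≠ ⊤ := by
    have := (integrable_const_iff_isFiniteMeasure (one_ne_zero (α := ℝ))).1
      (integrable_matrixSpectralMeasure hA i fun _ => 1)
    exact measure_ne_top _ _
  constructor
  have h2 : (matrixSpectralMeasure hA i).real Set.univ = 1 := by exact_mod_cast h.symm
  rw [Measure.real] at h2
  rw [← ENNReal.ofReal_toReal hfin, h2, ENNReal.ofReal_one]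

theorem integral_pow_matrixSpectralMeasure (hA : A.IsHermitian) (i : ι) (k : ℕ) :
    ∫ x, x ^ k ∂(matrixSpectralMeasure hA i) = ((A ^ k) i i).re := by
  have h := cfc_apply_diag hA i (fun x => x ^ k)
  rw [cfc_pow_id A k hA.isSelfAdjoint] at h
  rw [h, Complex.ofReal_re]

end MatrixSpectralMeasure

/-! ### The law of large numbers for local functions of the potential -/

section LawOfLargeNumbers

theorem ae_tendsto_zero_of_summable_integral {Ω : Type*} [MeasurableSpace Ω] {P : Measure Ω}
    {X : ℕ → Ω → ℝ} (hX : ∀ j, Integrable (X j) P) (h0 : ∀ j ω, 0 ≤ X j ω)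
    (hs : Summable fun j => ∫ ω, X j ω ∂P) : ∀ᵐ ω ∂P, Tendsto (fun j => X j ω) atTop (𝓝 0) := by
  have h1 : ∫⁻ ω, ∑' j, ENNReal.ofReal (X j ω) ∂P ≠ ⊤ := by
    rw [lintegral_tsum fun j => (hX j).aemeasurable.ennreal_ofReal]
    simp_rw [← fun j => ofReal_integral_eq_lintegral_ofReal (hX j) (Eventually.of_forall (h0 j))]
    exact hs.tsum_ofReal_ne_top
  have h2 := ae_lt_top' (AEMeasurable.tsum fun j => (hX j).aemeasurable.ennreal_ofReal) h1
  filter_upwards [h2] with ω hω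
  have h3 := ENNReal.tendsto_atTop_zero_of_tsum_ne_top hω.ne
  have h4 := (ENNReal.tendsto_toReal ENNReal.zero_ne_top).comp h3
  simpa [Function.comp_def, ENNReal.toReal_ofReal (h0 _ ω)] using h4

variable {d : ℕ}

/-- Translation of a potential. -/
def shiftPotential (a : LatticeZ d) (ω : LatticeZ d → ℝ) : LatticeZ d → ℝ := fun j => ω (j + a)

theorem measurePreserving_shiftPotential (μ : Measure ℝ) [IsProbabilityMeasure μ] (a : LatticeZ d) :
    MeasurePreserving (shiftPotential a) (potentialLaw d μ) (potentialLaw d μ) :=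
  ⟨measurable_pi_lambda _ fun j => measurable_pi_apply (j + a),
    Measure.map_infinitePi_infinitePi_of_inj (P := fun _ : LatticeZ d => μ)
      (add_left_injective a)⟩

/-- A function of the potential depending only on the sites of the cube of radius `k`. -/
def IsLocal (k : ℕ) (F : (LatticeZ d → ℝ) → ℝ) : Prop :=
  ∀ ω ω' : LatticeZ d → ℝ, (∀ j ∈ latticeBox d k, ω j = ω' j) → F ω = F ω'

/-- Extension of a configuration on a finite set by zero. -/
def extendZero (T : Finset (LatticeZ d)) (ρ : T → ℝ) : LatticeZ d → ℝ :=
  fun j => if h : j ∈ T then ρ ⟨j, h⟩ else 0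

theorem measurable_extendZero (T : Finset (LatticeZ d)) : Measurable (extendZero T) := by
  refine measurable_pi_lambda _ fun j => ?_
  by_cases h : j ∈ T
  · simp only [extendZero, dif_pos h]
    exact measurable_pi_apply _
  · simp only [extendZero, dif_neg h]
    exact measurable_const

variable {μ : Measure ℝ} [IsProbabilityMeasure μ] {k : ℕ} {F : (LatticeZ d → ℝ) → ℝ}

instance : IsProbabilityMeasure (potentialLaw d μ) := by
  unfold potentialLaw
  infer_instance

theorem IsLocal.indepFun_shiftPotential (hF : Measurable F) (hk : IsLocal k F) {n m : LatticeZ d}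
    (hnm : n - m ∉ latticeBox d (2 * k)) :
    ProbabilityTheory.IndepFun (fun ω => F (shiftPotential n ω)) (fun ω => F (shiftPotential m ω))
      (potentialLaw d μ) := by
  classical
  let T : LatticeZ d → Finset (LatticeZ d) := fun a => (latticeBox d k).image fun j => j + a
  have hdisj : Disjoint (T n) (T m) := by
    rw [Finset.disjoint_left]
    intro x hx hy
    simp only [T, Finset.mem_image] at hx hy
    obtain ⟨i, hi, rfl⟩ := hx
    obtain ⟨j, hj, hji⟩ := hy
    apply hnm
    have h := add_mem_latticeBox hj (neg_mem_latticeBox hi)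
    rw [← two_mul] at h
    convert! h using 1
    have : j = i + n - m := eq_sub_of_add_eq hji
    rw [this]
    abel
  have hind := (ProbabilityTheory.iIndepFun_infinitePi (P := fun _ : LatticeZ d => μ)
    (X := fun _ x => x) (fun _ => measurable_id)).indepFun_finset (T n) (T m) hdisj
    (fun i => measurable_pi_apply i)
  have hcomp := hind.comp
    (φ := fun ρ => F (shiftPotential n (extendZero (T n) ρ)))
    (ψ := fun ρ => F (shiftPotential m (extendZero (T m) ρ)))
    (hF.comp ((measurePreserving_shiftPotential μ n).measurable.comp (measurable_extendZero _)))
    (hF.comp ((measurePreserving_shiftPotential μ m).measurable.comp (measurable_extendZero _)))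
  have e : ∀ a : LatticeZ d, ((fun ρ => F (shiftPotential a (extendZero (T a) ρ))) ∘
      fun (ω : LatticeZ d → ℝ) (i : T a) => ω i) = fun ω => F (shiftPotential a ω) := fun a => by
    funext ω
    refine hk _ _ fun j hj => ?_
    have : j + a ∈ T a := Finset.mem_image_of_mem _ hj
    simp [shiftPotential, extendZero, this]
  rw [e, e] at hcomp
  exact hcomp

/-- Only pairs of sites with `n - m` in the cube of radius `2 * k` are correlated, so the variance
is of the order of the number of sites, and not of its square. -/
theorem IsLocal.variance_sum_le (hF : Measurable F) (hk : IsLocal k F)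
    (h2 : MemLp F 2 (potentialLaw d μ)) (L : ℕ) :
    ProbabilityTheory.variance (fun ω => ∑ n ∈ latticeBox d L, F (shiftPotential n ω))
      (potentialLaw d μ) ≤
      (latticeBox d L).card * ((latticeBox d (2 * k)).card *
        ProbabilityTheory.variance F (potentialLaw d μ)) := by
  classical
  set V := ProbabilityTheory.variance F (potentialLaw d μ) with hV
  have hV0 : 0 ≤ V := ProbabilityTheory.variance_nonneg _ _
  have hL2 : ∀ n : LatticeZ d,
      MemLp (fun ω => F (shiftPotential n ω)) 2 (potentialLaw d μ) := fun n =>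
    h2.comp_measurePreserving (measurePreserving_shiftPotential μ n)
  have hVn : ∀ n : LatticeZ d,
      ProbabilityTheory.variance (fun ω => F (shiftPotential n ω)) (potentialLaw d μ) = V :=
    fun n => (measurePreserving_shiftPotential μ n).variance_fun_comp hF.aemeasurable
  have hcov : ∀ n m : LatticeZ d, ProbabilityTheory.covariance (fun ω => F (shiftPotential n ω))
      (fun ω => F (shiftPotential m ω)) (potentialLaw d μ) ≤
      if n - m ∈ latticeBox d (2 * k) then V else 0 := by
    intro n m
    split_ifs with h
    · have h1 := ProbabilityTheory.variance_fun_sub (hL2 n) (hL2 m)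
      have h3 := ProbabilityTheory.variance_nonneg
        (fun ω => F (shiftPotential n ω) - F (shiftPotential m ω)) (potentialLaw d μ)
      rw [h1, hVn, hVn] at h3
      linarith
    · exact ((hk.indepFun_shiftPotential hF h).covariance_eq_zero (hL2 n) (hL2 m)).le
  rw [ProbabilityTheory.variance_fun_sum' fun n _ => hL2 n, ← nsmul_eq_mul]
  refine Finset.sum_le_card_nsmul _ _ _ fun n _ => ?_
  refine (Finset.sum_le_sum fun m _ => hcov n m).trans ?_
  rw [← Finset.sum_filter, Finset.sum_const, nsmul_eq_mul]
  refine mul_le_mul_of_nonneg_right ?_ hV0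
  rw [Nat.cast_le]
  exact Finset.card_le_card_of_injOn (fun m => n - m) (fun m hm => (Finset.mem_filter.1 hm).2)
    (sub_right_injective.injOn)

/-- Averages of `F` over cubes. -/
def boxAverage (F : (LatticeZ d → ℝ) → ℝ) (L : ℕ) (ω : LatticeZ d → ℝ) : ℝ :=
  (∑ n ∈ latticeBox d L, F (shiftPotential n ω)) / (latticeBox d L).card

theorem card_latticeBox_pos (d L : ℕ) : (0 : ℝ) < (latticeBox d L).card := by
  rw [card_latticeBox]
  positivity

/-- Consecutive squares have asymptotically equal cubes; this is what allows convergence along the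
squares to be interpolated. -/
theorem tendsto_ratio_sq (d : ℕ) : Tendsto (fun j : ℕ =>
    ((latticeBox d ((j + 1) ^ 2)).card : ℝ) / (latticeBox d (j ^ 2)).card) atTop (𝓝 1) := by
  have h : Tendsto (fun j : ℕ => (2 * ((j : ℝ) + 1) ^ 2 + 1) / (2 * (j : ℝ) ^ 2 + 1)) atTop
      (𝓝 1) := by
    have h6 : Tendsto (fun j : ℕ => 1 + 6 * (1 / ((j : ℝ) + 1))) atTop (𝓝 1) := by
      simpa using (tendsto_one_div_add_atTop_nhds_zero_nat (𝕜 := ℝ)).const_mul 6 |>.const_add 1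
    refine tendsto_of_tendsto_of_tendsto_of_le_of_le tendsto_const_nhds h6 (fun j => ?_)
      (fun j => ?_)
    · rw [le_div_iff₀ (by positivity)]
      nlinarith [(Nat.cast_nonneg j : (0 : ℝ) ≤ j)]
    · have hj : (0 : ℝ) ≤ j := Nat.cast_nonneg j
      simp only
      rw [div_le_iff₀ (by positivity), mul_one_div, ← sub_nonneg]
      have : (1 + 6 / ((j : ℝ) + 1)) * (2 * (j : ℝ) ^ 2 + 1) - (2 * ((j : ℝ) + 1) ^ 2 + 1) =
          (8 * (j : ℝ) ^ 2 - 6 * j + 4) / ((j : ℝ) + 1) := by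
        field_simp
        ring
      rw [this]
      refine div_nonneg ?_ (by positivity)
      nlinarith [sq_nonneg ((j : ℝ) - 1)]
  have h' := h.pow d
  rw [one_pow] at h'
  refine h'.congr fun j => ?_
  rw [card_latticeBox, card_latticeBox, div_pow]
  push_cast
  rfl

/-- Interpolation of convergence along the squares, for monotone sequences. -/
theorem tendsto_of_monotone_of_tendsto_sq (d : ℕ) {u : ℕ → ℝ} (hu : Monotone u) (h0 : ∀ L, 0 ≤ u L)
    {c : ℝ} (h : Tendsto (fun j : ℕ => u (j ^ 2) / (latticeBox d (j ^ 2)).card) atTop (𝓝 c)) :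
    Tendsto (fun L : ℕ => u L / (latticeBox d L).card) atTop (𝓝 c) := by
  have hsqrt : Tendsto Nat.sqrt atTop atTop := by
    refine tendsto_atTop_atTop.2 fun b => ⟨b ^ 2, fun a ha => ?_⟩
    exact Nat.le_sqrt'.2 ha
  have hr := tendsto_ratio_sq d
  have hcard : ∀ {a b : ℕ}, a ≤ b → ((latticeBox d a).card : ℝ) ≤ (latticeBox d b).card :=
    fun hab => by exact_mod_cast Finset.card_le_card (latticeBox_mono hab)
  have hup : Tendsto (fun j : ℕ => u ((j + 1) ^ 2) / (latticeBox d (j ^ 2)).card) atTop (𝓝 c) := by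
    have := (h.comp (tendsto_add_atTop_nat 1)).mul hr
    rw [mul_one] at this
    refine this.congr fun j => ?_
    exact div_mul_div_cancel₀ (card_latticeBox_pos d _).ne'
  have hlo : Tendsto (fun j : ℕ => u (j ^ 2) / (latticeBox d ((j + 1) ^ 2)).card) atTop (𝓝 c) := by
    have := h.div hr one_ne_zero
    rw [div_one] at this
    refine this.congr fun j => ?_
    exact div_div_div_cancel_right₀ (card_latticeBox_pos d _).ne' _ _
  refine tendsto_of_tendsto_of_tendsto_of_le_of_le (hlo.comp hsqrt) (hup.comp hsqrt)
    (fun L => ?_) (fun L => ?_)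
  · have h1 : L.sqrt ^ 2 ≤ L := Nat.sqrt_le' L
    have h2 : L ≤ (L.sqrt + 1) ^ 2 := (Nat.lt_succ_sqrt' L).le
    exact div_le_div₀ (h0 _) (hu h1) (card_latticeBox_pos d L) (hcard h2)
  · have h1 : L.sqrt ^ 2 ≤ L := Nat.sqrt_le' L
    have h2 : L ≤ (L.sqrt + 1) ^ 2 := (Nat.lt_succ_sqrt' L).le
    exact div_le_div₀ (h0 _) (hu h2) (card_latticeBox_pos d _) (hcard h1)

/-- The law of large numbers for nonnegative functions, where the sums are monotone in the cube.
The variance of the average over the cube of radius `j ^ 2` is `O(1 / j ^ 2)` for `d ≥ 1`, hence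
summable. -/
theorem ae_tendsto_boxAverage_of_nonneg (hd : 1 ≤ d) (hF : Measurable F) (hk : IsLocal k F)
    (h2 : MemLp F 2 (potentialLaw d μ)) (hpos : ∀ ω, 0 ≤ F ω) :
    ∀ᵐ ω ∂(potentialLaw d μ), Tendsto (fun L => boxAverage F L ω) atTop
      (𝓝 (∫ ω, F ω ∂(potentialLaw d μ))) := by
  set E := ∫ ω, F ω ∂(potentialLaw d μ) with hE
  set V := ProbabilityTheory.variance F (potentialLaw d μ) with hV
  have hV0 : 0 ≤ V := ProbabilityTheory.variance_nonneg _ _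
  have hL2 : ∀ n : LatticeZ d,
      MemLp (fun ω => F (shiftPotential n ω)) 2 (potentialLaw d μ) := fun n =>
    h2.comp_measurePreserving (measurePreserving_shiftPotential μ n)
  have hsum : ∀ L, MemLp (fun ω => ∑ n ∈ latticeBox d L, F (shiftPotential n ω)) 2
      (potentialLaw d μ) := fun L => memLp_finsetSum _ fun n _ => hL2 n
  have hmean : ∀ L, ∫ ω, ∑ n ∈ latticeBox d L, F (shiftPotential n ω) ∂(potentialLaw d μ) =
      (latticeBox d L).card * E := by
    intro L
    rw [integral_finsetSum _ fun n _ => (hL2 n).integrable (by simp)]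
    have : ∀ n ∈ latticeBox d L,
        ∫ ω, F (shiftPotential n ω) ∂(potentialLaw d μ) = E := fun n _ => by
      rw [hE, ← (measurePreserving_shiftPotential μ n).map_eq, integral_map
        (measurePreserving_shiftPotential μ n).measurable.aemeasurable hF.aestronglyMeasurable,
        (measurePreserving_shiftPotential μ n).map_eq]
    rw [Finset.sum_congr rfl this, Finset.sum_const, nsmul_eq_mul]
  -- the squared deviations along the squares are summable in mean
  set X : ℕ → (LatticeZ d → ℝ) → ℝ := fun j ω => (boxAverage F (j ^ 2) ω - E) ^ 2 with hX
  have hXint : ∀ j, Integrable (X j) (potentialLaw d μ) := fun j => by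
    refine MemLp.integrable_sq (MemLp.sub ?_ (memLp_const E))
    have h := (hsum (j ^ 2)).mul_const ((latticeBox d (j ^ 2)).card : ℝ)⁻¹
    simp only [← div_eq_mul_inv] at h
    exact h
  have hXle : ∀ j, ∫ ω, X j ω ∂(potentialLaw d μ) ≤
      ((latticeBox d (2 * k)).card * V * 2) * (1 / ((j : ℝ) + 1) ^ 2) := by
    intro j
    have hN := card_latticeBox_pos d (j ^ 2)
    have h1 : ∫ ω, X j ω ∂(potentialLaw d μ) =
        ProbabilityTheory.variance (fun ω => ∑ n ∈ latticeBox d (j ^ 2), F (shiftPotential n ω))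
          (potentialLaw d μ) / ((latticeBox d (j ^ 2)).card : ℝ) ^ 2 := by
      rw [ProbabilityTheory.variance_eq_integral (hsum _).1.aemeasurable, hmean, ← integral_div]
      refine integral_congr_ae (Eventually.of_forall fun ω => ?_)
      simp only [hX, boxAverage]
      field_simp
    have h3 := hk.variance_sum_le hF h2 (j ^ 2)
    have hNj : ((j : ℝ) + 1) ^ 2 / 2 ≤ (latticeBox d (j ^ 2)).card := by
      rw [card_latticeBox]
      push_cast
      have : (2 * (j : ℝ) ^ 2 + 1) ^ 1 ≤ (2 * (j : ℝ) ^ 2 + 1) ^ d :=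
        pow_le_pow_right₀ (by nlinarith [sq_nonneg (j : ℝ)]) hd
      nlinarith [sq_nonneg ((j : ℝ) - 1)]
    calc ∫ ω, X j ω ∂(potentialLaw d μ)
        ≤ ((latticeBox d (j ^ 2)).card * ((latticeBox d (2 * k)).card * V)) /
          ((latticeBox d (j ^ 2)).card : ℝ) ^ 2 := by
          rw [h1]; exact div_le_div_of_nonneg_right h3 (by positivity)
      _ = (latticeBox d (2 * k)).card * V * (1 / (latticeBox d (j ^ 2)).card) := by
          field_simp
      _ ≤ (latticeBox d (2 * k)).card * V * (1 / (((j : ℝ) + 1) ^ 2 / 2)) := by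
          refine mul_le_mul_of_nonneg_left ?_ (by positivity)
          exact one_div_le_one_div_of_le (by positivity) hNj
      _ = _ := by field_simp
  have hsummable : Summable fun j => ∫ ω, X j ω ∂(potentialLaw d μ) := by
    refine Summable.of_nonneg_of_le (fun j => integral_nonneg fun ω => sq_nonneg _) hXle
      (Summable.mul_left _ ?_)
    have := (summable_nat_add_iff 1).2 (Real.summable_one_div_nat_pow.2 one_lt_two)
    simpa using this
  filter_upwards [ae_tendsto_zero_of_summable_integral hXint (fun j ω => sq_nonneg _) hsummable]
    with ω hω
  have h4 : Tendsto (fun j : ℕ => boxAverage F (j ^ 2) ω) atTop (𝓝 E) := by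
    have h5 := hω.sqrt
    rw [Real.sqrt_zero] at h5
    simp only [hX, Real.sqrt_sq_eq_abs] at h5
    have h6 := (tendsto_zero_iff_abs_tendsto_zero _).2 h5
    simpa using h6.add_const E
  refine tendsto_of_monotone_of_tendsto_sq d
    (u := fun L => ∑ n ∈ latticeBox d L, F (shiftPotential n ω)) (fun a b hab => ?_)
    (fun L => Finset.sum_nonneg fun n _ => hpos _) h4
  exact Finset.sum_le_sum_of_subset_of_nonneg (latticeBox_mono hab) fun n _ _ => hpos _

/-- **Law of large numbers** for local functions of an i.i.d. field on `ℤ^d`. -/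
theorem ae_tendsto_boxAverage (hd : 1 ≤ d) (hF : Measurable F) (hk : IsLocal k F)
    (h2 : MemLp F 2 (potentialLaw d μ)) :
    ∀ᵐ ω ∂(potentialLaw d μ), Tendsto (fun L => boxAverage F L ω) atTop
      (𝓝 (∫ ω, F ω ∂(potentialLaw d μ))) := by
  have hp := ae_tendsto_boxAverage_of_nonneg (μ := μ) (F := fun ω => max (F ω) 0) hd
    (hF.max measurable_const) (fun ω ω' h => congrArg (fun t => max t 0) (hk ω ω' h))
    h2.pos_part (fun ω => le_max_right _ _)
  have hn := ae_tendsto_boxAverage_of_nonneg (μ := μ) (F := fun ω => max (-F ω) 0) hd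
    (hF.neg.max measurable_const) (fun ω ω' h => congrArg (fun t => max (-t) 0) (hk ω ω' h))
    h2.neg_part (fun ω => le_max_right _ _)
  filter_upwards [hp, hn] with ω h3 h4
  have hF0 : ∀ ω, F ω = max (F ω) 0 - max (-F ω) 0 := fun ω => by
    rcases le_total (F ω) 0 with h | h
    · rw [max_eq_right h, max_eq_left (by linarith)]; ring
    · rw [max_eq_left h, max_eq_right (by linarith)]; ring
  have h5 : ∫ ω, F ω ∂(potentialLaw d μ) = (∫ ω, max (F ω) 0 ∂(potentialLaw d μ)) -
      ∫ ω, max (-F ω) 0 ∂(potentialLaw d μ) := by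
    rw [← integral_sub (h2.pos_part.integrable (by simp)) (h2.neg_part.integrable (by simp))]
    exact integral_congr_ae (Eventually.of_forall hF0)
  rw [h5]
  refine (h3.sub h4).congr fun L => ?_
  simp only [boxAverage]
  rw [← sub_div, ← Finset.sum_sub_distrib]
  congr 1
  exact Finset.sum_congr rfl fun n _ => (hF0 _).symm

end LawOfLargeNumbers

/-! ### Moment bounds and spectral measures at the origin -/

section Moments

variable {d : ℕ} {S : Set (LatticeZ d)} {ω ω' : LatticeZ d → ℝ} {m n : LatticeZ d} {k : ℕ}

/-- A local function of the potential that dominates all entries of the `k`-th powers of the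
(restricted) Hamiltonian in the column of the origin. -/
def orbitBound (k : ℕ) (ω : LatticeZ d → ℝ) : ℝ := ∑ j ∈ latticeBox d k, (2 * d + |ω j|) ^ k

theorem orbitBound_nonneg (k : ℕ) (ω : LatticeZ d → ℝ) : 0 ≤ orbitBound k ω :=
  Finset.sum_nonneg fun _ _ => by positivity

theorem zero_mem_latticeBox (d L : ℕ) : (0 : LatticeZ d) ∈ latticeBox d L := by
  rw [mem_latticeBox]
  simp

theorem norm_restrictedOrbit_le_orbitBound (S : Set (LatticeZ d)) (ω : LatticeZ d → ℝ)
    (m n : LatticeZ d) (k : ℕ) :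
    ‖restrictedOrbit S ω m k n‖ ≤ orbitBound k (shiftPotential m ω) := by
  obtain ⟨j, hj, hmax⟩ := (latticeBox d k).exists_max_image (fun j => |shiftPotential m ω j|)
    ⟨0, zero_mem_latticeBox d k⟩
  refine (norm_restrictedOrbit_le (abs_nonneg (shiftPotential m ω j)) fun i hi => ?_).trans ?_
  · simpa [shiftPotential] using hmax _ hi
  · exact Finset.single_le_sum (f := fun j => (2 * (d : ℝ) + |shiftPotential m ω j|) ^ k)
      (fun _ _ => by positivity) hj

theorem isLocal_orbitBound (k : ℕ) : IsLocal k (orbitBound (d := d) k) := fun ω ω' h =>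
  Finset.sum_congr rfl fun j hj => by rw [h j hj]

theorem isLocal_originMoment (k : ℕ) : IsLocal k (originMoment (d := d) k) := fun ω ω' h => by
  rw [originMoment, originMoment, restrictedOrbit_congr (ω' := ω')]
  intro j hj
  exact h j (by simpa using hj)

theorem measurable_orbitBound (k : ℕ) : Measurable (orbitBound (d := d) k) :=
  Finset.measurable_fun_sum _ fun j _ =>
    ((measurable_pi_apply j).norm.const_add (2 * (d : ℝ))).pow_const k

theorem measurable_originMoment (k : ℕ) : Measurable (originMoment (d := d) k) :=
  Complex.measurable_re.comp (measurable_restrictedOrbit _ _ _ _)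

theorem abs_originMoment_le (k : ℕ) (ω : LatticeZ d → ℝ) :
    |originMoment k ω| ≤ orbitBound k ω := by
  have h := norm_restrictedOrbit_le_orbitBound Set.univ ω 0 0 k
  have h0 : shiftPotential 0 ω = ω := by
    funext j
    simp [shiftPotential]
  rw [h0] at h
  exact (Complex.abs_re_le_norm _).trans h

variable {μ : Measure ℝ} [IsProbabilityMeasure μ]

theorem integrable_const_add_abs_pow (hμ : MomentCondition μ) {c : ℝ} (hc : 0 ≤ c) (k : ℕ) :
    Integrable (fun x : ℝ => (c + |x|) ^ k) μ := by
  refine (((integrable_const (c ^ k)).add (hμ.1 k)).const_mul (2 ^ (k - 1))).mono' (by fun_prop)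
    (Eventually.of_forall fun x => ?_)
  rw [Real.norm_of_nonneg (by positivity)]
  exact add_pow_le hc (abs_nonneg x) k

theorem integrable_site_pow (hμ : MomentCondition μ) (j : LatticeZ d) (k : ℕ) :
    Integrable (fun ω : LatticeZ d → ℝ => (2 * (d : ℝ) + |ω j|) ^ k) (potentialLaw d μ) :=
  (measurePreserving_eval_infinitePi (fun _ : LatticeZ d => μ) j).integrable_comp_of_integrable
    (integrable_const_add_abs_pow hμ (by positivity) k)

theorem integral_site_pow (j : LatticeZ d) (k : ℕ) :
    ∫ ω : LatticeZ d → ℝ, (2 * (d : ℝ) + |ω j|) ^ k ∂(potentialLaw d μ) =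
      ∫ x, (2 * (d : ℝ) + |x|) ^ k ∂μ := by
  have h := measurePreserving_eval_infinitePi (fun _ : LatticeZ d => μ) j
  conv_rhs => rw [← h.map_eq]
  rw [integral_map h.measurable.aemeasurable (by fun_prop)]
  rfl

theorem memLp_orbitBound (hμ : MomentCondition μ) (k : ℕ) :
    MemLp (orbitBound (d := d) k) 2 (potentialLaw d μ) := by
  refine memLp_finsetSum _ fun j _ => ?_
  refine (memLp_two_iff_integrable_sq (integrable_site_pow hμ j k).aestronglyMeasurable).2 ?_
  simp only [← pow_mul]
  exact integrable_site_pow hμ j _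

theorem memLp_originMoment (hμ : MomentCondition μ) (k : ℕ) :
    MemLp (originMoment (d := d) k) 2 (potentialLaw d μ) :=
  (memLp_orbitBound hμ k).mono (measurable_originMoment k).aestronglyMeasurable
    (Eventually.of_forall fun ω => by
      rw [Real.norm_eq_abs, Real.norm_of_nonneg (orbitBound_nonneg k ω)]
      exact abs_originMoment_le k ω)

/-- The factor `k ^ k` of the moment condition is of the order of `k !`, and the number of sites
of the cube of radius `k` grows only polynomially. -/
theorem exists_integral_orbitBound_le (d : ℕ) (hμ : MomentCondition μ) :
    ∃ C b : ℝ, 0 < b ∧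
      ∀ k : ℕ, ∫ ω, orbitBound (d := d) k ω ∂(potentialLaw d μ) ≤ C * b ^ k * k.factorial := by
  obtain ⟨hint, C, a, hC, ha, hCa⟩ := id hμ
  refine ⟨d.factorial * Real.exp 1 * (1 + C),
    Real.exp 1 ^ 2 * (2 * Real.exp 1 * (2 * d + a)), by positivity, fun k => ?_⟩
  have hk1 : ((k : ℝ) ^ k) ≤ k.factorial * Real.exp 1 ^ k := by
    have h := Real.pow_div_factorial_le_exp (x := (k : ℝ)) (Nat.cast_nonneg k) k
    rw [div_le_iff₀ (by positivity)] at h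
    rw [← Real.exp_nat_mul, mul_one, mul_comm]
    exact h
  have hk2 : ((latticeBox d k).card : ℝ) ≤ d.factorial * Real.exp 1 * (Real.exp 1 ^ 2) ^ k := by
    have h := Real.pow_div_factorial_le_exp (x := ((2 * k + 1 : ℕ) : ℝ)) (Nat.cast_nonneg _) d
    rw [div_le_iff₀ (by positivity)] at h
    rw [card_latticeBox]
    have e : Real.exp ((2 * k + 1 : ℕ) : ℝ) = Real.exp 1 * (Real.exp 1 ^ 2) ^ k := by
      rw [← pow_mul, ← pow_succ', ← Real.exp_nat_mul, mul_one]
    rw [e] at h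
    push_cast at h ⊢
    linarith
  have hone : (1 : ℝ) ≤ k.factorial * Real.exp 1 ^ k :=
    one_le_mul_of_one_le_of_one_le (by exact_mod_cast k.factorial_pos)
      (one_le_pow₀ (Real.one_le_exp zero_le_one))
  have hsite : ∫ x, (2 * (d : ℝ) + |x|) ^ k ∂μ ≤
      (1 + C) * (2 * Real.exp 1 * (2 * d + a)) ^ k * k.factorial := by
    have h1 : ∫ x, (2 * (d : ℝ) + |x|) ^ k ∂μ ≤ 2 ^ k * ((2 * d) ^ k + ∫ x, |x| ^ k ∂μ) := by
      have h2 : ∫ x, (2 : ℝ) ^ k * ((2 * d) ^ k + |x| ^ k) ∂μ =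
          2 ^ k * ((2 * d) ^ k + ∫ x, |x| ^ k ∂μ) := by
        rw [integral_const_mul, integral_add (integrable_const _) (hint k)]
        simp
      rw [← h2]
      refine integral_mono (integrable_const_add_abs_pow hμ (by positivity) k)
        (((integrable_const _).add (hint k)).const_mul _) fun x => ?_
      refine (add_pow_le (by positivity) (abs_nonneg x) k).trans ?_
      exact mul_le_mul_of_nonneg_right (pow_le_pow_right₀ one_le_two (Nat.sub_le k 1))
        (by positivity)
    have h3 : (2 * (d : ℝ)) ^ k ≤ (2 * d + a) ^ k * (k.factorial * Real.exp 1 ^ k) := by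
      have : (2 * (d : ℝ)) ^ k ≤ (2 * d + a) ^ k := pow_le_pow_left₀ (by positivity) (by linarith) k
      exact this.trans (le_mul_of_one_le_right (by positivity) hone)
    have h4 : ∫ x, |x| ^ k ∂μ ≤ C * (2 * d + a) ^ k * (k.factorial * Real.exp 1 ^ k) := by
      refine (hCa k).trans (mul_le_mul ?_ hk1 (by positivity) (by positivity))
      refine mul_le_mul_of_nonneg_left (pow_le_pow_left₀ (by positivity) ?_ k) (by positivity)
      have : (0 : ℝ) ≤ d := Nat.cast_nonneg d
      linarith
    refine h1.trans ((mul_le_mul_of_nonneg_left (add_le_add h3 h4) (by positivity)).trans_eq ?_)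
    rw [mul_pow, mul_pow]
    ring
  simp only [orbitBound]
  rw [integral_finsetSum _ fun j _ => integrable_site_pow hμ j k]
  simp only [integral_site_pow]
  rw [Finset.sum_const, nsmul_eq_mul]
  refine (mul_le_mul hk2 hsite (integral_nonneg fun x => by positivity)
    (by positivity)).trans_eq ?_
  rw [mul_pow (Real.exp 1 ^ 2)]
  ring

end Moments

section SpectralMeasures

variable {d : ℕ}

/-- The spectral measure of `H^ω` at the origin. -/
def originSpectralMeasure (ω : LatticeZ d → ℝ) : Measure ℝ :=
  spectralMeasureAt (andersonOperator ω) (latticeDelta 0)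

instance (ω : LatticeZ d → ℝ) : IsProbabilityMeasure (originSpectralMeasure ω) := by
  obtain ⟨P, -, h⟩ := exists_spectralMeasureAt_eq ω
  rw [originSpectralMeasure, h]
  refine ⟨?_⟩
  rw [P.diag_univ, latticeDelta, lp.norm_single (by norm_num)]
  simp

theorem integrable_pow_originSpectralMeasure (ω : LatticeZ d → ℝ) (k : ℕ) :
    Integrable (fun x : ℝ => x ^ k) (originSpectralMeasure ω) := by
  obtain ⟨P, hP, h⟩ := exists_spectralMeasureAt_eq ω
  rw [originSpectralMeasure, h]
  exact integrable_pow_diag hP k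

theorem integral_pow_originSpectralMeasure (ω : LatticeZ d → ℝ) (k : ℕ) :
    ∫ x, x ^ k ∂(originSpectralMeasure ω) = originMoment k ω := by
  obtain ⟨P, hP, h⟩ := exists_spectralMeasureAt_eq ω
  rw [originSpectralMeasure, h]
  exact integral_pow_diag hP k

theorem originMoment_two_mul_nonneg (k : ℕ) (ω : LatticeZ d → ℝ) :
    0 ≤ originMoment (2 * k) ω := by
  rw [← integral_pow_originSpectralMeasure]
  exact integral_nonneg fun x => (even_two_mul k).pow_nonneg x

/-- The spectral measure at the origin of the Hamiltonian on the cube of radius `L`. -/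
def cubeSpectralMeasure (L : ℕ) (ω : LatticeZ d → ℝ) : Measure ℝ :=
  matrixSpectralMeasure (andersonMatrix_isHermitian ω L) ⟨0, zero_mem_latticeBox d L⟩

instance (L : ℕ) (ω : LatticeZ d → ℝ) : IsProbabilityMeasure (cubeSpectralMeasure L ω) :=
  isProbabilityMeasure_matrixSpectralMeasure _ _

theorem integrable_cubeSpectralMeasure (L : ℕ) (ω : LatticeZ d → ℝ) (f : ℝ → ℝ) :
    Integrable f (cubeSpectralMeasure L ω) :=
  integrable_matrixSpectralMeasure _ _ _

theorem integral_pow_cubeSpectralMeasure (L k : ℕ) (ω : LatticeZ d → ℝ) :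
    ∫ x, x ^ k ∂(cubeSpectralMeasure L ω) =
      (restrictedOrbit (latticeBox d L) ω 0 k 0).re := by
  rw [cubeSpectralMeasure, integral_pow_matrixSpectralMeasure, andersonMatrix_pow_apply]

/-- A growth condition on the moments at the origin that makes the moment problem determinate. -/
def HasMomentGrowth (ω : LatticeZ d → ℝ) : Prop :=
  ∃ C b : ℝ, 0 < b ∧ ∀ k : ℕ, originMoment (2 * k) ω ≤ C * b ^ (2 * k) * (2 * k).factorial

/-- By finite propagation, the moments of the spectral measure in the cube of radius `L` are
eventually equal to those in infinite volume. -/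
theorem tendsto_integral_cubeSpectralMeasure {ω : LatticeZ d → ℝ} (hω : HasMomentGrowth ω)
    {f : ℝ → ℝ} (hf : Continuous f) {P : Polynomial ℝ} (hP : ∀ x, |f x| ≤ P.eval x) :
    Tendsto (fun L => ∫ x, f x ∂(cubeSpectralMeasure L ω)) atTop
      (𝓝 (∫ x, f x ∂(originSpectralMeasure ω))) := by
  obtain ⟨C, b, hb, hC⟩ := hω
  refine tendsto_integral_of_tendsto_moments (fun L k => integrable_cubeSpectralMeasure L ω _)
    (integrable_pow_originSpectralMeasure ω) (fun k => ?_) hb (C := C) (fun k => ?_) hf hP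
  · refine tendsto_const_nhds.congr' ?_
    filter_upwards [eventually_ge_atTop k] with L hL
    rw [integral_pow_originSpectralMeasure, integral_pow_cubeSpectralMeasure, originMoment,
      restrictedOrbit_eq_univ (S := (latticeBox d L : Set (LatticeZ d)))]
    intro j hj
    rw [sub_zero] at hj
    exact latticeBox_mono hL hj
  · rw [integral_pow_originSpectralMeasure]
    exact hC k

/-- The expected moments grow at most like `b ^ (2 * k) (2 * k)!`, and doubling `b` makes the
quotients summable, hence almost surely bounded. -/
theorem ae_hasMomentGrowth {μ : Measure ℝ} [IsProbabilityMeasure μ] (hμ : MomentCondition μ) :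
    ∀ᵐ ω ∂(potentialLaw d μ), HasMomentGrowth ω := by
  obtain ⟨C, b, hb, hC⟩ := exists_integral_orbitBound_le d hμ
  have hint : ∀ k : ℕ, Integrable (originMoment (d := d) k) (potentialLaw d μ) := fun k =>
    (memLp_originMoment hμ k).integrable (by simp)
  have h := ae_tendsto_zero_of_summable_integral (P := potentialLaw d μ)
    (X := fun j ω => originMoment (2 * j) ω / ((2 * b) ^ (2 * j) * (2 * j).factorial))
    (fun j => (hint _).div_const _)
    (fun j ω => div_nonneg (originMoment_two_mul_nonneg j ω) (by positivity)) ?_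
  · filter_upwards [h] with ω hω
    obtain ⟨B, hB⟩ := hω.bddAbove_range
    refine ⟨B, 2 * b, by positivity, fun k => ?_⟩
    have := hB ⟨k, rfl⟩
    simp only at this
    rwa [div_le_iff₀ (by positivity), ← mul_assoc] at this
  · refine Summable.of_nonneg_of_le (fun j => integral_nonneg fun ω =>
      div_nonneg (originMoment_two_mul_nonneg j ω) (by positivity)) (fun j => ?_)
      ((summable_geometric_of_lt_one (r := (1 / 4 : ℝ)) (by norm_num) (by norm_num)).mul_left C)
    have h1 : ∫ ω, originMoment (d := d) (2 * j) ω ∂(potentialLaw d μ) ≤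
        C * b ^ (2 * j) * (2 * j).factorial :=
      (integral_mono (hint _) ((memLp_orbitBound hμ _).integrable (by simp))
        fun ω => (le_abs_self _).trans (abs_originMoment_le _ ω)).trans (hC _)
    rw [integral_div, div_le_iff₀ (by positivity)]
    refine h1.trans_eq ?_
    rw [mul_pow, pow_mul 2 2 j, one_div, inv_pow]
    norm_num
    field_simp

/-- The eigenvalues and eigenvectors are not chosen measurably in `ω`, but the moments are
polynomials in the potential, and `f` can be approximated by polynomials on compact sets containing
the spectrum. -/
theorem measurable_integral_cubeSpectralMeasure (L : ℕ) {f : ℝ → ℝ} (hf : Continuous f) :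
    Measurable fun ω : LatticeZ d → ℝ => ∫ x, f x ∂(cubeSpectralMeasure L ω) := by
  have hp : ∀ p : Polynomial ℝ,
      Measurable fun ω : LatticeZ d → ℝ => ∫ x, p.eval x ∂(cubeSpectralMeasure L ω) := by
    intro p
    have : ∀ ω : LatticeZ d → ℝ, ∫ x, p.eval x ∂(cubeSpectralMeasure L ω) =
        ∑ k ∈ Finset.range (p.natDegree + 1),
          p.coeff k * (restrictedOrbit (latticeBox d L) ω 0 k 0).re := fun ω => by
      simp only [Polynomial.eval_eq_sum_range]
      rw [integral_finsetSum _ fun k _ => integrable_cubeSpectralMeasure L ω _]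
      simp only [integral_const_mul, integral_pow_cubeSpectralMeasure]
    simp only [this]
    exact Finset.measurable_fun_sum _ fun k _ =>
      (Complex.measurable_re.comp (measurable_restrictedOrbit _ _ _ _)).const_mul _
  choose p hpf using fun j : ℕ => exists_polynomial_near_of_continuousOn (-j) j f hf.continuousOn
    (1 / ((j : ℝ) + 1)) (by positivity)
  refine measurable_of_tendsto_metrizable (fun j => hp (p j)) ?_
  rw [tendsto_pi_nhds]
  intro ω
  simp only [cubeSpectralMeasure, integral_matrixSpectralMeasure]
  refine tendsto_finsetSum _ fun i _ => Tendsto.const_mul _ ?_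
  rw [tendsto_iff_norm_sub_tendsto_zero]
  set x := (andersonMatrix_isHermitian ω L).eigenvalues i
  refine squeeze_zero' (Eventually.of_forall fun _ => norm_nonneg _) ?_
    (tendsto_one_div_add_atTop_nhds_zero_nat (𝕜 := ℝ))
  obtain ⟨N, hN⟩ := exists_nat_ge |x|
  filter_upwards [eventually_ge_atTop N] with j hj
  have hjx : |x| ≤ j := hN.trans (by exact_mod_cast hj)
  exact (hpf j x (abs_le.1 hjx)).le

end SpectralMeasures

/-! ### The density of states -/

section DensityOfStates

open ProbabilityTheory

variable {d : ℕ} {μ : Measure ℝ} [IsProbabilityMeasure μ]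

/-- The spectral measure at the origin depends measurably on the potential, up to a null set: where
the moments grow moderately, it is the weak limit of the spectral measures in finite volume. -/
theorem exists_measurable_ae_eq_originSpectralMeasure (d : ℕ) (hμ : MomentCondition μ) :
    ∃ κ : Kernel (LatticeZ d → ℝ) ℝ, IsMarkovKernel κ ∧
      ∀ᵐ ω ∂(potentialLaw d μ), κ ω = originSpectralMeasure ω := by
  classical
  obtain ⟨G, hG, hGm, hGω⟩ := (ae_hasMomentGrowth (d := d) hμ).exists_measurable_mem
  let κ : (LatticeZ d → ℝ) → Measure ℝ := fun ω =>
    if ω ∈ G then originSpectralMeasure ω else Measure.dirac 0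
  have hprob : ∀ ω, IsProbabilityMeasure (κ ω) := fun ω => by
    by_cases h : ω ∈ G
    · simp only [κ, if_pos h]; infer_instance
    · simp only [κ, if_neg h]; infer_instance
  have hcont : ∀ f : ℝ → ℝ, Continuous f → (∀ x, |f x| ≤ 1) →
      Measurable fun ω => ∫ x, f x ∂(κ ω) := by
    intro f hf h1
    refine measurable_of_tendsto_metrizable
      (f := fun L ω => if ω ∈ G then ∫ x, f x ∂(cubeSpectralMeasure L ω) else f 0)
      (fun L => Measurable.ite hGm (measurable_integral_cubeSpectralMeasure L hf) measurable_const)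
      ?_
    rw [tendsto_pi_nhds]
    intro ω
    by_cases h : ω ∈ G
    · simp only [κ, if_pos h]
      exact tendsto_integral_cubeSpectralMeasure (hGω ω h) hf (P := 1) (by simpa using h1)
    · simp only [κ, if_neg h, integral_dirac]
      exact tendsto_const_nhds
  -- closed sets are approximated from above by continuous functions
  have hκ : Measurable κ := by
    refine Measurable.measure_of_isPiSystem_of_isProbabilityMeasure
      (by rw [BorelSpace.measurable_eq (α := ℝ), borel_eq_generateFrom_isClosed])
      isPiSystem_isClosed fun F hF => ?_
    have hpos : ∀ n : ℕ, (0 : ℝ) < 1 / ((n : ℝ) + 1) := fun n => by positivity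
    refine measurable_of_tendsto_metrizable (f := fun n ω =>
      ENNReal.ofReal (∫ x, (thickenedIndicator (hpos n) F x : ℝ) ∂(κ ω))) (fun n => ?_) ?_
    · refine (hcont _ (by fun_prop) fun x => ?_).ennreal_ofReal
      rw [abs_of_nonneg NNReal.zero_le_coe]
      exact_mod_cast thickenedIndicator_le_one (hpos n) F x
    · rw [tendsto_pi_nhds]
      intro ω
      refine (tendsto_lintegral_thickenedIndicator_of_isClosed (κ ω) hF hpos
        tendsto_one_div_add_atTop_nhds_zero_nat).congr fun n => ?_
      rw [lintegral_coe_eq_integral _ (integrable_thickenedIndicator F (hpos n))]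
  refine ⟨⟨κ, hκ⟩, ⟨hprob⟩, ?_⟩
  filter_upwards [hG] with ω hω
  exact if_pos hω

/-- The density of states measure: the average of the spectral measure at the origin. -/
theorem exists_densityOfStates (d : ℕ) (hμ : MomentCondition μ) :
    ∃ ν : Measure ℝ, IsProbabilityMeasure ν ∧
      ∀ f : ℝ → ℝ, Continuous f → (∃ P : Polynomial ℝ, ∀ x, |f x| ≤ P.eval x) →
        Integrable f ν ∧
        Integrable (fun ω => ∫ x, f x ∂(originSpectralMeasure ω)) (potentialLaw d μ) ∧
        ∫ x, f x ∂ν = ∫ ω, ∫ x, f x ∂(originSpectralMeasure ω) ∂(potentialLaw d μ) := by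
  obtain ⟨κ, hκ, hκω⟩ := exists_measurable_ae_eq_originSpectralMeasure d hμ
  have hprob : IsProbabilityMeasure ((potentialLaw d μ).bind κ) := by
    infer_instance
  have hpow : ∀ k : ℕ, Integrable (fun x : ℝ => x ^ k) ((potentialLaw d μ).bind κ) := by
    refine integrable_pow_of_even fun k => ?_
    rw [Measure.integrable_comp_iff (by fun_prop)]
    constructor
    · filter_upwards [hκω] with ω hω
      rw [hω]
      exact integrable_pow_originSpectralMeasure ω _
    · refine ((memLp_originMoment (d := d) hμ (2 * k)).integrable (by simp)).congr ?_
      filter_upwards [hκω] with ω hω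
      rw [hω, ← integral_pow_originSpectralMeasure]
      refine integral_congr_ae (Eventually.of_forall fun x => ?_)
      exact (Real.norm_of_nonneg ((even_two_mul k).pow_nonneg x)).symm
  refine ⟨(potentialLaw d μ).bind κ, hprob, fun f hf ⟨P, hP⟩ => ?_⟩
  obtain ⟨A, r, hA⟩ := polynomial_eval_le_weight P
  have hfint : Integrable f ((potentialLaw d μ).bind κ) :=
    integrable_weight_mul_of_bounded hpow r hf.aestronglyMeasurable
      fun x => (hP x).trans ((le_abs_self _).trans (hA x))
  have hae : (fun ω => ∫ x, f x ∂(κ ω)) =ᵐ[potentialLaw d μ]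
      fun ω => ∫ x, f x ∂(originSpectralMeasure ω) := by
    filter_upwards [hκω] with ω hω
    rw [hω]
  have hfint' := hfint
  rw [Measure.comp_eq_comp_const_apply] at hfint'
  refine ⟨hfint, ?_, ?_⟩
  · have h := hfint'.integral_comp
    rw [Kernel.const_apply] at h
    exact h.congr hae
  · rw [← integral_congr_ae hae, Measure.comp_eq_comp_const_apply, Kernel.integral_comp hfint',
      Kernel.const_apply]

/-- The normalized counting measure of the eigenvalues of the Hamiltonian on the cube of radius `L`,
written as the average of the spectral measures at the sites of the cube. -/
def cubeDensityOfStates (L : ℕ) (ω : LatticeZ d → ℝ) : Measure ℝ :=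
  ((latticeBox d L).card : ENNReal)⁻¹ •
    ∑ n : latticeBox d L, matrixSpectralMeasure (andersonMatrix_isHermitian ω L) n

theorem integral_cubeDensityOfStates (L : ℕ) (ω : LatticeZ d → ℝ) (f : ℝ → ℝ) :
    ∫ x, f x ∂(cubeDensityOfStates L ω) =
      (∑ n : latticeBox d L, ∫ x, f x ∂(matrixSpectralMeasure (andersonMatrix_isHermitian ω L) n)) /
        (latticeBox d L).card := by
  rw [cubeDensityOfStates, integral_smul_measure,
    integral_finsetSum_measure (fun n _ => integrable_matrixSpectralMeasure _ _ _), smul_eq_mul,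
    ENNReal.toReal_inv, ENNReal.toReal_natCast, inv_mul_eq_div]

theorem integrable_cubeDensityOfStates (L : ℕ) (ω : LatticeZ d → ℝ) (f : ℝ → ℝ) :
    Integrable f (cubeDensityOfStates L ω) := by
  refine Integrable.smul_measure ?_ (by
    simp [Finset.ne_empty_of_mem (zero_mem_latticeBox d L)])
  rw [integrable_finsetSum_measure]
  exact fun n _ => integrable_matrixSpectralMeasure _ _ _

instance (L : ℕ) (ω : LatticeZ d → ℝ) : IsProbabilityMeasure (cubeDensityOfStates L ω) := by
  have h (n : latticeBox d L) :
      matrixSpectralMeasure (andersonMatrix_isHermitian ω L) n Set.univ = 1 :=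
    (isProbabilityMeasure_matrixSpectralMeasure _ n).measure_univ
  refine ⟨?_⟩
  rw [cubeDensityOfStates, Measure.smul_apply, Measure.finsetSum_apply]
  simp only [h, Finset.sum_const, Finset.card_univ, Fintype.card_coe, nsmul_eq_mul, mul_one,
    smul_eq_mul]
  refine ENNReal.inv_mul_cancel ?_ (ENNReal.natCast_ne_top _)
  have := card_latticeBox_pos d L
  exact_mod_cast this.ne'

/-- The normalized trace is the integral against the finite-volume density of states. -/
theorem trace_cfc_div_card (L : ℕ) (ω : LatticeZ d → ℝ) (f : ℝ → ℝ) :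
    (cfc f (andersonMatrix ω L)).trace / ((latticeBox d L).card : ℂ) =
      ((∫ x, f x ∂(cubeDensityOfStates L ω) : ℝ) : ℂ) := by
  rw [integral_cubeDensityOfStates, Matrix.trace]
  simp only [Matrix.diag_apply, cfc_apply_diag (andersonMatrix_isHermitian ω L)]
  push_cast
  rfl

theorem integral_pow_cubeDensityOfStates (L k : ℕ) (ω : LatticeZ d → ℝ) :
    ∫ x, x ^ k ∂(cubeDensityOfStates L ω) =
      (∑ n ∈ latticeBox d L, (restrictedOrbit (latticeBox d L) ω n k n).re) /
        (latticeBox d L).card := by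
  rw [integral_cubeDensityOfStates]
  simp only [integral_pow_matrixSpectralMeasure, andersonMatrix_pow_apply]
  rw [Finset.sum_coe_sort (latticeBox d L)
    fun n => (restrictedOrbit (latticeBox d L : Set (LatticeZ d)) ω n k n).re]

theorem originMoment_shiftPotential (k : ℕ) (n : LatticeZ d) (ω : LatticeZ d → ℝ) :
    originMoment k (shiftPotential n ω) = (restrictedOrbit Set.univ ω n k n).re := by
  have h := restrictedOrbit_translate (ω := ω) (m := 0) (n := 0) (k := k) n
  rw [zero_add] at h
  exact congrArg Complex.re h

/-- Only the sites at distance less than `k` from the boundary of the cube contribute to the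
difference between the `k`-th moment in finite volume and the average of the `k`-th moment in
infinite volume. -/
theorem abs_integral_pow_sub_boxAverage_le (L k : ℕ) (ω : LatticeZ d → ℝ) :
    |∫ x, x ^ k ∂(cubeDensityOfStates (L + k) ω) - boxAverage (originMoment k) (L + k) ω| ≤
      2 * (boxAverage (orbitBound k) (L + k) ω -
        ((latticeBox d L).card / (latticeBox d (L + k)).card) *
          boxAverage (orbitBound k) L ω) := by
  have hsub := latticeBox_mono (d := d) (Nat.le_add_right L k)
  have hrhs : 2 * (boxAverage (orbitBound k) (L + k) ω -
      ((latticeBox d L).card / (latticeBox d (L + k)).card) * boxAverage (orbitBound k) L ω) =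
      (∑ n ∈ latticeBox d (L + k) \ latticeBox d L, 2 * orbitBound k (shiftPotential n ω)) /
        (latticeBox d (L + k)).card := by
    have h0 := (card_latticeBox_pos d L).ne'
    rw [← Finset.mul_sum, Finset.sum_sdiff_eq_sub hsub, boxAverage, boxAverage]
    field_simp
  rw [hrhs, integral_pow_cubeDensityOfStates, boxAverage, ← sub_div, ← Finset.sum_sub_distrib,
    abs_div, Nat.abs_cast]
  refine div_le_div_of_nonneg_right ?_ (Nat.cast_nonneg _)
  refine (Finset.abs_sum_le_sum_abs _ _).trans ?_
  rw [← Finset.sum_sdiff hsub]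
  have hin : ∑ n ∈ latticeBox d L,
      |(restrictedOrbit (latticeBox d (L + k) : Set (LatticeZ d)) ω n k n).re -
        originMoment k (shiftPotential n ω)| = 0 := by
    refine Finset.sum_eq_zero fun n hn => ?_
    rw [originMoment_shiftPotential, restrictedOrbit_eq_univ, sub_self, abs_zero]
    intro j hj
    have := add_mem_latticeBox hn hj
    rwa [add_sub_cancel] at this
  rw [hin, add_zero]
  refine Finset.sum_le_sum fun n _ => ?_
  rw [originMoment_shiftPotential, two_mul]
  refine (abs_sub _ _).trans (add_le_add ?_ ?_) <;>
  exact (Complex.abs_re_le_norm _).trans (norm_restrictedOrbit_le_orbitBound _ _ _ _ _)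

theorem tendsto_card_latticeBox_ratio (d k : ℕ) : Tendsto (fun L : ℕ =>
    ((latticeBox d L).card : ℝ) / (latticeBox d (L + k)).card) atTop (𝓝 1) := by
  have h : Tendsto (fun L : ℕ => (2 * (L : ℝ) + 1) / (2 * ((L : ℝ) + k) + 1)) atTop (𝓝 1) := by
    have h1 : Tendsto (fun L : ℕ => 1 - 2 * k * (1 / ((L : ℝ) + 1))) atTop (𝓝 1) := by
      simpa using ((tendsto_one_div_add_atTop_nhds_zero_nat (𝕜 := ℝ)).const_mul
        (2 * (k : ℝ))).const_sub 1
    refine tendsto_of_tendsto_of_tendsto_of_le_of_le h1 tendsto_const_nhds (fun L => ?_)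
      (fun L => ?_)
    · have hL : (0 : ℝ) ≤ L := Nat.cast_nonneg L
      have hk : (0 : ℝ) ≤ k := Nat.cast_nonneg k
      have e : (2 * (L : ℝ) + 1) / (2 * ((L : ℝ) + k) + 1) =
          1 - 2 * k * (1 / (2 * ((L : ℝ) + k) + 1)) := by
        field_simp
        ring
      simp only [e]
      refine sub_le_sub_left (mul_le_mul_of_nonneg_left ?_ (by positivity)) _
      exact one_div_le_one_div_of_le (by positivity) (by linarith)
    · have hk : (0 : ℝ) ≤ k := Nat.cast_nonneg k
      exact div_le_one_of_le₀ (by linarith) (by positivity)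
  have h' := h.pow d
  rw [one_pow] at h'
  refine h'.congr fun L => ?_
  rw [card_latticeBox, card_latticeBox, div_pow]
  push_cast
  rfl

/-- The boundary terms vanish in the limit, because the averages of `orbitBound` over the cubes of
radius `L` and `L + k` have the same limit. -/
theorem tendsto_integral_pow_cubeDensityOfStates {ω : LatticeZ d → ℝ} {k : ℕ} {E E' : ℝ}
    (h : Tendsto (fun L => boxAverage (originMoment k) L ω) atTop (𝓝 E))
    (h' : Tendsto (fun L => boxAverage (orbitBound k) L ω) atTop (𝓝 E')) :
    Tendsto (fun L => ∫ x, x ^ k ∂(cubeDensityOfStates L ω)) atTop (𝓝 E) := by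
  rw [← tendsto_add_atTop_iff_nat k] at h ⊢
  have hb := ((((tendsto_add_atTop_iff_nat k).2 h').sub
    ((tendsto_card_latticeBox_ratio d k).mul h')).const_mul 2)
  rw [one_mul, sub_self, mul_zero] at hb
  have hz := squeeze_zero_norm (fun L => (Real.norm_eq_abs _).trans_le
    (abs_integral_pow_sub_boxAverage_le L k ω)) hb
  simpa using hz.add h

end DensityOfStates

end

theorem lemmaA11 (d : ℕ) (hd : 1 ≤ d) (μ : Measure ℝ) [IsProbabilityMeasure μ]
    (hμ : MomentCondition μ) :
    ∃ Ω' : Set (LatticeZ d → ℝ), MeasurableSet Ω' ∧ potentialLaw d μ Ω' = 1 ∧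
      ∀ f : ℝ → ℝ, Continuous f → (∃ P : Polynomial ℝ, ∀ x, |f x| ≤ P.eval x) →
        (∀ ω, MemLp f 2 (spectralMeasureAt (andersonOperator ω) (latticeDelta (0 : LatticeZ d)))) ∧
        Integrable (fun ω => spectralExpectation (andersonOperator ω) f
          (latticeDelta (0 : LatticeZ d))) (potentialLaw d μ) ∧
        ∀ ω ∈ Ω', Tendsto
          (fun L : ℕ => (cfc f (andersonMatrix ω L)).trace / ((latticeBox d L).card : ℂ)) atTop
          (𝓝 ((∫ ω', spectralExpectation (andersonOperator ω') f
            (latticeDelta (0 : LatticeZ d)) ∂(potentialLaw d μ) : ℝ) : ℂ)) := by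
  obtain ⟨ν, hν, hνf⟩ := exists_densityOfStates d hμ
  obtain ⟨C, b, hb, hC⟩ := exists_integral_orbitBound_le d hμ
  have hpow : ∀ k : ℕ, Integrable (fun x : ℝ => x ^ k) ν ∧
      ∫ x, x ^ k ∂ν = ∫ ω, originMoment k ω ∂(potentialLaw d μ) := by
    intro k
    have hk : ∃ P : Polynomial ℝ, ∀ x : ℝ, |x ^ k| ≤ P.eval x := by
      refine ⟨1 + Polynomial.X ^ (2 * k), fun x => ?_⟩
      simp only [Polynomial.eval_add, Polynomial.eval_one, Polynomial.eval_pow, Polynomial.eval_X]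
      rw [mul_comm 2 k, pow_mul, ← sq_abs (x ^ k)]
      nlinarith [sq_nonneg (|x ^ k| - 1)]
    obtain ⟨h1, -, h3⟩ := hνf _ (continuous_pow k) hk
    simp only [integral_pow_originSpectralMeasure] at h3
    exact ⟨h1, h3⟩
  have hae : ∀ᵐ ω ∂(potentialLaw d μ), ∀ k : ℕ,
      Tendsto (fun L => ∫ x, x ^ k ∂(cubeDensityOfStates L ω)) atTop (𝓝 (∫ x, x ^ k ∂ν)) := by
    refine ae_all_iff.2 fun k => ?_
    filter_upwards [ae_tendsto_boxAverage hd (measurable_originMoment k) (isLocal_originMoment k)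
      (memLp_originMoment hμ k), ae_tendsto_boxAverage hd (measurable_orbitBound k)
      (isLocal_orbitBound k) (memLp_orbitBound hμ k)] with ω h h'
    rw [(hpow k).2]
    exact tendsto_integral_pow_cubeDensityOfStates h h'
  obtain ⟨Ω', hΩ, hΩm, hΩω⟩ := hae.exists_measurable_mem
  refine ⟨Ω', hΩm, (prob_compl_eq_zero_iff hΩm).1 hΩ, fun f hf hfP => ⟨fun ω => ?_,
    (hνf f hf hfP).2.1, fun ω hω => ?_⟩⟩
  · obtain ⟨P, hP⟩ := hfP
    refine (memLp_two_iff_integrable_sq hf.aestronglyMeasurable).2 ?_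
    obtain ⟨A, r, hA⟩ := polynomial_eval_le_weight (P ^ 2)
    refine integrable_weight_mul_of_bounded (integrable_pow_originSpectralMeasure ω) r
      (A := A) (by fun_prop) fun x => ?_
    refine (le_trans ?_ (le_abs_self _)).trans (hA x)
    rw [abs_pow, Polynomial.eval_pow]
    exact pow_le_pow_left₀ (abs_nonneg _) (hP x) 2
  · simp only [trace_cfc_div_card]
    refine (Complex.continuous_ofReal.tendsto _).comp ?_
    simp only [spectralExpectation]
    obtain ⟨P, hP⟩ := hfP
    have hlim := tendsto_integral_of_tendsto_moments (C := C)
      (fun L k => integrable_cubeDensityOfStates L ω _) (fun k => (hpow k).1) (hΩω ω hω) hb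
      (fun k => ?_) hf hP
    · rw [(hνf f hf ⟨P, hP⟩).2.2] at hlim
      exact hlim
    · rw [(hpow _).2]
      refine le_trans ?_ (hC (2 * k))
      exact integral_mono ((memLp_originMoment hμ _).integrable (by simp))
        ((memLp_orbitBound hμ _).integrable (by simp))
        fun ω => (le_abs_self _).trans (abs_originMoment_le _ ω)
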